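/- Let $(E,d)$ be a Polish metric space, let $\mu$ be a Borel probability measure on $E$, and let $X_1,X_2,\dots$ be i.i.d. random variables with values in $E$ and law $\mu$ (for a fixed $n$, only $X_1,\dots,X_n$ are needed). Let $L_n=\frac1n\sum_{i=1}^n\delta_{X_i}$ be the empirical measure. For $p\ge 1$ let $$W_p^p(\mu,\nu)=\inf_{\pi}\int d(x,y)^p\,\pi(dx,dy),$$ where the infimum is over all probability measures $\pi$ on $E\times E$ with marginals $\mu$ and $\nu$. Fix $x_0\in E$, let $B(x_0,t)$ be the closed ball with centre $x_0$ and radius $t$, and set $$H(t)=\mu\big(B(x_0,t)^c\big),\qquad \|X\|_{q,w}^q=\sup_{t\ge0}t^qH(t),\qquad I_{2p,p}=\int_0^\infty\sqrt{H(t)}\,t^{p-1}\,dt .$$ We say that $\mu$ has a weak moment of order $q$ if $\|X\|_{q,w}^q<\infty$. Let $S\subset E$ satisfy $\mu(S)=1$. For $A\subset E$ and $\delta>0$ let $N(A,\delta)$ be the minimal number of closed balls of radius $\delta$, with centres in $A$, that cover $A$. Assume that, for some $\alpha,\beta>0$ with $\alpha\le 2p$, $$N\big(S\cap B(x_0,r),\delta\big)\le\beta\Big(\frac{2r}{\delta}\Big)^{\alpha}\qquad\text{for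 all } r>0 \text{ and } \delta\in(0,2r].$$ Below, $C_{a_1,\dots,a_k}$ denotes a positive finite constant that depends only on $a_1,\dots,a_k$. Then: 1. If $\mu$ has a weak moment of order $rp$ with $r>2$, and $\rho\in(1/2,1]$, then for any $x>0$ $$\limsup_{n\to\infty}n^{r\rho-1}\,\mathbb P\Big(W_p^p(\mu,L_n)>\frac{x}{n^{1-\rho}}\Big)\le C_{p,r}\frac{\|X\|_{rp,w}^{rp}}{x^r}.$$ 2. If $I_{2p,p}<\infty$ and $\rho\in(1/2,1]$, then for any $x>0$ $$\limsup_{n\to\infty}n^{2\rho-1}\,\mathbb P\Big(W_p^p(\mu,L_n)>\frac{x}{n^{1-\rho}}\Big)\le C_{p,\alpha,\beta}\frac{I_{2p,p}^2}{x^2}.$$ 3. If $\mu$ has a weak moment of order $rp$ with $r\in(1,2)$, and $\rho\in[1/r,1]$, then for any $x>0$ and any $n\ge1$ $$n^{r\rho-1}\,\mathbb P\Big(W_p^p(\mu,L_n)>\frac{x}{n^{1-\rho}}\Big)\le C_{p,\alpha,\beta,r}\frac{\|X\|_{rp,w}^{rp}}{x^r}.$$ -/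

import Mathlib

open Set Filter MeasureTheory ProbabilityTheory
open scoped NNReal ENNReal

universe u v

/-- The tail function `H(t) = μ(B(x₀, t)ᶜ)`, with `B(x₀, t)` the closed ball. -/
noncomputable def tailFun {E : Type*} [MetricSpace E] [MeasurableSpace E]
    (μ : Measure E) (x₀ : E) (t : ℝ) : ℝ≥0∞ :=
  μ (Metric.closedBall x₀ t)ᶜ

/-- The `q`-th power `‖X‖_{q,w}^q = sup_{t ≥ 0} t^q H(t)` of the weak moment of order `q` of a
random variable `X` with law `μ`, as an extended nonnegative number. -/
noncomputable def weakMomentPow {E : Type*} [MetricSpace E] [MeasurableSpace E]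
    (μ : Measure E) (x₀ : E) (q : ℝ) : ℝ≥0∞ :=
  ⨆ (t : ℝ) (_ : 0 ≤ t), ENNReal.ofReal (t ^ q) * tailFun μ x₀ t

/-- The integral `I_{2p,p} = ∫_0^∞ √H(t) t^(p-1) dt`, as an extended nonnegative number. -/
noncomputable def sqrtTailIntegral {E : Type*} [MetricSpace E] [MeasurableSpace E]
    (μ : Measure E) (x₀ : E) (p : ℝ) : ℝ≥0∞ :=
  ∫⁻ t in Ioi (0 : ℝ), tailFun μ x₀ t ^ (1 / 2 : ℝ) * ENNReal.ofReal (t ^ (p - 1))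

/-- The `p`-th power `W_p^p(μ, ν)` of the Wasserstein distance: the infimum of
`∫ d(x, y)^p π(dx, dy)` over all couplings `π` of `μ` and `ν`. (If `μ` is a probability measure,
every measure with first marginal `μ` is one.) -/
noncomputable def wassersteinPow {E : Type*} [MetricSpace E] [MeasurableSpace E]
    (p : ℝ) (μ ν : Measure E) : ℝ≥0∞ :=
  ⨅ (π : Measure (E × E)) (_ : π.fst = μ ∧ π.snd = ν), ∫⁻ z, edist z.1 z.2 ^ p ∂π

/-- The empirical measure `(1/n) ∑_{i} δ_{x_i}` of the points `x_0, …, x_{n-1}`. -/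
noncomputable def empiricalMeasure {E : Type*} [MeasurableSpace E] {n : ℕ} (x : Fin n → E) :
    Measure E :=
  (n : ℝ≥0∞)⁻¹ • ∑ i, Measure.dirac (x i)

/-- The random variables `X i` are independent and identically distributed with law `μ`. -/
structure IsIIDWithLaw {ι Ω E : Type*} [MeasurableSpace Ω] [MeasurableSpace E]
    (X : ι → Ω → E) (μ : Measure E) (P : Measure Ω) : Prop where
  measurable : ∀ i, Measurable (X i)
  law : ∀ i, P.map (X i) = μ
  indep : iIndepFun X P

/-- `S` is of finite-dimensional type around `x₀` with covering dimension `α` and constant `β`: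
`N(S ∩ B(x₀, r), δ) ≤ β (2r/δ)^α` for all `r > 0` and `δ ∈ (0, 2r]`. Here `N(A, δ)` is the
minimal number of closed balls of radius `δ` centred in `A` that cover `A`. -/
def HasCoveringDim {E : Type*} [MetricSpace E] (S : Set E) (x₀ : E) (α β : ℝ) : Prop :=
  ∀ r : ℝ, 0 < r → ∀ δ : ℝ≥0, 0 < δ → (δ : ℝ) ≤ 2 * r →
    ((Metric.coveringNumber δ (S ∩ Metric.closedBall x₀ r) : ℕ∞) : ℝ≥0∞)
      ≤ ENNReal.ofReal (β * (2 * r / δ) ^ α)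

/-! ### Couplings obtained by greedy matching inside partitions -/

section Transport

variable {E : Type*} [MeasurableSpace E]

/-! Put y = x n^ρ; the event becomes n W_p^p > y. The ball of radius R₀ is cut into dyadic rings B_j
of radius r_j = R₀/2^j, and each ring carries nested finite partitions, from a very fine one (level
0) to the trivial one (level K). Mass of μ and of the empirical measure is matched greedily: first
inside the finest cells, then the leftovers inside the next coarser cells, and so on. What remains
in a ring at the end, and all mass outside R₀, travels through x₀. This gives the pathwise bound
`natCast_mul_wassersteinPow_le`: n W_p^p is at most a weighted sum of the deviations |nμ(F) - #{i :
x_i ∈ F}| over all cells F, plus a resolution error, plus the p-th moments of the mass outside R₀.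

The weighted sum is a function of n independent points. Replacing a point changes it by at most the
sum of the influences of the old and the new point, where the influence is of order r_j^p on ring j.
Integrating out one coordinate at a time (`integral_comp_sub_le_iterate`) bounds its variance and
its exponential moments by means of n ∑ r_j^(2p) μ(B_j).

For the mean, a level with cells of relative size 2^(-l) has at most a constant times 4^(pl) cells,
because α ≤ 2p, and weight of order r_j^p 2^(-pl). By Cauchy–Schwarz it contributes a multiple of
r_j^p √(n μ(B_j)), whatever l is. Summing over the rings gives a discretised I_{2p,p}; summing over
K ~ log n levels costs a logarithm, harmless when ρ > 1/2.

The three statements differ in the cut-off and in the concentration inequality. For r > 2, R₀^p =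
√n. The exponential bound makes the inner part negligible, and so is the event that more than k
points leave the ball, once k is large in terms of r. At most k outer points can cost too much only
if one of them is of order (y/k)^(1/p). The probability of this single large jump is n H(s), which
gives a constant depending on p and r alone. For I_{2p,p} < ∞, R₀^p = n². The outside is negligible
and Chebyshev's inequality gives the main term. For r < 2, R₀^p = y. Chebyshev's inequality for the
truncated part and n H(R₀) are both of order nA/y^r, where A bounds the weak moment. No logarithm is
allowed here, so the two bounds for the mean of a cell deviation are interpolated
(`exists_sum_min_le`), which restores geometric decay in the levels. -/

lemma lintegral_add_prod_le_of_rpow_triangle {E : Type*} [PseudoEMetricSpace E]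
    [MeasurableSpace E] [OpensMeasurableSpace E] {p : ℝ} (hp : 1 ≤ p)
    (μ ν : Measure E) [SFinite μ] [SFinite ν] (x₀ : E) :
    ∫⁻ z, edist z.1 z.2 ^ p ∂(μ.prod ν) ≤
      2 ^ (p - 1) * (ν univ * ∫⁻ x, edist x x₀ ^ p ∂μ + μ univ * ∫⁻ x, edist x x₀ ^ p ∂ν) := by
  have hm : Measurable fun x : E => edist x x₀ ^ p := by fun_prop
  have h1 : Measurable fun z : E × E => edist z.1 x₀ ^ p := hm.comp measurable_fst
  have h2 : Measurable fun z : E × E => edist z.2 x₀ ^ p := hm.comp measurable_snd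
  calc ∫⁻ z, edist z.1 z.2 ^ p ∂(μ.prod ν)
      ≤ ∫⁻ z, 2 ^ (p - 1) * (edist z.1 x₀ ^ p + edist z.2 x₀ ^ p) ∂(μ.prod ν) := by
        refine lintegral_mono fun z => ?_
        calc edist z.1 z.2 ^ p ≤ (edist z.1 x₀ + edist z.2 x₀) ^ p := by
              gcongr
              exact edist_triangle_right _ _ _
          _ ≤ _ := ENNReal.rpow_add_le_mul_rpow_add_rpow _ _ hp
    _ = 2 ^ (p - 1) * (∫⁻ z, edist z.1 x₀ ^ p ∂(μ.prod ν) +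
          ∫⁻ z, edist z.2 x₀ ^ p ∂(μ.prod ν)) := by
        rw [lintegral_const_mul (f := fun z : E × E => edist z.1 x₀ ^ p + edist z.2 x₀ ^ p) _ (h1.add h2), lintegral_add_left h1]
    _ = _ := by
        rw [lintegral_prod _ h1.aemeasurable, lintegral_prod _ h2.aemeasurable]
        simp only [lintegral_const]
        rw [lintegral_mul_const _ hm, mul_comm (ν univ), mul_comm (μ univ)]

/-- Two finite measures can be matched inside the cells of a finite partition until in each cell at
most one of them has mass left. -/
lemma exists_cell_matching {ι : Type*} [MeasurableSpace ι] [MeasurableSingletonClass ι]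
    (μ ν : Measure E) [IsFiniteMeasure μ] [IsFiniteMeasure ν] {T : E → ι} (hT : Measurable T)
    (A : Finset ι) (hA : ∀ x, T x ∈ A) :
    ∃ (π : Measure (E × E)) (μ' ν' : Measure E), μ = π.fst + μ' ∧ ν = π.snd + ν' ∧
      π {z | T z.1 ≠ T z.2} = 0 ∧
      (∀ i, μ' (T ⁻¹' {i}) = μ (T ⁻¹' {i}) - ν (T ⁻¹' {i})) ∧
      (∀ i, ν' (T ⁻¹' {i}) = ν (T ⁻¹' {i}) - μ (T ⁻¹' {i})) := by
  classical
  have hF : ∀ i, MeasurableSet (T ⁻¹' {i}) := fun i => hT (measurableSet_singleton i)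
  have hsum : ∀ η : Measure E, η = ∑ i ∈ A, η.restrict (T ⁻¹' {i}) := by
    intro η
    ext s hs
    rw [Measure.finsetSum_apply]
    simp_rw [Measure.restrict_apply hs]
    rw [← measure_biUnion_finset]
    · congr 1
      ext x
      simp [hA]
    · intro i _ j _ hij
      refine Set.disjoint_left.2 fun x hx hx' => hij ?_
      rw [← hx.2, ← hx'.2]
    · exact fun i _ => hs.inter (hF i)
  set m : ι → ℝ≥0∞ := fun i => μ (T ⁻¹' {i}) with hm
  set k : ι → ℝ≥0∞ := fun i => ν (T ⁻¹' {i}) with hk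
  have hmt : ∀ i, m i ≠ ∞ := fun i => measure_ne_top _ _
  have hkt : ∀ i, k i ≠ ∞ := fun i => measure_ne_top _ _
  -- Cells of zero mass need no exclusion: the minimum vanishes there, and 0 times ∞ is 0 in `ℝ≥0∞`.
  have key1 : ∀ i, min (m i) (k i) * (m i)⁻¹ * (k i)⁻¹ * k i = min (m i) (k i) * (m i)⁻¹ := by
    intro i
    rcases eq_or_ne (k i) 0 with h | h
    · simp [h]
    · rw [mul_assoc, ENNReal.inv_mul_cancel h (hkt i), mul_one]
  have key2 : ∀ i, min (m i) (k i) * (m i)⁻¹ * (k i)⁻¹ * m i = min (m i) (k i) * (k i)⁻¹ := by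
    intro i
    rcases eq_or_ne (m i) 0 with h | h
    · simp [h]
    · rw [mul_right_comm, mul_assoc (min _ _), ENNReal.inv_mul_cancel h (hmt i), mul_one]
  have key3 : ∀ a b : ℝ≥0∞, a ≠ ∞ → min a b * a⁻¹ ≤ 1 := by
    intro a b ha
    rcases eq_or_ne a 0 with h | h
    · simp [h]
    · calc min a b * a⁻¹ ≤ a * a⁻¹ := by gcongr; exact min_le_left _ _
        _ = 1 := ENNReal.mul_inv_cancel h ha
  have key4 : ∀ a b : ℝ≥0∞, a ≠ ∞ → (1 - min a b * a⁻¹) * a = a - b := by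
    intro a b ha
    rcases eq_or_ne a 0 with h | h
    · simp [h]
    · rw [ENNReal.sub_mul (fun _ _ => ha), one_mul, mul_assoc, ENNReal.inv_mul_cancel h ha, mul_one]
      rcases le_total a b with hab | hab
      · simp [min_eq_left hab, tsub_eq_zero_of_le hab]
      · simp [min_eq_right hab]
  have hcell : ∀ (η : Measure E) (c : ι → ℝ≥0∞) (i : ι),
      (∑ j ∈ A, c j • η.restrict (T ⁻¹' {j})) (T ⁻¹' {i}) = c i * η (T ⁻¹' {i}) := by
    intro η c i
    rw [Measure.finsetSum_apply]
    simp only [Measure.smul_apply, smul_eq_mul, Measure.restrict_apply (hF i)]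
    rw [Finset.sum_eq_single i]
    · simp
    · intro j _ hj
      have : T ⁻¹' {i} ∩ T ⁻¹' {j} = ∅ := by
        ext x
        simp only [mem_inter_iff, mem_preimage, mem_singleton_iff, mem_empty_iff_false, iff_false]
        rintro ⟨h1, h2⟩
        exact hj (h2.symm.trans h1)
      simp [this]
    · intro hi
      have : T ⁻¹' {i} = ∅ := by
        ext x
        simp only [mem_preimage, mem_singleton_iff, mem_empty_iff_false, iff_false]
        rintro rfl
        exact hi (hA x)
      simp [this]
  -- In cell i the common mass min (m i) (k i) is coupled by the normalised product of the two
  -- restrictions; each marginal keeps the complementary proportion of its own restriction.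
  refine ⟨∑ i ∈ A, (min (m i) (k i) * (m i)⁻¹ * (k i)⁻¹) •
      (μ.restrict (T ⁻¹' {i})).prod (ν.restrict (T ⁻¹' {i})),
    ∑ i ∈ A, (1 - min (m i) (k i) * (m i)⁻¹) • μ.restrict (T ⁻¹' {i}),
    ∑ i ∈ A, (1 - min (k i) (m i) * (k i)⁻¹) • ν.restrict (T ⁻¹' {i}), ?_, ?_, ?_, ?_, ?_⟩
  · have : ∀ s : Finset ι, (∑ i ∈ s, (min (m i) (k i) * (m i)⁻¹ * (k i)⁻¹) •
        (μ.restrict (T ⁻¹' {i})).prod (ν.restrict (T ⁻¹' {i}))).fst =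
        ∑ i ∈ s, (min (m i) (k i) * (m i)⁻¹) • μ.restrict (T ⁻¹' {i}) := by
      intro s
      ext t ht
      rw [Measure.fst_apply ht, Measure.finsetSum_apply, Measure.finsetSum_apply]
      refine Finset.sum_congr rfl fun i _ => ?_
      rw [Measure.smul_apply, Measure.smul_apply, ← Set.prod_univ, Measure.prod_prod,
        Measure.restrict_apply_univ, smul_eq_mul, smul_eq_mul]
      change _ * (_ * k i) = _
      conv_rhs => rw [← key1 i]
      ring
    rw [this, ← Finset.sum_add_distrib]
    conv_lhs => rw [hsum μ]
    refine Finset.sum_congr rfl fun i _ => ?_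
    rw [← add_smul, add_tsub_cancel_of_le (key3 _ _ (hmt i)), one_smul]
  · have : ∀ s : Finset ι, (∑ i ∈ s, (min (m i) (k i) * (m i)⁻¹ * (k i)⁻¹) •
        (μ.restrict (T ⁻¹' {i})).prod (ν.restrict (T ⁻¹' {i}))).snd =
        ∑ i ∈ s, (min (k i) (m i) * (k i)⁻¹) • ν.restrict (T ⁻¹' {i}) := by
      intro s
      ext t ht
      rw [Measure.snd_apply ht, Measure.finsetSum_apply, Measure.finsetSum_apply]
      refine Finset.sum_congr rfl fun i _ => ?_
      rw [Measure.smul_apply, Measure.smul_apply, ← Set.univ_prod, Measure.prod_prod,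
        Measure.restrict_apply_univ, smul_eq_mul, smul_eq_mul, min_comm (k i)]
      change _ * (m i * _) = _
      conv_rhs => rw [← key2 i]
      ring
    rw [this, ← Finset.sum_add_distrib]
    conv_lhs => rw [hsum ν]
    refine Finset.sum_congr rfl fun i _ => ?_
    rw [← add_smul, add_tsub_cancel_of_le (key3 _ _ (hkt i)), one_smul]
  · rw [Measure.finsetSum_apply]
    refine Finset.sum_eq_zero fun i _ => ?_
    rw [Measure.smul_apply, Measure.prod_restrict, smul_eq_mul]
    have : ((μ.prod ν).restrict ((T ⁻¹' {i}) ×ˢ (T ⁻¹' {i}))) {z | T z.1 ≠ T z.2} = 0 := by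
      have h := ae_restrict_mem (μ := μ.prod ν) ((hF i).prod (hF i))
      refine measure_mono_null ?_ (ae_iff.1 h)
      rintro z hz ⟨h1, h2⟩
      exact hz (by rw [mem_preimage, mem_singleton_iff] at h1 h2; rw [h1, h2])
    rw [this, mul_zero]
  · intro i
    rw [hcell μ]
    exact key4 _ _ (hmt i)
  · intro i
    rw [hcell ν]
    exact key4 _ _ (hkt i)

/-- Greedy matching along a finite chain of successively coarser finite partitions. -/
lemma exists_chain_matching {E : Type*} [PseudoEMetricSpace E] [MeasurableSpace E]
    [OpensMeasurableSpace E]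
    {ι : Type*} [MeasurableSpace ι] [MeasurableSingletonClass ι] (p : ℝ)
    (μ ν : Measure E) [IsFiniteMeasure μ] [IsFiniteMeasure ν]
    {B : Set E} (hμB : μ Bᶜ = 0) (hνB : ν Bᶜ = 0)
    {T : ℕ → E → ι} (hT : ∀ e, Measurable (T e)) (A : ℕ → Finset ι) (hA : ∀ e x, T e x ∈ A e)
    (hnest : ∀ e x y, T e x = T e y → T (e + 1) x = T (e + 1) y)
    (c : ℕ → ℝ≥0∞) (K : ℕ)
    (hc : ∀ e ≤ K, ∀ x ∈ B, ∀ y ∈ B, T e x = T e y → edist x y ^ p ≤ c e) :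
    ∃ (π : Measure (E × E)) (μ' ν' : Measure E), μ = π.fst + μ' ∧ ν = π.snd + ν' ∧
      π {z | T K z.1 ≠ T K z.2} = 0 ∧
      (∀ i, μ' (T K ⁻¹' {i}) = μ (T K ⁻¹' {i}) - ν (T K ⁻¹' {i})) ∧
      (∀ i, ν' (T K ⁻¹' {i}) = ν (T K ⁻¹' {i}) - μ (T K ⁻¹' {i})) ∧
      ∫⁻ z, edist z.1 z.2 ^ p ∂π ≤ c 0 * μ univ + ∑ e ∈ Finset.range K,
        c (e + 1) * ∑ a ∈ A e, (μ (T e ⁻¹' {a}) - ν (T e ⁻¹' {a})) := by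
  have cost : ∀ (e : ℕ) (c : ℝ≥0∞) (η : Measure (E × E)),
      (∀ x ∈ B, ∀ y ∈ B, T e x = T e y → edist x y ^ p ≤ c) → η {z | T e z.1 ≠ T e z.2} = 0 →
      η.fst Bᶜ = 0 → η.snd Bᶜ = 0 → ∫⁻ z, edist z.1 z.2 ^ p ∂η ≤ c * η.fst univ := by
    intro e c η hc h0 h1 h2
    rw [Measure.fst_univ, ← lintegral_const]
    refine lintegral_mono_ae ?_
    have h1' : ∀ᵐ z ∂η, z.1 ∈ B := by
      have := ae_of_ae_map measurable_fst.aemeasurable (ae_iff.2 h1 : ∀ᵐ x ∂(η.map Prod.fst), x ∈ B)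
      exact this
    have h2' : ∀ᵐ z ∂η, z.2 ∈ B := by
      have := ae_of_ae_map measurable_snd.aemeasurable (ae_iff.2 h2 : ∀ᵐ x ∂(η.map Prod.snd), x ∈ B)
      exact this
    have h0' : ∀ᵐ z ∂η, T e z.1 = T e z.2 := ae_iff.2 h0
    filter_upwards [h0', h1', h2'] with z hz hz1 hz2
    exact hc _ hz1 _ hz2 hz
  induction K with
  | zero =>
    obtain ⟨π, μ', ν', h1, h2, h3, h4, h5⟩ := exists_cell_matching μ ν (hT 0) (A 0) (hA 0)
    refine ⟨π, μ', ν', h1, h2, h3, h4, h5, ?_⟩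
    have hle : π.fst ≤ μ := by rw [h1]; exact Measure.le_add_right le_rfl
    have hle2 : π.snd ≤ ν := by rw [h2]; exact Measure.le_add_right le_rfl
    calc _ ≤ c 0 * π.fst univ := cost 0 _ π (hc 0 le_rfl) h3
          (le_antisymm ((hle _).trans hμB.le) (by simp))
          (le_antisymm ((hle2 _).trans hνB.le) (by simp))
      _ ≤ _ := by
        simp only [Finset.range_zero, Finset.sum_empty, add_zero]
        gcongr
  | succ K ih =>
    obtain ⟨π, μ', ν', h1, h2, h3, h4, h5, h6⟩ := ih fun e he => hc e (he.trans K.le_succ)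
    have hμ' : μ' ≤ μ := by rw [h1]; exact Measure.le_add_left le_rfl
    have hν' : ν' ≤ ν := by rw [h2]; exact Measure.le_add_left le_rfl
    have : IsFiniteMeasure μ' := isFiniteMeasure_of_le _ hμ'
    have : IsFiniteMeasure ν' := isFiniteMeasure_of_le _ hν'
    obtain ⟨π₂, μ₂, ν₂, g1, g2, g3, g4, g5⟩ :=
      exists_cell_matching μ' ν' (hT (K + 1)) (A (K + 1)) (hA (K + 1))
    have hle : π₂.fst ≤ μ' := by rw [g1]; exact Measure.le_add_right le_rfl
    have hle2 : π₂.snd ≤ ν' := by rw [g2]; exact Measure.le_add_right le_rfl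
    have hlep : π.fst ≤ μ := by rw [h1]; exact Measure.le_add_right le_rfl
    have h3' : π {z | T (K + 1) z.1 ≠ T (K + 1) z.2} = 0 := by
      refine measure_mono_null ?_ h3
      intro z hz h
      exact hz (hnest K _ _ h)
    -- The pairs already matched lie in common cells of level K, hence of level K + 1. They remove
    -- equal mass from both sides of each coarser cell, so the leftover differences there are still
    -- those of μ and ν.
    have hmarg : ∀ i, π.fst (T (K + 1) ⁻¹' {i}) = π.snd (T (K + 1) ⁻¹' {i}) := by
      intro i
      have hm := hT (K + 1) (measurableSet_singleton i)
      rw [Measure.fst_apply hm, Measure.snd_apply hm]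
      refine measure_congr ?_
      have h0' : ∀ᵐ z ∂π, T (K + 1) z.1 = T (K + 1) z.2 := ae_iff.2 h3'
      filter_upwards [h0'] with z hz
      refine propext ?_
      change T (K + 1) z.1 = i ↔ T (K + 1) z.2 = i
      rw [hz]
    have hfin : ∀ i, π.snd (T (K + 1) ⁻¹' {i}) ≠ ∞ := fun i => by
      rw [← hmarg]
      exact ((hlep _).trans_lt (measure_lt_top μ _)).ne
    refine ⟨π + π₂, μ₂, ν₂, ?_, ?_, ?_, ?_, ?_, ?_⟩
    · rw [h1, g1, Measure.fst_add, add_assoc]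
    · rw [h2, g2, Measure.snd_add, add_assoc]
    · rw [Measure.add_apply, h3', g3, add_zero]
    · intro i
      rw [g4, h1, h2, Measure.add_apply, Measure.add_apply, hmarg i,
        ENNReal.add_sub_add_eq_sub_left (hfin i)]
    · intro i
      rw [g5, h1, h2, Measure.add_apply, Measure.add_apply, hmarg i,
        ENNReal.add_sub_add_eq_sub_left (hfin i)]
    · rw [lintegral_add_measure, Finset.sum_range_succ, ← add_assoc]
      refine add_le_add h6 ?_
      -- Whatever is moved at level K + 1 was unmatched at level K, so its mass is at most the sum
      -- of the excesses over the level K cells.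
      calc _ ≤ c (K + 1) * π₂.fst univ := cost (K + 1) _ π₂ (hc (K + 1) le_rfl) g3
            (le_antisymm ((hle _).trans ((hμ' _).trans hμB.le)) (by simp))
            (le_antisymm ((hle2 _).trans ((hν' _).trans hνB.le)) (by simp))
        _ ≤ c (K + 1) * μ' univ := by gcongr
        _ ≤ _ := by
          gcongr
          calc μ' univ ≤ μ' (⋃ a ∈ A K, T K ⁻¹' {a}) := by
                refine measure_mono fun x _ => ?_
                simp [hA]
            _ ≤ ∑ a ∈ A K, μ' (T K ⁻¹' {a}) := measure_biUnion_finset_le _ _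
            _ = _ := by simp_rw [h4]

/-- Finite families of partially matched pieces with a common reference point glue to a coupling. -/
lemma wassersteinPow_le_of_pieces {E : Type*} [MetricSpace E] [MeasurableSpace E]
    [OpensMeasurableSpace E] {p : ℝ} (hp : 1 ≤ p) (μ ν : Measure E)
    [IsProbabilityMeasure μ] [IsProbabilityMeasure ν] (x₀ : E) {J : Type*} (s : Finset J)
    (π : J → Measure (E × E)) (μ' ν' : J → Measure E) (ρ σ : Measure E)
    (hμ : μ = ∑ j ∈ s, ((π j).fst + μ' j) + ρ) (hν : ν = ∑ j ∈ s, ((π j).snd + ν' j) + σ) :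
    wassersteinPow p μ ν ≤ ∑ j ∈ s, ∫⁻ z, edist z.1 z.2 ^ p ∂(π j) +
      2 ^ (p - 1) * (∑ j ∈ s, (∫⁻ x, edist x x₀ ^ p ∂(μ' j) + ∫⁻ x, edist x x₀ ^ p ∂(ν' j)) +
        (∫⁻ x, edist x x₀ ^ p ∂ρ + ∫⁻ x, edist x x₀ ^ p ∂σ)) := by
  classical
  set α : Measure E := ∑ j ∈ s, μ' j + ρ with hα
  set β : Measure E := ∑ j ∈ s, ν' j + σ with hβ
  set Θ : Measure (E × E) := ∑ j ∈ s, π j with hΘ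
  have hfst : ∀ t : Finset J, (∑ j ∈ t, π j).fst = ∑ j ∈ t, (π j).fst := by
    intro t
    induction t using Finset.induction_on with
    | empty => simp [Measure.fst]
    | insert a t ha ih => rw [Finset.sum_insert ha, Finset.sum_insert ha, Measure.fst_add, ih]
  have hsnd : ∀ t : Finset J, (∑ j ∈ t, π j).snd = ∑ j ∈ t, (π j).snd := by
    intro t
    induction t using Finset.induction_on with
    | empty => simp [Measure.snd]
    | insert a t ha ih => rw [Finset.sum_insert ha, Finset.sum_insert ha, Measure.snd_add, ih]
  have hμ1 : μ = Θ.fst + α := by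
    rw [hfst, hα, ← add_assoc, ← Finset.sum_add_distrib, hμ]
  have hν1 : ν = Θ.snd + β := by
    rw [hsnd, hβ, ← add_assoc, ← Finset.sum_add_distrib, hν]
  have hαf : IsFiniteMeasure α :=
    isFiniteMeasure_of_le μ (by rw [hμ1]; exact Measure.le_add_left le_rfl)
  have hβf : IsFiniteMeasure β :=
    isFiniteMeasure_of_le ν (by rw [hν1]; exact Measure.le_add_left le_rfl)
  have hmass : α univ = β univ := by
    have h1 : Θ univ + α univ = 1 := by
      rw [← Measure.fst_univ, ← Measure.add_apply, ← hμ1, measure_univ]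
    have h2 : Θ univ + β univ = 1 := by
      rw [← Measure.snd_univ, ← Measure.add_apply, ← hν1, measure_univ]
    have hf : Θ univ ≠ ∞ := by
      intro h
      rw [h] at h1
      simp at h1
    exact (ENNReal.add_right_inj hf).1 (h1.trans h2.symm)
  -- The remainders have equal mass, so their normalised product couples them. If that mass is 0,
  -- the factor is ∞ but multiplies the zero measure.
  have hcpl : ((α univ)⁻¹ • α.prod β).fst = α ∧ ((α univ)⁻¹ • α.prod β).snd = β := by
    rcases eq_or_ne (α univ) 0 with h | h
    · have hα0 : α = 0 := Measure.measure_univ_eq_zero.1 h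
      have hβ0 : β = 0 := Measure.measure_univ_eq_zero.1 (hmass ▸ h)
      rw [hα0, hβ0]
      simp [Measure.fst, Measure.snd]
    · constructor
      · ext t ht
        rw [Measure.fst_apply ht, Measure.smul_apply, ← Set.prod_univ, Measure.prod_prod,
          smul_eq_mul, ← hmass, mul_comm (α t), ← mul_assoc,
          ENNReal.inv_mul_cancel h (measure_ne_top _ _), one_mul]
      · ext t ht
        rw [Measure.snd_apply ht, Measure.smul_apply, ← Set.univ_prod, Measure.prod_prod,
          smul_eq_mul, ← mul_assoc, ENNReal.inv_mul_cancel h (measure_ne_top _ _), one_mul]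
  have hcost : ∫⁻ z, edist z.1 z.2 ^ p ∂((α univ)⁻¹ • α.prod β) ≤
      2 ^ (p - 1) * (∫⁻ x, edist x x₀ ^ p ∂α + ∫⁻ x, edist x x₀ ^ p ∂β) := by
    rw [lintegral_smul_measure, smul_eq_mul]
    rcases eq_or_ne (α univ) 0 with h | h
    · have hα0 : α = 0 := Measure.measure_univ_eq_zero.1 h
      simp [hα0]
    · calc _ ≤ (α univ)⁻¹ * (2 ^ (p - 1) * (β univ * ∫⁻ x, edist x x₀ ^ p ∂α +
            α univ * ∫⁻ x, edist x x₀ ^ p ∂β)) := by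
            gcongr
            exact lintegral_add_prod_le_of_rpow_triangle hp α β x₀
        _ = ((α univ)⁻¹ * α univ) * (2 ^ (p - 1) * (∫⁻ x, edist x x₀ ^ p ∂α +
            ∫⁻ x, edist x x₀ ^ p ∂β)) := by rw [← hmass]; ring
        _ = _ := by rw [ENNReal.inv_mul_cancel h (measure_ne_top _ _), one_mul]
  calc wassersteinPow p μ ν
      ≤ ∫⁻ z, edist z.1 z.2 ^ p ∂(Θ + (α univ)⁻¹ • α.prod β) := by
        refine iInf₂_le _ ⟨?_, ?_⟩
        · rw [Measure.fst_add, hcpl.1, ← hμ1]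
        · rw [Measure.snd_add, hcpl.2, ← hν1]
    _ ≤ ∫⁻ z, edist z.1 z.2 ^ p ∂Θ +
        2 ^ (p - 1) * (∫⁻ x, edist x x₀ ^ p ∂α + ∫⁻ x, edist x x₀ ^ p ∂β) := by
        rw [lintegral_add_measure]
        gcongr
    _ = _ := by
        rw [hα, hβ, hΘ, lintegral_add_measure, lintegral_add_measure,
          lintegral_finsetSum_measure, lintegral_finsetSum_measure, lintegral_finsetSum_measure,
          Finset.sum_add_distrib]
        congr 2
        ring

end Transport

/-! ### Nested measurable partitions from nets -/

section Nets

variable {E : Type*} [MetricSpace E] [MeasurableSpace E] [BorelSpace E]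
  [SecondCountableTopology E]

lemma exists_measurable_nearest (A : Finset E) (hA : A.Nonempty) :
    ∃ g : E → E, Measurable g ∧ ∀ x, g x ∈ A ∧ ∀ a ∈ A, dist x (g x) ≤ dist x a := by
  classical
  induction hA using Finset.Nonempty.cons_induction with
  | singleton a => exact ⟨fun _ => a, measurable_const, fun x => by simp⟩
  | cons a s ha hs ih =>
    obtain ⟨g, hg, h⟩ := ih
    refine ⟨fun x => if dist x (g x) ≤ dist x a then g x else a,
      Measurable.ite (measurableSet_le (by fun_prop) (by fun_prop)) hg measurable_const,
      fun x => ?_⟩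
    by_cases hx : dist x (g x) ≤ dist x a
    · simp only [hx, if_true, Finset.mem_cons]
      refine ⟨Or.inr (h x).1, ?_⟩
      rintro b (rfl | hb)
      · exact hx
      · exact (h x).2 b hb
    · simp only [hx, if_false, Finset.mem_cons]
      refine ⟨Or.inl trivial, ?_⟩
      rintro b (rfl | hb)
      · exact le_rfl
      · exact (not_le.1 hx).le.trans ((h x).2 b hb)

omit [MeasurableSpace E] [BorelSpace E] [SecondCountableTopology E] in
lemma HasCoveringDim.exists_net {S : Set E} {x₀ : E} {α β : ℝ} (hS : HasCoveringDim S x₀ α β)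
    {r : ℝ} (hr : 0 < r) {δ : ℝ} (hδ : 0 < δ) (hδr : δ ≤ 2 * r) :
    ∃ A : Finset E, ↑A ⊆ S ∩ Metric.closedBall x₀ r ∧
      (∀ x ∈ S ∩ Metric.closedBall x₀ r, ∃ a ∈ A, dist x a ≤ δ) ∧
      (A.card : ℝ≥0∞) ≤ ENNReal.ofReal (β * (2 * r / δ) ^ α) := by
  lift δ to ℝ≥0 using hδ.le
  have h := hS r hr δ (by exact_mod_cast hδ) hδr
  have hne : Metric.coveringNumber δ (S ∩ Metric.closedBall x₀ r) ≠ ⊤ := by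
    intro h'
    rw [h'] at h
    simp at h
  obtain ⟨C, hCA, hCf, hC, hcard⟩ := Metric.exists_set_encard_eq_coveringNumber hne
  refine ⟨hCf.toFinset, by simpa using hCA, ?_, ?_⟩
  · intro x hx
    obtain ⟨a, ha, hxa⟩ := hC hx
    refine ⟨a, by simpa using ha, ?_⟩
    rw [dist_edist]
    exact ENNReal.toReal_le_of_le_ofReal δ.2 (by simpa using hxa)
  · rw [← hcard, hCf.encard_eq_coe_toFinset_card] at h
    simpa using h

/-- A covering dimension bound at a ball gives a nested sequence of finite partitions of a measurable
set covering the ball up to the exceptional set, from finest to coarsest. -/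
lemma HasCoveringDim.exists_nested_partition {S : Set E} {x₀ : E} {α β p : ℝ}
    (hS : HasCoveringDim S x₀ α β) (hp : 0 ≤ p) (hα : α ≤ 2 * p) (hβ : 0 < β)
    {r : ℝ} (hr : 0 < r) (K : ℕ) :
    ∃ (B : Set E) (T : ℕ → E → E) (A : ℕ → Finset E), MeasurableSet B ∧
      S ∩ Metric.closedBall x₀ r ⊆ B ∧ (∀ e, Measurable (T e)) ∧ (∀ e x, T e x ∈ A e) ∧
      (∀ e x y, T e x = T e y → T (e + 1) x = T (e + 1) y) ∧ A K = {x₀} ∧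
      (∀ e ≤ K, ((A e).card : ℝ) ≤ (β + 1) * ((4 : ℝ) ^ p) ^ (K - e)) ∧
      ∀ e ≤ K, ∀ x ∈ B ∩ Metric.closedBall x₀ r, ∀ y ∈ B ∩ Metric.closedBall x₀ r,
        T e x = T e y → dist x y ≤ 8 * r / 2 ^ (K - e) := by
  classical
  rcases (S ∩ Metric.closedBall x₀ r).eq_empty_or_nonempty with hemp | hne
  · refine ⟨∅, fun _ _ => x₀, fun _ => {x₀}, MeasurableSet.empty, hemp.le, fun _ => measurable_const,
      by simp, by simp, rfl, ?_, by simp⟩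
    intro e he
    have h1 : (1 : ℝ) ≤ ((4 : ℝ) ^ p) ^ (K - e) :=
      one_le_pow₀ (Real.one_le_rpow (by norm_num) hp)
    simp only [Finset.card_singleton, Nat.cast_one]
    nlinarith
  -- The mesh doubles from each level e < K to the next. The centres lie in S ∩ B(x₀, r), so that
  -- each net is itself covered by the next one.
  · have hnet : ∀ e : ℕ, ∃ A : Finset E, ↑A ⊆ S ∩ Metric.closedBall x₀ r ∧
        (∀ x ∈ S ∩ Metric.closedBall x₀ r, ∃ a ∈ A, dist x a ≤ 2 * r / 2 ^ (K - e)) ∧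
        (A.card : ℝ) ≤ β * ((4 : ℝ) ^ p) ^ (K - e) := by
      intro e
      have h2 : (1 : ℝ) ≤ 2 ^ (K - e) := one_le_pow₀ (by norm_num)
      obtain ⟨A, h1, h3, h4⟩ := hS.exists_net hr (δ := 2 * r / 2 ^ (K - e)) (by positivity)
        (div_le_self (by positivity) h2)
      refine ⟨A, h1, h3, ?_⟩
      have h5 : 2 * r / (2 * r / 2 ^ (K - e)) = 2 ^ (K - e) := by field_simp
      rw [h5, ← ENNReal.ofReal_natCast, ENNReal.ofReal_le_ofReal_iff (by positivity)] at h4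
      refine h4.trans ?_
      gcongr
      -- The exponent condition α ≤ 2p enters here and nowhere deeper: cell counts grow at most like
      -- 4^p per level.
      calc ((2 : ℝ) ^ (K - e)) ^ α ≤ ((2 : ℝ) ^ (K - e)) ^ (2 * p) :=
            Real.rpow_le_rpow_of_exponent_le h2 hα
        _ = ((4 : ℝ) ^ p) ^ (K - e) := by
            rw [Real.rpow_mul (by positivity), Real.rpow_two, ← pow_mul, mul_comm (K - e), pow_mul,
              ← Real.rpow_natCast ((4 : ℝ) ^ p), ← Real.rpow_mul (by norm_num), mul_comm p,
              Real.rpow_mul (by norm_num), Real.rpow_natCast]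
            norm_num
    choose A hAS hAcov hAcard using hnet
    have hAne : ∀ e, (A e).Nonempty := fun e => by
      obtain ⟨x, hx⟩ := hne
      obtain ⟨a, ha, -⟩ := hAcov e x hx
      exact ⟨a, ha⟩
    choose g hg hgA using fun e => exists_measurable_nearest (A e) (hAne e)
    set A' : ℕ → Finset E := fun e => if e < K then A e else {x₀} with hA'
    set g' : ℕ → E → E := fun e => if e < K then g e else fun _ => x₀ with hg'
    have hg'm : ∀ e, Measurable (g' e) := fun e => by
      by_cases h : e < K
      · simp [hg', h, hg e]
      · simp [hg', h]
    have hg'A : ∀ e x, g' e x ∈ A' e := fun e x => by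
      by_cases h : e < K
      · simp [hg', hA', h, (hgA e x).1]
      · simp [hg', hA', h]
    -- Each label is the nearest net point to the previous label, not to x itself; this makes the
    -- partitions nested automatically.
    set T : ℕ → E → E := fun e => Nat.rec (g' 0) (fun e t => g' (e + 1) ∘ t) e with hT
    have hT0 : T 0 = g' 0 := rfl
    have hTs : ∀ e, T (e + 1) = g' (e + 1) ∘ T e := fun e => rfl
    have hTm : ∀ e, Measurable (T e) := fun e => by
      induction e with
      | zero => exact hg'm 0
      | succ e ih => exact (hg'm (e + 1)).comp ih
    have hTA : ∀ e x, T e x ∈ A' e := fun e x => by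
      cases e with
      | zero => exact hg'A 0 x
      | succ e => exact hg'A (e + 1) (T e x)
    -- The set S need not be measurable, so S ∩ B(x₀, r) is replaced by the measurable set of points
    -- close to their first label.
    refine ⟨{x | dist x (g' 0 x) ≤ 2 * r / 2 ^ K}, T, A',
      measurableSet_le (measurable_id.dist (hg'm 0)) measurable_const, ?_, hTm, hTA, ?_,
      by simp [hA'], ?_, ?_⟩
    · intro x hx
      by_cases h : 0 < K
      · obtain ⟨a, ha, hxa⟩ := hAcov 0 x hx
        simpa [hg', h] using ((hgA 0 x).2 a ha).trans hxa
      · have hK : K = 0 := by omega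
        have := hx.2
        rw [Metric.mem_closedBall] at this
        simp only [hg', hK, lt_self_iff_false, if_false, mem_ofPred_eq, pow_zero, div_one]
        linarith
    · intro e x y hxy
      rw [hTs, Function.comp_apply, Function.comp_apply, hxy]
    · intro e he
      have h1 : (1 : ℝ) ≤ ((4 : ℝ) ^ p) ^ (K - e) :=
        one_le_pow₀ (Real.one_le_rpow (by norm_num) hp)
      by_cases h : e < K
      · simp only [hA', h, if_true]
        have := hAcard e
        nlinarith
      · simp only [hA', h, if_false, Finset.card_singleton, Nat.cast_one]
        nlinarith
    -- The steps from x along its labels have geometrically growing lengths, so the distance to the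
    -- label is at most twice the current mesh. Two points with the same label are then within four
    -- meshes, which is the constant 8.
    · have hclose : ∀ e < K, ∀ x, dist x (g' 0 x) ≤ 2 * r / 2 ^ K →
          dist x (T e x) ≤ 2 * (2 * r / 2 ^ (K - e)) := by
        intro e
        induction e with
        | zero =>
          intro _ x hx
          rw [hT0, Nat.sub_zero]
          have : 0 ≤ 2 * r / 2 ^ K := by positivity
          linarith
        | succ e ih =>
          intro he x hx
          have h1 := ih (by omega) x hx
          have h2 : T e x ∈ S ∩ Metric.closedBall x₀ r := by
            have := hTA e x
            simp only [hA', show e < K by omega, if_true] at this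
            exact hAS e this
          obtain ⟨a, ha, hxa⟩ := hAcov (e + 1) _ h2
          have h3 : dist (T e x) (T (e + 1) x) ≤ 2 * r / 2 ^ (K - (e + 1)) := by
            rw [hTs, Function.comp_apply]
            simp only [hg', he, if_true]
            exact ((hgA (e + 1) (T e x)).2 a ha).trans hxa
          have h4 : (2 : ℝ) ^ (K - e) = 2 ^ (K - (e + 1)) * 2 := by
            rw [← pow_succ]
            congr 1
            omega
          have h5 : 2 * (2 * r / 2 ^ (K - e)) = 2 * r / 2 ^ (K - (e + 1)) := by
            rw [h4]
            field_simp
          rw [h5] at h1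
          linarith [dist_triangle x (T e x) (T (e + 1) x)]
      rintro e he x ⟨hx, hxb⟩ y ⟨hy, hyb⟩ hxy
      rcases he.lt_or_eq with h | rfl
      · have h1 := hclose e h x hx
        have h2 := hclose e h y hy
        rw [← hxy] at h2
        have h3 := dist_triangle_right x y (T e x)
        calc dist x y ≤ 2 * (2 * (2 * r / 2 ^ (K - e))) := by linarith
          _ = _ := by ring
      · rw [Metric.mem_closedBall] at hxb hyb
        have h3 := dist_triangle_right x y x₀
        simp only [Nat.sub_self, pow_zero, div_one]
        linarith

end Nets

/-! ### Concentration for functions of independent points -/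

section Concentration

variable {E : Type*} [MeasurableSpace E]

lemma integral_pi_succ (μ : Measure E) [IsProbabilityMeasure μ] {n : ℕ}
    (F : (Fin (n + 1) → E) → ℝ)
    (hF : Integrable F (Measure.pi fun _ : Fin (n + 1) => μ)) :
    ∫ x, F x ∂(Measure.pi fun _ : Fin (n + 1) => μ) =
      ∫ y, ∫ a, F (Fin.cons a y) ∂μ ∂(Measure.pi fun _ : Fin n => μ) := by
  have hmp := (measurePreserving_piFinSuccAbove (fun _ : Fin (n + 1) => μ) 0).symm
  rw [← hmp.integral_comp']
  have hint := (hmp.integrable_comp_emb (MeasurableEquiv.measurableEmbedding _)).2 hF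
  change ∫ z, (F ∘ (MeasurableEquiv.piFinSuccAbove (fun _ => E) 0).symm) z ∂_ = _
  rw [integral_prod_symm _ hint]
  simp only [Function.comp_apply, MeasurableEquiv.piFinSuccAbove_symm_apply, Fin.insertNthEquiv,
    Equiv.coe_fn_mk, Fin.insertNth_zero']

lemma integral_quadratic (μ : Measure E) [IsProbabilityMeasure μ] {h : E → ℝ} (a b c : ℝ)
    (hi : Integrable h μ) (hi2 : Integrable (fun x => h x ^ 2) μ) :
    ∫ x, (a + b * h x + c * h x ^ 2) ∂μ = a + b * ∫ x, h x ∂μ + c * ∫ x, h x ^ 2 ∂μ := by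
  rw [integral_add (f := fun x => a + b * h x) ((integrable_const _).add (hi.const_mul _))
    (hi2.const_mul _), integral_add (integrable_const _) (hi.const_mul _), integral_const_mul,
    integral_const_mul]
  simp

/-- Generic tensorization: if `Φ` can be controlled under adding one centred increment, then
it can be controlled along a function of `n` independent variables with bounded differences. -/
lemma integral_comp_sub_le_iterate (μ : Measure E) [IsProbabilityMeasure μ] {g : E → ℝ}
    {Φ : ℝ → ℝ} (hΦ : Continuous Φ) {a b : ℝ} (hb : 0 ≤ b)
    (hstep : ∀ (h : E → ℝ) (c : ℝ), Measurable h → (∀ x, |h x| ≤ g x + ∫ y, g y ∂μ) →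
      ∫ x, h x ∂μ = 0 → ∫ x, Φ (c + h x) ∂μ ≤ a + b * Φ c)
    (hg : Integrable g μ) (n : ℕ) (f : (Fin n → E) → ℝ) (hf : Measurable f)
    {C : ℝ} (hC : ∀ x, |f x| ≤ C)
    (hfg : ∀ x i y, |f x - f (Function.update x i y)| ≤ g (x i) + g y) (m : ℝ)
    (hm : ∫ x, f x ∂(Measure.pi fun _ : Fin n => μ) = m) :
    ∫ x, Φ (f x - m) ∂(Measure.pi fun _ : Fin n => μ) ≤ (fun u => a + b * u)^[n] (Φ 0) := by
  have hΦb : ∀ R : ℝ, ∃ D, ∀ u, |u| ≤ R → |Φ u| ≤ D := by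
    intro R
    obtain ⟨D, hD⟩ := (isCompact_Icc (a := -R) (b := R)).exists_bound_of_continuousOn
      hΦ.continuousOn
    exact ⟨D, fun u hu => hD u ⟨neg_le_of_abs_le hu, le_of_abs_le hu⟩⟩
  have hint : ∀ {X : Type _} [MeasurableSpace X] (η : Measure X) [IsProbabilityMeasure η]
      (k : X → ℝ) (R : ℝ), Measurable k → (∀ x, |k x| ≤ R) → Integrable k η := by
    intro X _ η _ k R hk hR
    exact Integrable.of_bound hk.aestronglyMeasurable R (ae_of_all _ hR)
  induction n generalizing m with
  | zero =>
    have : ∀ x : Fin 0 → E, f x = m := by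
      intro x
      have h1 : f = fun _ => f x := by
        funext y
        rw [Subsingleton.elim y x]
      rw [h1] at hm
      simpa using hm
    simp [this]
  | succ n ih =>
    have hcons : Measurable fun z : (Fin n → E) × E => (Fin.cons z.2 z.1 : Fin (n + 1) → E) := by
      refine measurable_pi_lambda _ fun i => ?_
      refine Fin.cases ?_ (fun j => ?_) i
      · simpa using measurable_snd
      · simp only [Fin.cons_succ]
        exact (measurable_pi_apply j).comp measurable_fst
    -- Averaging out the first coordinate leaves a function of n coordinates with the same mean, the
    -- same bound and the same influence function g.
    set fb : (Fin n → E) → ℝ := fun y => ∫ t, f (Fin.cons t y) ∂μ with hfb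
    have hfc : ∀ y, Measurable fun t => f (Fin.cons t y) := fun y =>
      hf.comp (hcons.comp (measurable_const.prodMk measurable_id))
    have hfi : ∀ y, Integrable (fun t => f (Fin.cons t y)) μ := fun y =>
      hint μ _ C (hfc y) fun t => hC _
    have hfbm : Measurable fb :=
      (((hf.comp hcons).stronglyMeasurable).integral_prod_right' (ν := μ)).measurable
    have hfbC : ∀ y, |fb y| ≤ C := fun y => by
      have := norm_integral_le_of_norm_le_const (μ := μ) (f := fun t => f (Fin.cons t y)) (C := C)
        (ae_of_all _ fun t => hC _)
      simpa using this
    have hfbg : ∀ x i y, |fb x - fb (Function.update x i y)| ≤ g (x i) + g y := by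
      intro x i y
      rw [hfb, ← integral_sub (hfi _) (hfi _)]
      have := norm_integral_le_of_norm_le_const (μ := μ)
        (f := fun t => f (Fin.cons t x) - f (Fin.cons t (Function.update x i y)))
        (C := g (x i) + g y) (ae_of_all _ fun t => by
          have := hfg (Fin.cons t x) i.succ y
          rwa [← Fin.cons_update, Fin.cons_succ] at this)
      simpa using this
    have hmb : ∫ y, fb y ∂(Measure.pi fun _ : Fin n => μ) = m := by
      rw [← hm, integral_pi_succ μ f (hint _ f C hf hC)]
    obtain ⟨D, hD⟩ := hΦb (C + |m|)
    have hΦf : ∀ {X : Type _} [MeasurableSpace X] (η : Measure X) [IsProbabilityMeasure η]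
        (k : X → ℝ), Measurable k → (∀ x, |k x| ≤ C) → Integrable (fun x => Φ (k x - m)) η := by
      intro X _ η _ k hk hR
      refine hint η _ D (hΦ.measurable.comp (hk.sub_const m)) fun x => hD _ ?_
      exact (abs_sub _ _).trans (by gcongr; exact hR x)
    rw [integral_pi_succ μ _ (hΦf _ f hf hC), Function.iterate_succ_apply']
    -- For fixed y the increment in the first coordinate is centred. It is bounded by g t + ∫ g
    -- because fb y is the average of f over that coordinate.
    have hinner : ∀ y, ∫ t, Φ (f (Fin.cons t y) - m) ∂μ ≤ a + b * Φ (fb y - m) := by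
      intro y
      have := hstep (fun t => f (Fin.cons t y) - fb y) (fb y - m) ((hfc y).sub_const _) ?_ ?_
      · refine le_trans (le_of_eq ?_) this
        congr 1
        funext t
        ring_nf
      · intro t
        rw [hfb]
        have h1 : f (Fin.cons t y) - ∫ s, f (Fin.cons s y) ∂μ =
            ∫ s, (f (Fin.cons t y) - f (Fin.cons s y)) ∂μ := by
          rw [integral_sub (integrable_const _) (hfi y)]
          simp
        have h2 : g t + ∫ s, g s ∂μ = ∫ s, (g t + g s) ∂μ := by
          rw [integral_add (integrable_const _) hg]
          simp
        rw [h1, h2, ← Real.norm_eq_abs]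
        refine (norm_integral_le_integral_norm _).trans
          (integral_mono ((integrable_const _).sub (hfi y)).norm ((integrable_const _).add hg) ?_)
        intro s
        have := hfg (Fin.cons t y) 0 s
        rwa [Fin.update_cons_zero, Fin.cons_zero] at this
      · rw [integral_sub (hfi y) (integrable_const _)]
        simp [hfb]
    calc _ ≤ ∫ y, (a + b * Φ (fb y - m)) ∂(Measure.pi fun _ : Fin n => μ) := by
          refine integral_mono ?_ ((integrable_const _).add ((hΦf _ fb hfbm hfbC).const_mul b)) hinner
          have hmm : Measurable fun z : (Fin n → E) × E => Φ (f (Fin.cons z.2 z.1) - m) :=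
            hΦ.measurable.comp ((hf.comp hcons).sub_const m)
          refine hint _ _ D
            ((hmm.stronglyMeasurable).integral_prod_right' (ν := μ)).measurable fun y => ?_
          have := norm_integral_le_of_norm_le_const (μ := μ)
            (f := fun t => Φ (f (Fin.cons t y) - m)) (C := D) (ae_of_all _ fun t => hD _
              ((abs_sub _ _).trans (by gcongr; exact hC _)))
          simpa using this
      _ = a + b * ∫ y, Φ (fb y - m) ∂(Measure.pi fun _ : Fin n => μ) := by
          rw [integral_add (integrable_const _) ((hΦf _ fb hfbm hfbC).const_mul b),
            integral_const_mul]
          simp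
      _ ≤ _ := by
          gcongr
          exact ih fb hfbm hfbC hfbg m hmb

lemma Real.exp_le_one_add_add_sq_mul_exp_abs (u : ℝ) : Real.exp u ≤ 1 + u + u ^ 2 * Real.exp |u| := by
  have h := Complex.norm_exp_sub_sum_le_norm_mul_exp (u : ℂ) 2
  have h2 : Complex.exp u - ∑ m ∈ Finset.range 2, (u : ℂ) ^ m / m.factorial =
      ((Real.exp u - (1 + u) : ℝ) : ℂ) := by
    simp [Finset.sum_range_succ]
  rw [h2, Complex.norm_real, Complex.norm_real, Real.norm_eq_abs, Real.norm_eq_abs, sq_abs] at h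
  linarith [le_abs_self (Real.exp u - (1 + u))]

lemma sq_integral_le_integral_sq (μ : Measure E) [IsProbabilityMeasure μ] {g : E → ℝ}
    (hg : Integrable g μ) (hg2 : Integrable (fun x => g x ^ 2) μ) :
    (∫ x, g x ∂μ) ^ 2 ≤ ∫ x, g x ^ 2 ∂μ := by
  set q := ∫ y, g y ∂μ with hq
  have h0 : 0 ≤ ∫ x, (g x - q) ^ 2 ∂μ := integral_nonneg fun x => sq_nonneg _
  have h1 : ∫ x, (g x - q) ^ 2 ∂μ = ∫ x, (q ^ 2 + (-2 * q) * g x + 1 * g x ^ 2) ∂μ := by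
    congr 1
    funext x
    ring
  rw [h1, integral_quadratic μ _ _ _ hg hg2, ← hq] at h0
  nlinarith

/-- The inequality (a + b)² ≤ 2a² + 2b² together with (∫ g)² ≤ ∫ g². -/
lemma integral_sq_centred_increment_le (μ : Measure E) [IsProbabilityMeasure μ] {g : E → ℝ}
    (hg : Measurable g) (hg0 : ∀ x, 0 ≤ g x) {G : ℝ} (hG : ∀ x, g x ≤ G) {h : E → ℝ}
    (hh : ∀ x, |h x| ≤ g x + ∫ y, g y ∂μ) :
    ∫ x, h x ^ 2 ∂μ ≤ 4 * ∫ x, g x ^ 2 ∂μ := by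
  have hgi : Integrable g μ := Integrable.of_bound hg.aestronglyMeasurable G
    (ae_of_all _ fun x => by rw [Real.norm_eq_abs, abs_of_nonneg (hg0 x)]; exact hG x)
  have hg2 : Integrable (fun x => g x ^ 2) μ :=
    Integrable.of_bound (hg.pow_const 2).aestronglyMeasurable (G ^ 2)
      (ae_of_all _ fun x => by
        rw [Real.norm_eq_abs, abs_of_nonneg (by positivity)]
        exact pow_le_pow_left₀ (hg0 x) (hG x) 2)
  set q := ∫ y, g y ∂μ with hq
  have hq0 : 0 ≤ q := integral_nonneg hg0
  have hjen : q ^ 2 ≤ ∫ x, g x ^ 2 ∂μ := sq_integral_le_integral_sq μ hgi hg2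
  calc ∫ x, h x ^ 2 ∂μ ≤ ∫ x, (2 * g x ^ 2 + 2 * q ^ 2) ∂μ := by
        refine integral_mono_of_nonneg (ae_of_all _ fun x => sq_nonneg _)
          ((hg2.const_mul 2).add (integrable_const _)) (ae_of_all _ fun x => ?_)
        have h1 := hh x
        have h2 : h x ^ 2 ≤ (g x + q) ^ 2 := sq_le_sq' (by linarith [neg_abs_le (h x)])
          ((le_abs_self _).trans h1)
        simp only
        nlinarith [sq_nonneg (g x - q)]
    _ ≤ _ := by
        rw [integral_add (hg2.const_mul 2) (integrable_const _), integral_const_mul]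
        simp only [integral_const, probReal_univ, smul_eq_mul, one_mul]
        linarith

/-- Efron–Stein type variance bound for functions with bounded differences. -/
lemma variance_le_of_bounded_differences (μ : Measure E) [IsProbabilityMeasure μ] {g : E → ℝ}
    (hg : Measurable g) (hg0 : ∀ x, 0 ≤ g x) {G : ℝ} (hG : ∀ x, g x ≤ G) (n : ℕ)
    (f : (Fin n → E) → ℝ) (hf : Measurable f) {C : ℝ} (hC : ∀ x, |f x| ≤ C)
    (hfg : ∀ x i y, |f x - f (Function.update x i y)| ≤ g (x i) + g y) (m : ℝ)
    (hm : ∫ x, f x ∂(Measure.pi fun _ : Fin n => μ) = m) :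
    ∫ x, (f x - m) ^ 2 ∂(Measure.pi fun _ : Fin n => μ) ≤ n * (4 * ∫ x, g x ^ 2 ∂μ) := by
  have hgi : Integrable g μ := Integrable.of_bound hg.aestronglyMeasurable G
    (ae_of_all _ fun x => by rw [Real.norm_eq_abs, abs_of_nonneg (hg0 x)]; exact hG x)
  -- For the square the cross term integrates to zero, so each coordinate adds one increment
  -- variance.
  have key := integral_comp_sub_le_iterate μ (Φ := fun u => u ^ 2) (by fun_prop)
    (a := 4 * ∫ x, g x ^ 2 ∂μ) (b := 1) zero_le_one ?_ hgi n f hf hC hfg m hm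
  · refine key.trans (le_of_eq ?_)
    generalize 4 * ∫ x, g x ^ 2 ∂μ = a
    clear key hfg hC hf hm f
    induction n with
    | zero => simp
    | succ n ih => rw [Function.iterate_succ_apply', ih]; push_cast; ring
  · intro h c hh hhg h0
    have hb : ∀ x, |h x| ≤ G + ∫ y, g y ∂μ := fun x => (hhg x).trans (by gcongr; exact hG x)
    have hi : Integrable h μ := Integrable.of_bound hh.aestronglyMeasurable _ (ae_of_all _ hb)
    have hi2 : Integrable (fun x => h x ^ 2) μ :=
      Integrable.of_bound (hh.pow_const 2).aestronglyMeasurable ((G + ∫ y, g y ∂μ) ^ 2)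
        (ae_of_all _ fun x => by
          rw [Real.norm_eq_abs, abs_pow]
          exact pow_le_pow_left₀ (abs_nonneg _) (hb x) 2)
    have h1 : ∫ x, (c + h x) ^ 2 ∂μ = ∫ x, (c ^ 2 + 2 * c * h x + 1 * h x ^ 2) ∂μ := by
      congr 1
      funext x
      ring
    rw [h1, integral_quadratic μ _ _ _ hi hi2, h0]
    have := integral_sq_centred_increment_le μ hg hg0 hG hhg
    linarith

/-- Exponential moment bound for functions with bounded differences. -/
lemma integral_exp_le_of_bounded_differences (μ : Measure E) [IsProbabilityMeasure μ] {g : E → ℝ}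
    (hg : Measurable g) (hg0 : ∀ x, 0 ≤ g x) {G : ℝ} (hG : ∀ x, g x ≤ G) (n : ℕ)
    (f : (Fin n → E) → ℝ) (hf : Measurable f) {C : ℝ} (hC : ∀ x, |f x| ≤ C)
    (hfg : ∀ x i y, |f x - f (Function.update x i y)| ≤ g (x i) + g y) (m : ℝ)
    (hm : ∫ x, f x ∂(Measure.pi fun _ : Fin n => μ) = m) {l : ℝ} (hl : 0 ≤ l) :
    ∫ x, Real.exp (l * (f x - m)) ∂(Measure.pi fun _ : Fin n => μ) ≤
      Real.exp (n * (l ^ 2 * Real.exp (2 * l * G) * (4 * ∫ x, g x ^ 2 ∂μ))) := by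
  have hgi : Integrable g μ := Integrable.of_bound hg.aestronglyMeasurable G
    (ae_of_all _ fun x => by rw [Real.norm_eq_abs, abs_of_nonneg (hg0 x)]; exact hG x)
  have hg2 : 0 ≤ ∫ x, g x ^ 2 ∂μ := integral_nonneg fun x => sq_nonneg _
  -- For the exponential each coordinate multiplies by the same factor 1 + v, and (1 + v)^n ≤ exp (n
  -- v). The linear term of the expansion vanishes by centring, and increments are at most 2G.
  have key := integral_comp_sub_le_iterate μ (Φ := fun u => Real.exp (l * u)) (by fun_prop)
    (a := 0) (b := 1 + l ^ 2 * Real.exp (2 * l * G) * (4 * ∫ x, g x ^ 2 ∂μ)) (by positivity) ?_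
    hgi n f hf hC hfg m hm
  · refine key.trans ?_
    have : ∀ b : ℝ, (fun u => 0 + b * u)^[n] (Real.exp (l * 0)) = b ^ n := by
      intro b
      clear key hfg hC hf hm f
      induction n with
      | zero => simp
      | succ n ih => rw [Function.iterate_succ_apply', ih]; ring
    rw [this, Real.exp_nat_mul]
    gcongr
    rw [add_comm]
    exact Real.add_one_le_exp _
  · intro h c hh hhg h0
    have hgint : ∫ y, g y ∂μ ≤ G := by
      calc ∫ y, g y ∂μ ≤ ∫ _, G ∂μ := integral_mono hgi (integrable_const _) hG
        _ = G := by simp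
    have hb : ∀ x, |h x| ≤ 2 * G := fun x => (hhg x).trans (by linarith [hG x])
    have hi : Integrable h μ := Integrable.of_bound hh.aestronglyMeasurable _ (ae_of_all _ hb)
    have hi2 : Integrable (fun x => h x ^ 2) μ :=
      Integrable.of_bound (hh.pow_const 2).aestronglyMeasurable ((2 * G) ^ 2)
        (ae_of_all _ fun x => by
          rw [Real.norm_eq_abs, abs_pow]
          exact pow_le_pow_left₀ (abs_nonneg _) (hb x) 2)
    have h1 : ∀ x, Real.exp (l * (c + h x)) ≤ Real.exp (l * c) *
        (1 + l * h x + l ^ 2 * Real.exp (2 * l * G) * h x ^ 2) := by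
      intro x
      rw [mul_add, Real.exp_add]
      gcongr
      refine (Real.exp_le_one_add_add_sq_mul_exp_abs _).trans ?_
      have h3 : |l * h x| ≤ 2 * l * G := by
        rw [abs_mul, abs_of_nonneg hl]
        nlinarith [hb x]
      have h4 := Real.exp_le_exp.2 h3
      have h5 : 0 ≤ (l * h x) ^ 2 := sq_nonneg _
      nlinarith
    have := integral_sq_centred_increment_le μ hg hg0 hG hhg
    calc ∫ x, Real.exp (l * (c + h x)) ∂μ
        ≤ ∫ x, Real.exp (l * c) * (1 + l * h x + l ^ 2 * Real.exp (2 * l * G) * h x ^ 2) ∂μ :=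
          integral_mono_of_nonneg (ae_of_all _ fun x => (Real.exp_pos _).le)
            ((((integrable_const _).add (hi.const_mul _)).add (hi2.const_mul _)).const_mul _)
            (ae_of_all _ h1)
      _ = Real.exp (l * c) * (1 + l ^ 2 * Real.exp (2 * l * G) * ∫ x, h x ^ 2 ∂μ) := by
          rw [integral_const_mul, integral_quadratic μ _ _ _ hi hi2, h0]
          simp
      _ ≤ _ := by
          rw [zero_add, mul_comm]
          gcongr

end Concentration

/-! ### Deviation of the number of sample points in a cell -/

section Deviation

variable {E : Type*} [MeasurableSpace E]

/-- The deviation `|n μ(F) - #{i : x_i ∈ F}|` between expected and actual number of points in `F`. -/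
noncomputable def cellDeviation (μ : Measure E) (F : Set E) {n : ℕ} (x : Fin n → E) : ℝ :=
  |n * μ.real F - ∑ i, F.indicator (fun _ => (1 : ℝ)) (x i)|

lemma cellDeviation_nonneg (μ : Measure E) (F : Set E) {n : ℕ} (x : Fin n → E) :
    0 ≤ cellDeviation μ F x :=
  abs_nonneg _

lemma measurable_sum_indicator {F : Set E} (hF : MeasurableSet F) (n : ℕ) :
    Measurable fun x : Fin n → E => ∑ i, F.indicator (fun _ => (1 : ℝ)) (x i) :=
  Finset.measurable_sum _ fun i _ =>
    (measurable_const.indicator hF).comp (measurable_pi_apply i)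

lemma measurable_cellDeviation (μ : Measure E) {F : Set E} (hF : MeasurableSet F) (n : ℕ) :
    Measurable fun x : Fin n → E => cellDeviation μ F x :=
  continuous_abs.measurable.comp (measurable_const.sub (measurable_sum_indicator hF n))

omit [MeasurableSpace E] in
lemma indicator_one_mem_Icc (F : Set E) (x : E) : F.indicator (fun _ => (1 : ℝ)) x ∈ Icc 0 1 := by
  by_cases h : x ∈ F <;> simp [h]

omit [MeasurableSpace E] in
lemma sum_indicator_mem_Icc (F : Set E) {n : ℕ} (x : Fin n → E) :
    ∑ i, F.indicator (fun _ => (1 : ℝ)) (x i) ∈ Icc (0 : ℝ) n := by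
  refine ⟨Finset.sum_nonneg fun i _ => (indicator_one_mem_Icc F _).1, ?_⟩
  calc ∑ i, F.indicator (fun _ => (1 : ℝ)) (x i) ≤ ∑ _i : Fin n, (1 : ℝ) :=
        Finset.sum_le_sum fun i _ => (indicator_one_mem_Icc F _).2
    _ = n := by simp

lemma cellDeviation_le (μ : Measure E) [IsProbabilityMeasure μ] (F : Set E) {n : ℕ}
    (x : Fin n → E) : cellDeviation μ F x ≤ n := by
  have h1 := sum_indicator_mem_Icc F x
  have h2 : μ.real F ≤ 1 := measureReal_le_one
  have h3 : 0 ≤ μ.real F := measureReal_nonneg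
  have h4 : (0 : ℝ) ≤ n := Nat.cast_nonneg n
  rw [cellDeviation, abs_le]
  constructor <;> nlinarith [h1.1, h1.2]

omit [MeasurableSpace E] in
lemma sum_indicator_sub_update (F : Set E) {n : ℕ} (x : Fin n → E) (i : Fin n) (y : E) :
    ∑ k, F.indicator (fun _ => (1 : ℝ)) (x k) -
      ∑ k, F.indicator (fun _ => (1 : ℝ)) (Function.update x i y k) =
      F.indicator (fun _ => (1 : ℝ)) (x i) - F.indicator (fun _ => (1 : ℝ)) y := by
  rw [← Finset.sum_sub_distrib, Finset.sum_eq_single i]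
  · simp
  · intro k _ hk
    rw [Function.update_of_ne hk, sub_self]
  · simp

lemma abs_cellDeviation_sub_update_le (μ : Measure E) (F : Set E) {n : ℕ} (x : Fin n → E)
    (i : Fin n) (y : E) :
    |cellDeviation μ F x - cellDeviation μ F (Function.update x i y)| ≤
      F.indicator (fun _ => (1 : ℝ)) (x i) + F.indicator (fun _ => (1 : ℝ)) y := by
  refine (abs_abs_sub_abs_le_abs_sub _ _).trans ?_
  have h := sum_indicator_sub_update F x i y
  have h1 := indicator_one_mem_Icc F (x i)
  have h2 := indicator_one_mem_Icc F y
  rw [sub_sub_sub_cancel_left, abs_sub_comm, h, abs_le]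
  constructor <;> linarith [h1.1, h2.1]

lemma integral_sum_indicator (μ : Measure E) [IsProbabilityMeasure μ] {F : Set E}
    (hF : MeasurableSet F) (n : ℕ) :
    ∫ x, ∑ i, F.indicator (fun _ => (1 : ℝ)) (x i) ∂(Measure.pi fun _ : Fin n => μ) =
      n * μ.real F := by
  have h1 : ∀ i : Fin n, ∫ x, F.indicator (fun _ => (1 : ℝ)) (x i)
      ∂(Measure.pi fun _ : Fin n => μ) = μ.real F := by
    intro i
    have hmp := measurePreserving_eval (fun _ : Fin n => μ) i
    have hm : AEStronglyMeasurable (F.indicator fun _ => (1 : ℝ))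
        ((Measure.pi fun _ : Fin n => μ).map (Function.eval i)) :=
      (measurable_const.indicator hF).aestronglyMeasurable
    have := integral_map hmp.measurable.aemeasurable hm
    rw [hmp.map_eq] at this
    refine this.symm.trans ?_
    rw [integral_indicator_const _ hF, smul_eq_mul, mul_one]
  rw [integral_finsetSum]
  · simp [h1]
  · intro i _
    refine Integrable.of_bound
      ((measurable_const.indicator hF).comp (measurable_pi_apply i)).aestronglyMeasurable 1
      (ae_of_all _ fun x => ?_)
    have := indicator_one_mem_Icc F (x i)
    rw [Real.norm_eq_abs, abs_of_nonneg this.1]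
    exact this.2

lemma integrable_cellDeviation (μ : Measure E) [IsProbabilityMeasure μ] {F : Set E}
    (hF : MeasurableSet F) (n : ℕ) :
    Integrable (fun x : Fin n → E => cellDeviation μ F x) (Measure.pi fun _ : Fin n => μ) :=
  Integrable.of_bound (measurable_cellDeviation μ hF n).aestronglyMeasurable n
    (ae_of_all _ fun x => by
      rw [Real.norm_eq_abs, cellDeviation, abs_abs]
      exact cellDeviation_le μ F x)

lemma integral_cellDeviation_le_mul (μ : Measure E) [IsProbabilityMeasure μ] {F : Set E}
    (hF : MeasurableSet F) (n : ℕ) :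
    ∫ x, cellDeviation μ F x ∂(Measure.pi fun _ : Fin n => μ) ≤ 2 * (n * μ.real F) := by
  have hi : Integrable (fun x : Fin n → E => ∑ i, F.indicator (fun _ => (1 : ℝ)) (x i))
      (Measure.pi fun _ : Fin n => μ) :=
    Integrable.of_bound (measurable_sum_indicator hF n).aestronglyMeasurable n
      (ae_of_all _ fun x => by
        rw [Real.norm_eq_abs, abs_of_nonneg (sum_indicator_mem_Icc F x).1]
        exact (sum_indicator_mem_Icc F x).2)
  calc ∫ x, cellDeviation μ F x ∂(Measure.pi fun _ : Fin n => μ)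
      ≤ ∫ x, (n * μ.real F + ∑ i, F.indicator (fun _ => (1 : ℝ)) (x i))
          ∂(Measure.pi fun _ : Fin n => μ) := by
        refine integral_mono (integrable_cellDeviation μ hF n) ((integrable_const _).add hi) ?_
        intro x
        have h1 := (sum_indicator_mem_Icc F x).1
        have h3 : 0 ≤ n * μ.real F := by positivity
        refine (abs_sub _ _).trans ?_
        rw [abs_of_nonneg h1, abs_of_nonneg h3]
    _ = _ := by
        rw [integral_add (integrable_const _) hi, integral_sum_indicator μ hF]
        simp only [integral_const, probReal_univ, smul_eq_mul, one_mul]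
        ring

/-- The first moment is bounded by the root of the variance of the count, to which the general
variance bound applies with the indicator of F as influence. This beats the linear bound once n μ(F)
exceeds 1. -/
lemma integral_cellDeviation_le_sqrt (μ : Measure E) [IsProbabilityMeasure μ] {F : Set E}
    (hF : MeasurableSet F) (n : ℕ) :
    ∫ x, cellDeviation μ F x ∂(Measure.pi fun _ : Fin n => μ) ≤ 2 * √(n * μ.real F) := by
  have hvar := variance_le_of_bounded_differences μ (g := F.indicator fun _ => (1 : ℝ))
    (measurable_const.indicator hF) (fun x => (indicator_one_mem_Icc F x).1)
    (fun x => (indicator_one_mem_Icc F x).2) n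
    (fun x => ∑ i, F.indicator (fun _ => (1 : ℝ)) (x i)) (measurable_sum_indicator hF n)
    (C := n) (fun x => by
      rw [abs_of_nonneg (sum_indicator_mem_Icc F x).1]
      exact (sum_indicator_mem_Icc F x).2)
    (fun x i y => by
      have h1 := indicator_one_mem_Icc F (x i)
      have h2 := indicator_one_mem_Icc F y
      rw [sum_indicator_sub_update, abs_le]
      constructor <;> linarith [h1.1, h2.1]) _ (integral_sum_indicator μ hF n)
  have hsq : ∫ x, (F.indicator (fun _ => (1 : ℝ)) x) ^ 2 ∂μ = μ.real F := by
    have : (fun x => (F.indicator (fun _ => (1 : ℝ)) x) ^ 2) = F.indicator fun _ => (1 : ℝ) := by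
      funext x
      by_cases h : x ∈ F <;> simp [h]
    rw [this, integral_indicator_const _ hF, smul_eq_mul, mul_one]
  rw [hsq] at hvar
  have hdev2 : ∀ x : Fin n → E, cellDeviation μ F x ^ 2 =
      (∑ i, F.indicator (fun _ => (1 : ℝ)) (x i) - n * μ.real F) ^ 2 := fun x => by
    rw [cellDeviation, sq_abs]
    ring
  have hi2 : Integrable (fun x : Fin n → E => cellDeviation μ F x ^ 2)
      (Measure.pi fun _ : Fin n => μ) :=
    Integrable.of_bound ((measurable_cellDeviation μ hF n).pow_const 2).aestronglyMeasurable
      ((n : ℝ) ^ 2) (ae_of_all _ fun x => by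
        rw [Real.norm_eq_abs, abs_of_nonneg (sq_nonneg _)]
        exact pow_le_pow_left₀ (abs_nonneg _) (cellDeviation_le μ F x) 2)
  have hj := sq_integral_le_integral_sq _ (integrable_cellDeviation μ hF n) hi2
  simp_rw [hdev2] at hj
  have h4 : 2 * √(n * μ.real F) = √(4 * (n * μ.real F)) := by
    rw [Real.sqrt_mul (x := 4) (by norm_num), show (4 : ℝ) = 2 ^ 2 by norm_num,
      Real.sqrt_sq (by norm_num)]
  rw [h4]
  refine Real.le_sqrt_of_sq_le (hj.trans (hvar.trans (le_of_eq (by ring))))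

end Deviation

/-! ### Dyadic rings with nested partitions and their weighted deviation -/

/-- A decomposition of the ball of radius `R₀` around `x₀`, up to a null set, into dyadic rings, with
`K + 1` nested finite partitions of each ring. -/
structure RingPartition {E : Type*} [MetricSpace E] [MeasurableSpace E] (μ : Measure E) (x₀ : E)
    (p γ R₀ : ℝ) (M K : ℕ) where
  B : ℕ → Set E
  T : ℕ → ℕ → E → E
  A : ℕ → ℕ → Finset E
  measurableSet_B : ∀ j, MeasurableSet (B j)
  B_subset : ∀ j, B j ⊆ Metric.closedBall x₀ (R₀ / 2 ^ j)
  B_far : ∀ j < M, ∀ x ∈ B j, R₀ / 2 ^ (j + 1) < dist x x₀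
  null : μ (Metric.closedBall x₀ R₀ \ ⋃ j ∈ Finset.range (M + 1), B j) = 0
  measurable_T : ∀ j e, Measurable (T j e)
  T_mem : ∀ j e x, T j e x ∈ A j e
  nest : ∀ j e x y, T j e x = T j e y → T j (e + 1) x = T j (e + 1) y
  A_root : ∀ j, A j K = {x₀}
  card_le : ∀ j, ∀ e ≤ K, ((A j e).card : ℝ) ≤ γ * ((4 : ℝ) ^ p) ^ (K - e)
  dist_le : ∀ j, ∀ e ≤ K, ∀ x ∈ B j, ∀ y ∈ B j, T j e x = T j e y →
    dist x y ≤ 8 * (R₀ / 2 ^ j) / 2 ^ (K - e)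

lemma HasCoveringDim.nonempty_ringPartition {E : Type*} [MetricSpace E] [MeasurableSpace E]
    [BorelSpace E] [SecondCountableTopology E] (μ : Measure E) [IsProbabilityMeasure μ]
    {S : Set E} {x₀ : E} {α β p : ℝ} (hμS : μ S = 1)
    (hS : HasCoveringDim S x₀ α β) (hp : 0 ≤ p) (hα : α ≤ 2 * p) (hβ : 0 < β)
    {R₀ : ℝ} (hR₀ : 0 < R₀) (M K : ℕ) :
    Nonempty (RingPartition μ x₀ p (β + 1) R₀ M K) := by
  classical
  choose B T A hB hSB hTm hTA hnest hroot hcard hdist using fun j : ℕ =>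
    hS.exists_nested_partition hp hα hβ (r := R₀ / 2 ^ j) (by positivity) K
  set Q : ℕ → Set E := fun j => Metric.closedBall x₀ (R₀ / 2 ^ j) \
    (if j < M then Metric.closedBall x₀ (R₀ / 2 ^ (j + 1)) else ∅) with hQ
  have hQm : ∀ j, MeasurableSet (Q j) := fun j => by
    refine Metric.isClosed_closedBall.measurableSet.diff ?_
    split_ifs
    exacts [Metric.isClosed_closedBall.measurableSet, MeasurableSet.empty]
  refine ⟨⟨fun j => B j ∩ Q j, T, A, fun j => (hB j).inter (hQm j), fun j x hx => hx.2.1, ?_, ?_,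
    hTm, hTA, hnest, hroot, hcard, ?_⟩⟩
  · rintro j hj x ⟨-, hx⟩
    have := hx.2
    simpa [hj] using this
  · set U := Metric.closedBall x₀ R₀ \ ⋃ j ∈ Finset.range (M + 1), B j ∩ Q j with hU
    have hUm : MeasurableSet U := Metric.isClosed_closedBall.measurableSet.diff
      (Finset.measurableSet_biUnion _ fun j _ => (hB j).inter (hQm j))
    -- A point of S in the ball belongs to the ring with the largest index j ≤ M for which its
    -- distance to x₀ is at most R₀/2^j. Hence the measurable set U misses S and is null, even if S
    -- is not measurable.
    have hUS : S ⊆ Uᶜ := by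
      rintro x hxS ⟨hx, hxU⟩
      refine hxU ?_
      set P : ℕ → Prop := fun j => dist x x₀ ≤ R₀ / 2 ^ j with hP
      have hP0 : P 0 := by simpa [hP] using hx
      set j := Nat.findGreatest P M with hj
      have hPj : P j := Nat.findGreatest_spec (Nat.zero_le M) hP0
      have hjM : j ≤ M := Nat.findGreatest_le M
      have hxQ : x ∈ Q j := by
        refine ⟨hPj, ?_⟩
        split_ifs with h
        · intro h'
          exact Nat.findGreatest_is_greatest (P := P) (n := M) (k := j + 1) (by omega) (by omega) h'
        · exact notMem_empty x
      simp only [mem_iUnion, Finset.mem_range]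
      exact ⟨j, by omega, hSB j ⟨hxS, hPj⟩, hxQ⟩
    rw [← prob_compl_eq_one_iff hUm]
    exact le_antisymm prob_le_one (hμS ▸ measure_mono hUS)
  · rintro j e he x ⟨hx, hxQ⟩ y ⟨hy, hyQ⟩ hxy
    exact hdist j e he x ⟨hx, hxQ.1⟩ y ⟨hy, hyQ.1⟩ hxy

namespace RingPartition

variable {E : Type*} [MetricSpace E] [MeasurableSpace E] {μ : Measure E} {x₀ : E}
  {p γ R₀ : ℝ} {M K : ℕ}

/-- The cell with label `a` of the partition of the ring `j` at level `e`. -/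
def cell (D : RingPartition μ x₀ p γ R₀ M K) (j e : ℕ) (a : E) : Set E :=
  D.B j ∩ D.T j e ⁻¹' {a}

/-- The weight of the cells of the ring `j` at level `e`. -/
noncomputable def weight (_D : RingPartition μ x₀ p γ R₀ M K) (j e : ℕ) : ℝ :=
  16 ^ p * (R₀ / 2 ^ j) ^ p * ((2 ^ p)⁻¹) ^ (K - e)

/-- The weighted sum of the deviations of all cells. -/
noncomputable def deviation (D : RingPartition μ x₀ p γ R₀ M K) {n : ℕ} (x : Fin n → E) : ℝ :=
  ∑ j ∈ Finset.range (M + 1), ∑ e ∈ Finset.range (K + 1), ∑ a ∈ D.A j e,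
    D.weight j e * cellDeviation μ (D.cell j e a) x

/-- A bound for the influence of a single sample point on the weighted deviation. -/
noncomputable def influence (D : RingPartition μ x₀ p γ R₀ M K) (x : E) : ℝ :=
  ∑ j ∈ Finset.range (M + 1), 2 * 16 ^ p * (R₀ / 2 ^ j) ^ p *
    (D.B j).indicator (fun _ => (1 : ℝ)) x

/-- The points outside all rings. -/
def rest (D : RingPartition μ x₀ p γ R₀ M K) : Set E :=
  (⋃ j ∈ Finset.range (M + 1), D.B j)ᶜ

variable (D : RingPartition μ x₀ p γ R₀ M K)

lemma disjoint_B (hR : 0 ≤ R₀) {i j : ℕ} (hi : i ≤ M) (hj : j ≤ M) (hij : i ≠ j) :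
    Disjoint (D.B i) (D.B j) := by
  wlog h : i < j generalizing i j
  · exact (this hj hi hij.symm (by omega)).symm
  refine Set.disjoint_left.2 fun x hxi hxj => ?_
  have h1 := D.B_far i (by omega) x hxi
  have h2 : dist x x₀ ≤ R₀ / 2 ^ j := D.B_subset j hxj
  have h3 : R₀ / 2 ^ j ≤ R₀ / 2 ^ (i + 1) := by
    gcongr
    · norm_num
    · omega
  linarith

lemma measurableSet_rest : MeasurableSet D.rest :=
  (Finset.measurableSet_biUnion _ fun j _ => D.measurableSet_B j).compl

lemma rest_ae_eq (hR : 0 ≤ R₀) : D.rest =ᵐ[μ] ((Metric.closedBall x₀ R₀)ᶜ : Set E) := by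
  have h1 : (Metric.closedBall x₀ R₀)ᶜ ⊆ D.rest := by
    refine compl_subset_compl.2 (iUnion₂_subset fun j _ => (D.B_subset j).trans ?_)
    exact Metric.closedBall_subset_closedBall (div_le_self hR (one_le_pow₀ (by norm_num)))
  have h2 : D.rest \ (Metric.closedBall x₀ R₀)ᶜ ⊆
      Metric.closedBall x₀ R₀ \ ⋃ j ∈ Finset.range (M + 1), D.B j :=
    fun x hx => ⟨not_notMem.1 hx.2, hx.1⟩
  have h3 : (Metric.closedBall x₀ R₀)ᶜ \ D.rest = ∅ := Set.sdiff_eq_empty.2 h1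
  exact ae_eq_set.2 ⟨measure_mono_null h2 D.null, by rw [h3, measure_empty]⟩

lemma sum_indicator_cell (j e : ℕ) (x : E) :
    ∑ a ∈ D.A j e, (D.cell j e a).indicator (fun _ => (1 : ℝ)) x =
      (D.B j).indicator (fun _ => (1 : ℝ)) x := by
  classical
  by_cases hx : x ∈ D.B j
  · rw [Finset.sum_eq_single (D.T j e x)]
    · simp [cell, hx]
    · intro a _ ha
      exact indicator_of_notMem (fun h => ha h.2.symm) _
    · exact fun h => absurd (D.T_mem j e x) h
  · rw [indicator_of_notMem hx]
    exact Finset.sum_eq_zero fun a _ => indicator_of_notMem (fun h => hx h.1) _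

lemma weight_nonneg (hR : 0 ≤ R₀) (j e : ℕ) : 0 ≤ D.weight j e := by
  unfold weight
  positivity

omit [MetricSpace E] [MeasurableSpace E] in
lemma _root_.sum_geometric_reflect_le (hp : 1 ≤ p) (K : ℕ) :
    ∑ e ∈ Finset.range (K + 1), (((2 : ℝ) ^ p)⁻¹) ^ (K - e) ≤ 2 := by
  have h2 : (2 : ℝ) ≤ 2 ^ p := by
    simpa using Real.rpow_le_rpow_of_exponent_le (x := 2) (by norm_num) hp
  have hq : ((2 : ℝ) ^ p)⁻¹ ≤ 1 / 2 := by
    rw [inv_eq_one_div]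
    gcongr
  have hq0 : 0 ≤ ((2 : ℝ) ^ p)⁻¹ := by positivity
  have := Finset.sum_range_reflect (fun l => (((2 : ℝ) ^ p)⁻¹) ^ l) (K + 1)
  simp only [Nat.add_sub_cancel] at this
  rw [this]
  calc ∑ l ∈ Finset.range (K + 1), (((2 : ℝ) ^ p)⁻¹) ^ l
      ≤ ∑ l ∈ Finset.range (K + 1), (1 / 2 : ℝ) ^ l :=
        Finset.sum_le_sum fun l _ => pow_le_pow_left₀ hq0 hq l
    _ ≤ 2 := sum_geometric_two_le _

/-- A point of a ring lies in exactly one cell of each level, and the weights along the levels form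
a geometric series of ratio 2^(-p) ≤ 1/2; this is the factor 2 in `influence`. -/
lemma sum_weight_indicator_le (hp : 1 ≤ p) (hR : 0 ≤ R₀) (x : E) :
    ∑ j ∈ Finset.range (M + 1), ∑ e ∈ Finset.range (K + 1), ∑ a ∈ D.A j e,
      D.weight j e * (D.cell j e a).indicator (fun _ => (1 : ℝ)) x ≤ D.influence x := by
  refine Finset.sum_le_sum fun j _ => ?_
  simp_rw [← Finset.mul_sum, D.sum_indicator_cell, ← Finset.sum_mul, weight, ← Finset.mul_sum]
  have h1 := (indicator_one_mem_Icc (D.B j) x).1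
  have h2 := sum_geometric_reflect_le hp K
  calc _ ≤ 16 ^ p * (R₀ / 2 ^ j) ^ p * 2 * (D.B j).indicator (fun _ => (1 : ℝ)) x := by gcongr
    _ = _ := by ring

lemma abs_deviation_sub_update_le (hp : 1 ≤ p) (hR : 0 ≤ R₀) {n : ℕ} (x : Fin n → E) (i : Fin n)
    (y : E) :
    |D.deviation x - D.deviation (Function.update x i y)| ≤
      D.influence (x i) + D.influence y := by
  have h1 := D.sum_weight_indicator_le hp hR (x i)
  have h2 := D.sum_weight_indicator_le hp hR y
  refine le_trans ?_ (add_le_add h1 h2)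
  unfold deviation
  simp_rw [← Finset.sum_sub_distrib, ← Finset.sum_add_distrib]
  refine (Finset.abs_sum_le_sum_abs _ _).trans (Finset.sum_le_sum fun j _ => ?_)
  refine (Finset.abs_sum_le_sum_abs _ _).trans (Finset.sum_le_sum fun e _ => ?_)
  refine (Finset.abs_sum_le_sum_abs _ _).trans (Finset.sum_le_sum fun a _ => ?_)
  rw [← mul_sub, abs_mul, abs_of_nonneg (D.weight_nonneg hR j e), ← mul_add]
  exact mul_le_mul_of_nonneg_left (abs_cellDeviation_sub_update_le μ _ x i y)
    (D.weight_nonneg hR j e)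

lemma measurableSet_cell [MeasurableSingletonClass E] (j e : ℕ) (a : E) :
    MeasurableSet (D.cell j e a) :=
  (D.measurableSet_B j).inter (D.measurable_T j e (measurableSet_singleton a))

lemma measurable_deviation [MeasurableSingletonClass E] (n : ℕ) :
    Measurable fun x : Fin n → E => D.deviation x :=
  Finset.measurable_sum _ fun j _ => Finset.measurable_sum _ fun e _ =>
    Finset.measurable_sum _ fun a _ =>
      (measurable_cellDeviation μ (D.measurableSet_cell j e a) n).const_mul _

lemma deviation_nonneg (hR : 0 ≤ R₀) {n : ℕ} (x : Fin n → E) : 0 ≤ D.deviation x :=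
  Finset.sum_nonneg fun j _ => Finset.sum_nonneg fun e _ => Finset.sum_nonneg fun _ _ =>
    mul_nonneg (D.weight_nonneg hR j e) (abs_nonneg _)

lemma abs_deviation_le [IsProbabilityMeasure μ] (hR : 0 ≤ R₀) (n : ℕ) (x : Fin n → E) :
    |D.deviation x| ≤ ∑ j ∈ Finset.range (M + 1), ∑ e ∈ Finset.range (K + 1), ∑ _a ∈ D.A j e,
      D.weight j e * n := by
  rw [abs_of_nonneg (D.deviation_nonneg hR x)]
  refine Finset.sum_le_sum fun j _ => Finset.sum_le_sum fun e _ => Finset.sum_le_sum fun a _ => ?_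
  exact mul_le_mul_of_nonneg_left (cellDeviation_le μ _ x) (D.weight_nonneg hR j e)

lemma measurable_influence : Measurable D.influence :=
  Finset.measurable_sum _ fun j _ => (measurable_const.indicator (D.measurableSet_B j)).const_mul _

lemma influence_nonneg (hR : 0 ≤ R₀) (x : E) : 0 ≤ D.influence x :=
  Finset.sum_nonneg fun j _ => mul_nonneg (by positivity) (indicator_one_mem_Icc _ x).1

lemma influence_eq_of_mem (hR : 0 ≤ R₀) {j : ℕ} (hj : j ≤ M) {x : E} (hx : x ∈ D.B j) :
    D.influence x = 2 * 16 ^ p * (R₀ / 2 ^ j) ^ p := by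
  unfold influence
  rw [Finset.sum_eq_single j]
  · simp [hx]
  · intro i hi hij
    have := Set.disjoint_right.1 (D.disjoint_B hR (by simpa [Nat.lt_succ_iff] using hi) hj hij) hx
    simp [this]
  · intro h
    exact absurd (Finset.mem_range.2 (by omega)) h

lemma influence_eq_zero {x : E} (hx : x ∈ D.rest) : D.influence x = 0 := by
  refine Finset.sum_eq_zero fun j hj => ?_
  have : x ∉ D.B j := fun h => hx (mem_biUnion hj h)
  simp [this]

lemma influence_le (hp : 0 ≤ p) (hR : 0 ≤ R₀) (x : E) : D.influence x ≤ 2 * 16 ^ p * R₀ ^ p := by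
  by_cases hx : x ∈ D.rest
  · rw [D.influence_eq_zero hx]
    positivity
  · simp only [rest, mem_compl_iff, mem_iUnion, not_not] at hx
    obtain ⟨j, hj, hxj⟩ := hx
    rw [D.influence_eq_of_mem hR (by simpa [Nat.lt_succ_iff] using hj) hxj]
    gcongr
    exact div_le_self hR (one_le_pow₀ (by norm_num))

/-- The rings are disjoint, so no cross terms appear. -/
lemma influence_sq (hR : 0 ≤ R₀) (x : E) : D.influence x ^ 2 =
    ∑ j ∈ Finset.range (M + 1), (2 * 16 ^ p * (R₀ / 2 ^ j) ^ p) ^ 2 *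
      (D.B j).indicator (fun _ => (1 : ℝ)) x := by
  by_cases hx : x ∈ D.rest
  · rw [D.influence_eq_zero hx, Finset.sum_eq_zero]
    · simp
    · intro j hj
      have : x ∉ D.B j := fun h => hx (mem_biUnion hj h)
      simp [this]
  · simp only [rest, mem_compl_iff, mem_iUnion, not_not] at hx
    obtain ⟨j, hj, hxj⟩ := hx
    have hjM : j ≤ M := by simpa [Nat.lt_succ_iff] using hj
    rw [D.influence_eq_of_mem hR hjM hxj, Finset.sum_eq_single j]
    · simp [hxj]
    · intro i hi hij
      have := Set.disjoint_right.1
        (D.disjoint_B hR (by simpa [Nat.lt_succ_iff] using hi) hjM hij) hxj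
      simp [this]
    · exact fun h => absurd hj h

lemma integral_influence_sq [IsProbabilityMeasure μ] (hR : 0 ≤ R₀) :
    ∫ x, D.influence x ^ 2 ∂μ =
      (2 * 16 ^ p) ^ 2 * ∑ j ∈ Finset.range (M + 1), ((R₀ / 2 ^ j) ^ p) ^ 2 * μ.real (D.B j) := by
  simp_rw [D.influence_sq hR]
  rw [integral_finsetSum, Finset.mul_sum]
  · refine Finset.sum_congr rfl fun j _ => ?_
    rw [integral_const_mul, integral_indicator_const _ (D.measurableSet_B j), smul_eq_mul, mul_one]
    ring
  · intro j _
    exact ((integrable_const _).indicator (D.measurableSet_B j)).const_mul _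

lemma sum_real_cell [IsFiniteMeasure μ] [MeasurableSingletonClass E] (j e : ℕ) :
    ∑ a ∈ D.A j e, μ.real (D.cell j e a) = μ.real (D.B j) := by
  rw [← measureReal_biUnion_finset]
  · congr 1
    ext x
    simp only [cell, mem_iUnion, mem_inter_iff, mem_preimage, mem_singleton_iff]
    constructor
    · rintro ⟨a, _, h, _⟩
      exact h
    · exact fun h => ⟨_, D.T_mem j e x, h, rfl⟩
  · intro a _ b _ hab
    refine Set.disjoint_left.2 fun x hx hx' => hab (hx.2.symm.trans hx'.2)
  · exact fun a _ => D.measurableSet_cell j e a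

/-- With l = K - e, the first entry of the minimum sums the linear bounds over the cells of a ring
and keeps the decay 2^(-pl). The second combines the square root bounds by Cauchy–Schwarz: at most γ
4^(pl) cells produce a factor 2^(pl), which cancels the weight exactly. -/
lemma integral_deviation_le [IsProbabilityMeasure μ] [MeasurableSingletonClass E]
    (hR : 0 ≤ R₀) (n : ℕ) :
    ∫ x, D.deviation x ∂(Measure.pi fun _ : Fin n => μ) ≤
      ∑ j ∈ Finset.range (M + 1), 16 ^ p * (R₀ / 2 ^ j) ^ p * ∑ l ∈ Finset.range (K + 1),
        min (((2 ^ p)⁻¹) ^ l * (2 * (n * μ.real (D.B j)))) (2 * √(γ * (n * μ.real (D.B j)))) := by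
  unfold deviation
  have hi : ∀ j e a, Integrable (fun x : Fin n → E => D.weight j e *
      cellDeviation μ (D.cell j e a) x) (Measure.pi fun _ : Fin n => μ) := fun j e a =>
    (integrable_cellDeviation μ (D.measurableSet_cell j e a) n).const_mul _
  rw [integral_finsetSum _ fun j _ => integrable_finsetSum _ fun e _ =>
    integrable_finsetSum _ fun a _ => hi j e a]
  refine Finset.sum_le_sum fun j _ => ?_
  rw [integral_finsetSum _ fun e _ => integrable_finsetSum _ fun a _ => hi j e a]
  have hrefl := Finset.sum_range_reflect (fun l => min (((2 ^ p : ℝ)⁻¹) ^ l *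
    (2 * (n * μ.real (D.B j)))) (2 * √(γ * (n * μ.real (D.B j))))) (K + 1)
  simp only [Nat.add_sub_cancel] at hrefl
  rw [← hrefl, Finset.mul_sum]
  refine Finset.sum_le_sum fun e he => ?_
  have heK : e ≤ K := by simpa [Nat.lt_succ_iff] using he
  rw [integral_finsetSum _ fun a _ => hi j e a]
  simp_rw [integral_const_mul]
  rw [← Finset.mul_sum, weight, mul_assoc (16 ^ p * (R₀ / 2 ^ j) ^ p)]
  refine mul_le_mul_of_nonneg_left ?_ (by positivity)
  refine le_min ?_ ?_
  · refine mul_le_mul_of_nonneg_left ?_ (by positivity)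
    calc _ ≤ ∑ a ∈ D.A j e, 2 * (n * μ.real (D.cell j e a)) :=
          Finset.sum_le_sum fun a _ =>
            integral_cellDeviation_le_mul μ (D.measurableSet_cell j e a) n
      _ = _ := by rw [← Finset.mul_sum, ← Finset.mul_sum, D.sum_real_cell]
  · have h1 : ∑ a ∈ D.A j e, ∫ x, cellDeviation μ (D.cell j e a) x
        ∂(Measure.pi fun _ : Fin n => μ) ≤
        2 * √((D.A j e).card * (n * μ.real (D.B j))) := by
      calc _ ≤ ∑ a ∈ D.A j e, 2 * √(n * μ.real (D.cell j e a)) :=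
            Finset.sum_le_sum fun a _ =>
              integral_cellDeviation_le_sqrt μ (D.measurableSet_cell j e a) n
        _ = 2 * ∑ a ∈ D.A j e, √(n * μ.real (D.cell j e a)) := by rw [Finset.mul_sum]
        _ ≤ _ := by
          gcongr
          refine Real.le_sqrt_of_sq_le ((sq_sum_le_card_mul_sum_sq).trans (le_of_eq ?_))
          congr 1
          rw [← D.sum_real_cell j e, Finset.mul_sum]
          exact Finset.sum_congr rfl fun a _ => Real.sq_sqrt (by positivity)
    calc _ ≤ ((2 ^ p : ℝ)⁻¹) ^ (K - e) * (2 * √((D.A j e).card * (n * μ.real (D.B j)))) := by gcongr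
      _ ≤ ((2 ^ p : ℝ)⁻¹) ^ (K - e) *
          (2 * √(((2 ^ p : ℝ) ^ (K - e)) ^ 2 * (γ * (n * μ.real (D.B j))))) := by
          gcongr _ * (2 * √?_)
          rw [← mul_assoc (((2 ^ p : ℝ) ^ (K - e)) ^ 2)]
          refine mul_le_mul_of_nonneg_right (b := ((D.A j e).card : ℝ)) ?_ (by positivity)
          refine (D.card_le j e heK).trans (le_of_eq ?_)
          rw [mul_comm]
          congr 1
          rw [← pow_mul, mul_comm (K - e), pow_mul]
          congr 1
          rw [show (4 : ℝ) = 2 * 2 by norm_num, Real.mul_rpow (by norm_num) (by norm_num), sq]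
      _ = _ := by
          rw [Real.sqrt_mul (x := ((2 ^ p : ℝ) ^ (K - e)) ^ 2) (by positivity),
            Real.sqrt_sq (by positivity), inv_pow]
          field_simp

end RingPartition

/-! ### Integrals and masses of the empirical measure -/

section Empirical

variable {E : Type*} [MeasurableSpace E]

lemma natCast_mul_lintegral_empiricalMeasure [MeasurableSingletonClass E] {n : ℕ} (hn : n ≠ 0)
    (x : Fin n → E) (F : E → ℝ≥0∞) :
    (n : ℝ≥0∞) * ∫⁻ y, F y ∂(empiricalMeasure x) = ∑ i, F (x i) := by
  rw [empiricalMeasure, lintegral_smul_measure, lintegral_finsetSum_measure, smul_eq_mul,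
    ← mul_assoc, ENNReal.mul_inv_cancel (by exact_mod_cast hn) (ENNReal.natCast_ne_top n), one_mul]
  simp

lemma isProbabilityMeasure_empiricalMeasure {n : ℕ} (hn : n ≠ 0) (x : Fin n → E) :
    IsProbabilityMeasure (empiricalMeasure x) := by
  constructor
  rw [empiricalMeasure, Measure.smul_apply, Measure.finsetSum_apply]
  simp only [measure_univ, Finset.sum_const, Finset.card_univ, Fintype.card_fin, nsmul_eq_mul,
    mul_one, smul_eq_mul]
  exact ENNReal.inv_mul_cancel (by exact_mod_cast hn) (ENNReal.natCast_ne_top n)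

lemma natCast_mul_empiricalMeasure_apply {n : ℕ} (hn : n ≠ 0)
    (x : Fin n → E) {s : Set E} (hs : MeasurableSet s) :
    (n : ℝ≥0∞) * empiricalMeasure x s =
      ENNReal.ofReal (∑ i, s.indicator (fun _ => (1 : ℝ)) (x i)) := by
  rw [empiricalMeasure, Measure.smul_apply, Measure.finsetSum_apply, smul_eq_mul,
    ← mul_assoc, ENNReal.mul_inv_cancel (by exact_mod_cast hn) (ENNReal.natCast_ne_top n), one_mul,
    ENNReal.ofReal_sum_of_nonneg fun i _ => (indicator_one_mem_Icc s _).1]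
  refine Finset.sum_congr rfl fun i _ => ?_
  rw [Measure.dirac_apply' _ hs]
  by_cases h : x i ∈ s <;> simp [h]

lemma natCast_mul_sub_empiricalMeasure_le (μ : Measure E) [IsProbabilityMeasure μ] {n : ℕ}
    (hn : n ≠ 0) (x : Fin n → E) {s : Set E} (hs : MeasurableSet s) :
    n * (μ s - empiricalMeasure x s) ≤ ENNReal.ofReal (cellDeviation μ s x) ∧
      n * (empiricalMeasure x s - μ s) ≤ ENNReal.ofReal (cellDeviation μ s x) := by
  have hnt : (n : ℝ≥0∞) ≠ ∞ := ENNReal.natCast_ne_top n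
  have h1 : (n : ℝ≥0∞) * μ s = ENNReal.ofReal (n * μ.real s) := by
    rw [ENNReal.ofReal_mul (Nat.cast_nonneg n), ENNReal.ofReal_natCast, ofReal_measureReal]
  have h2 := natCast_mul_empiricalMeasure_apply hn x hs
  rw [ENNReal.mul_sub fun _ _ => hnt, ENNReal.mul_sub fun _ _ => hnt, h1, h2,
    ← ENNReal.ofReal_sub _ (sum_indicator_mem_Icc s x).1,
    ← ENNReal.ofReal_sub _ (by positivity)]
  constructor
  · exact ENNReal.ofReal_le_ofReal (le_abs_self _)
  · refine ENNReal.ofReal_le_ofReal ?_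
    rw [cellDeviation, abs_sub_comm]
    exact le_abs_self _

end Empirical

/-! ### The pathwise bound for the transport cost -/

namespace RingPartition

variable {E : Type*} [MetricSpace E] [MeasurableSpace E] [BorelSpace E] {μ : Measure E} {x₀ : E}
  {p γ R₀ : ℝ} {M K : ℕ} (D : RingPartition μ x₀ p γ R₀ M K)

omit [BorelSpace E] in
lemma eq_sum_restrict (hR : 0 ≤ R₀) (η : Measure E) :
    η = ∑ j ∈ Finset.range (M + 1), η.restrict (D.B j) + η.restrict D.rest := by
  have hm : MeasurableSet (⋃ j ∈ Finset.range (M + 1), D.B j) :=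
    Finset.measurableSet_biUnion _ fun j _ => D.measurableSet_B j
  conv_lhs => rw [← Measure.restrict_add_restrict_compl (μ := η) hm]
  congr 1
  ext s hs
  rw [Measure.finsetSum_apply, Measure.restrict_apply hs]
  simp_rw [Measure.restrict_apply hs]
  rw [inter_iUnion₂, measure_biUnion_finset]
  · intro i hi j hj hij
    refine (D.disjoint_B hR ?_ ?_ hij).mono inter_subset_right inter_subset_right
    · simpa [Nat.lt_succ_iff] using hi
    · simpa [Nat.lt_succ_iff] using hj
  · exact fun j _ => hs.inter (D.measurableSet_B j)

lemma exists_ring_matching (hp : 0 ≤ p) (ν : Measure E) [IsFiniteMeasure μ]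
    [IsFiniteMeasure ν] (j : ℕ) :
    ∃ (π : Measure (E × E)) (μ' ν' : Measure E),
      μ.restrict (D.B j) = π.fst + μ' ∧ ν.restrict (D.B j) = π.snd + ν' ∧
      ∫⁻ x, edist x x₀ ^ p ∂μ' ≤ ENNReal.ofReal ((R₀ / 2 ^ j) ^ p) * (μ (D.B j) - ν (D.B j)) ∧
      ∫⁻ x, edist x x₀ ^ p ∂ν' ≤ ENNReal.ofReal ((R₀ / 2 ^ j) ^ p) * (ν (D.B j) - μ (D.B j)) ∧
      ∫⁻ z, edist z.1 z.2 ^ p ∂π ≤ ENNReal.ofReal ((8 * (R₀ / 2 ^ j) / 2 ^ K) ^ p) * μ (D.B j) +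
        ∑ e ∈ Finset.range K, ENNReal.ofReal ((16 * (R₀ / 2 ^ j) / 2 ^ (K - e)) ^ p) *
          ∑ a ∈ D.A j e, (μ (D.cell j e a) - ν (D.cell j e a)) := by
  have hBm := D.measurableSet_B j
  have hcell : ∀ (η : Measure E) e a,
      η.restrict (D.B j) (D.T j e ⁻¹' {a}) = η (D.cell j e a) := by
    intro η e a
    rw [Measure.restrict_apply (D.measurable_T j e (measurableSet_singleton a)), inter_comm, cell]
  obtain ⟨π, μ', ν', h1, h2, -, h4, h5, h6⟩ := exists_chain_matching p (μ.restrict (D.B j))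
    (ν.restrict (D.B j)) (B := D.B j) (by rw [Measure.restrict_apply hBm.compl]; simp)
    (by rw [Measure.restrict_apply hBm.compl]; simp) (D.measurable_T j) (D.A j) (D.T_mem j)
    (D.nest j) (fun e => ENNReal.ofReal ((8 * (R₀ / 2 ^ j) / 2 ^ (K - e)) ^ p)) K (by
      intro e he x hx y hy hxy
      rw [edist_dist, ENNReal.ofReal_rpow_of_nonneg dist_nonneg hp]
      exact ENNReal.ofReal_le_ofReal
        (Real.rpow_le_rpow dist_nonneg (D.dist_le j e he x hx y hy hxy) hp))
  -- At level K there is one cell, so after the last matching the remainder of a ring is only the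
  -- difference of the total masses.
  have huniv : D.T j K ⁻¹' {x₀} = univ := by
    ext x
    have := D.T_mem j K x
    rw [D.A_root, Finset.mem_singleton] at this
    simp [this]
  have h4' := h4 x₀
  have h5' := h5 x₀
  rw [huniv, Measure.restrict_apply_univ, Measure.restrict_apply_univ] at h4' h5'
  have hfar : ∀ η η' : Measure E, η' ≤ η.restrict (D.B j) →
      ∫⁻ x, edist x x₀ ^ p ∂η' ≤ ENNReal.ofReal ((R₀ / 2 ^ j) ^ p) * η' univ := by
    intro η η' hη
    rw [← lintegral_const]
    refine lintegral_mono_ae ?_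
    have : ∀ᵐ x ∂η', x ∈ D.B j := (Measure.absolutelyContinuous_of_le hη) (ae_restrict_mem hBm)
    filter_upwards [this] with x hx
    rw [edist_dist, ENNReal.ofReal_rpow_of_nonneg dist_nonneg hp]
    exact ENNReal.ofReal_le_ofReal (Real.rpow_le_rpow dist_nonneg (D.B_subset j hx) hp)
  refine ⟨π, μ', ν', h1, h2, ?_, ?_, ?_⟩
  · rw [← h4']
    exact hfar μ μ' (by rw [h1]; exact Measure.le_add_left le_rfl)
  · rw [← h5']
    exact hfar ν ν' (by rw [h2]; exact Measure.le_add_left le_rfl)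
  · refine h6.trans (le_of_eq ?_)
    rw [Measure.restrict_apply_univ, Nat.sub_zero]
    congr 1
    refine Finset.sum_congr rfl fun e he => ?_
    have he' : e < K := Finset.mem_range.1 he
    congr 1
    · congr 2
      -- Mass unmatched at level e travels inside a cell of level e + 1, whose diameter bound is
      -- twice as large: 8 becomes 16.
      have : (2 : ℝ) ^ (K - e) = 2 ^ (K - (e + 1)) * 2 := by
        rw [← pow_succ]
        congr 1
        omega
      rw [this]
      field_simp
      ring
    · simp_rw [hcell]

omit [BorelSpace E] in
lemma cell_root (j : ℕ) : D.cell j K x₀ = D.B j := by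
  ext x
  have := D.T_mem j K x
  rw [D.A_root, Finset.mem_singleton] at this
  simp [cell, this]

/-- The empirical Wasserstein cost is bounded by the weighted deviations of the cells, up to a
resolution error and the contribution of the points outside the rings. -/
lemma natCast_mul_wassersteinPow_le [IsProbabilityMeasure μ] (hp : 1 ≤ p) (hR : 0 ≤ R₀) {n : ℕ}
    (hn : n ≠ 0) (x : Fin n → E) :
    n * wassersteinPow p μ (empiricalMeasure x) ≤ ENNReal.ofReal (D.deviation x) +
      ENNReal.ofReal (n * (8 * R₀ / 2 ^ K) ^ p) +
      2 ^ (p - 1) * (n * ∫⁻ y in D.rest, edist y x₀ ^ p ∂μ +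
        ∑ i, D.rest.indicator (fun y => edist y x₀ ^ p) (x i)) := by
  have hp0 : 0 ≤ p := by linarith
  have := isProbabilityMeasure_empiricalMeasure hn x
  set ν := empiricalMeasure x with hν
  choose π μ' ν' h1 h2 h3 h4 h5 using D.exists_ring_matching hp0 ν
  have hW := wassersteinPow_le_of_pieces hp μ ν x₀ (Finset.range (M + 1)) π μ' ν'
    (μ.restrict D.rest) (ν.restrict D.rest)
    (by simp_rw [← h1]; exact D.eq_sum_restrict hR μ)
    (by simp_rw [← h2]; exact D.eq_sum_restrict hR ν)
  have hrest : n * ∫⁻ y in D.rest, edist y x₀ ^ p ∂ν =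
      ∑ i, D.rest.indicator (fun y => edist y x₀ ^ p) (x i) := by
    rw [← lintegral_indicator D.measurableSet_rest]
    exact natCast_mul_lintegral_empiricalMeasure hn x _
  have hring : ∀ j, n * (∫⁻ z, edist z.1 z.2 ^ p ∂(π j) +
      2 ^ (p - 1) * (∫⁻ x, edist x x₀ ^ p ∂(μ' j) + ∫⁻ x, edist x x₀ ^ p ∂(ν' j))) ≤
      ENNReal.ofReal (n * (8 * R₀ / 2 ^ K) ^ p) * μ (D.B j) +
        ENNReal.ofReal (∑ e ∈ Finset.range (K + 1), ∑ a ∈ D.A j e,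
          D.weight j e * cellDeviation μ (D.cell j e a) x) := by
    intro j
    have hnn : ∀ e, 0 ≤ ∑ a ∈ D.A j e, D.weight j e * cellDeviation μ (D.cell j e a) x := fun e =>
      Finset.sum_nonneg fun a _ => mul_nonneg (D.weight_nonneg hR j e) (cellDeviation_nonneg _ _ _)
    have hw : ∀ e, (16 * (R₀ / 2 ^ j) / 2 ^ (K - e)) ^ p = D.weight j e := by
      intro e
      have h2 : ((2 : ℝ) ^ (K - e)) ^ p = (2 ^ p) ^ (K - e) := by
        rw [← Real.rpow_natCast, ← Real.rpow_natCast, ← Real.rpow_mul (by norm_num),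
          ← Real.rpow_mul (by norm_num), mul_comm]
      rw [weight, Real.div_rpow (by positivity) (by positivity),
        Real.mul_rpow (by norm_num) (by positivity), inv_pow, div_eq_mul_inv, h2]
    -- The remainders of a ring, sent through x₀, are charged to the term e = K of the deviation;
    -- its weight suffices because 2^(p - 1) · 2 ≤ 16^p.
    have hroot : n * (2 ^ (p - 1) * (∫⁻ x, edist x x₀ ^ p ∂(μ' j) + ∫⁻ x, edist x x₀ ^ p ∂(ν' j))) ≤
        ENNReal.ofReal (∑ a ∈ D.A j K, D.weight j K * cellDeviation μ (D.cell j K a) x) := by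
      have h2p : ENNReal.ofReal ((2 : ℝ) ^ (p - 1)) = 2 ^ (p - 1) := by
        rw [← ENNReal.ofReal_rpow_of_pos (by norm_num)]
        simp
      obtain ⟨g1, g2⟩ := natCast_mul_sub_empiricalMeasure_le μ hn x (D.measurableSet_B j)
      rw [D.A_root, Finset.sum_singleton, cell_root]
      calc _ ≤ n * (2 ^ (p - 1) * (ENNReal.ofReal ((R₀ / 2 ^ j) ^ p) * (μ (D.B j) - ν (D.B j)) +
            ENNReal.ofReal ((R₀ / 2 ^ j) ^ p) * (ν (D.B j) - μ (D.B j)))) := by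
            gcongr
            exacts [h3 j, h4 j]
        _ = 2 ^ (p - 1) * ENNReal.ofReal ((R₀ / 2 ^ j) ^ p) * (n * (μ (D.B j) - ν (D.B j)) +
            n * (ν (D.B j) - μ (D.B j))) := by ring
        _ ≤ 2 ^ (p - 1) * ENNReal.ofReal ((R₀ / 2 ^ j) ^ p) *
            (ENNReal.ofReal (cellDeviation μ (D.B j) x) +
              ENNReal.ofReal (cellDeviation μ (D.B j) x)) := by gcongr
        _ = ENNReal.ofReal (2 ^ (p - 1) * (R₀ / 2 ^ j) ^ p *
            (cellDeviation μ (D.B j) x + cellDeviation μ (D.B j) x)) := by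
            rw [ENNReal.ofReal_mul (by positivity), ENNReal.ofReal_mul (by positivity),
              ENNReal.ofReal_add (cellDeviation_nonneg _ _ _) (cellDeviation_nonneg _ _ _), h2p]
        _ ≤ _ := by
            refine ENNReal.ofReal_le_ofReal ?_
            rw [weight, Nat.sub_self, pow_zero, mul_one]
            have h6 : (2 : ℝ) ^ (p - 1) * 2 ≤ 16 ^ p := by
              rw [Real.rpow_sub_one (by norm_num), div_mul_cancel₀ _ (by norm_num)]
              exact Real.rpow_le_rpow (by norm_num) (by norm_num) hp0
            have h7 : 0 ≤ cellDeviation μ (D.B j) x := cellDeviation_nonneg _ _ _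
            have h8 : 0 ≤ (R₀ / 2 ^ j) ^ p := by positivity
            calc _ = 2 ^ (p - 1) * 2 * ((R₀ / 2 ^ j) ^ p * cellDeviation μ (D.B j) x) := by ring
              _ ≤ 16 ^ p * ((R₀ / 2 ^ j) ^ p * cellDeviation μ (D.B j) x) := by gcongr
              _ = _ := by ring
    have hlevels : ∀ e, n * (ENNReal.ofReal ((16 * (R₀ / 2 ^ j) / 2 ^ (K - e)) ^ p) *
          ∑ a ∈ D.A j e, (μ (D.cell j e a) - ν (D.cell j e a))) ≤
        ENNReal.ofReal (∑ a ∈ D.A j e, D.weight j e * cellDeviation μ (D.cell j e a) x) := by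
      intro e
      rw [hw, ENNReal.ofReal_sum_of_nonneg fun a _ =>
        mul_nonneg (D.weight_nonneg hR j e) (cellDeviation_nonneg _ _ _), mul_left_comm, Finset.mul_sum,
        Finset.mul_sum]
      refine Finset.sum_le_sum fun a _ => ?_
      rw [ENNReal.ofReal_mul (D.weight_nonneg hR j e)]
      gcongr
      exact (natCast_mul_sub_empiricalMeasure_le μ hn x (D.measurableSet_cell j e a)).1
    have hfine : n * (ENNReal.ofReal ((8 * (R₀ / 2 ^ j) / 2 ^ K) ^ p) * μ (D.B j)) ≤
        ENNReal.ofReal (n * (8 * R₀ / 2 ^ K) ^ p) * μ (D.B j) := by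
      rw [← mul_assoc, ENNReal.ofReal_mul (Nat.cast_nonneg n), ENNReal.ofReal_natCast]
      gcongr
      exact div_le_self hR (one_le_pow₀ (by norm_num))
    rw [Finset.sum_range_succ, ENNReal.ofReal_add (Finset.sum_nonneg fun e _ => hnn e) (hnn K),
      ENNReal.ofReal_sum_of_nonneg fun e _ => hnn e, mul_add, ← add_assoc]
    refine add_le_add ?_ hroot
    calc _ ≤ n * (ENNReal.ofReal ((8 * (R₀ / 2 ^ j) / 2 ^ K) ^ p) * μ (D.B j) +
        ∑ e ∈ Finset.range K, ENNReal.ofReal ((16 * (R₀ / 2 ^ j) / 2 ^ (K - e)) ^ p) *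
          ∑ a ∈ D.A j e, (μ (D.cell j e a) - ν (D.cell j e a))) := by
          gcongr
          exact h5 j
      _ ≤ _ := by
          rw [mul_add, Finset.mul_sum]
          exact add_le_add hfine (Finset.sum_le_sum fun e _ => hlevels e)
  -- Each ring pays the resolution error in proportion to its mass, so in total it is paid only
  -- once.
  have hmass : ∑ j ∈ Finset.range (M + 1), μ (D.B j) ≤ 1 := by
    have := congrArg (fun η : Measure E => η univ) (D.eq_sum_restrict hR μ)
    simp only [Measure.add_apply, Measure.finsetSum_apply, Measure.restrict_apply_univ,
      measure_univ] at this
    rw [this]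
    exact le_self_add
  calc n * wassersteinPow p μ ν
      ≤ n * (∑ j ∈ Finset.range (M + 1), ∫⁻ z, edist z.1 z.2 ^ p ∂(π j) +
        2 ^ (p - 1) * (∑ j ∈ Finset.range (M + 1),
          (∫⁻ x, edist x x₀ ^ p ∂(μ' j) + ∫⁻ x, edist x x₀ ^ p ∂(ν' j)) +
        (∫⁻ x in D.rest, edist x x₀ ^ p ∂μ + ∫⁻ x in D.rest, edist x x₀ ^ p ∂ν))) := by gcongr
    _ = ∑ j ∈ Finset.range (M + 1), n * (∫⁻ z, edist z.1 z.2 ^ p ∂(π j) +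
          2 ^ (p - 1) * (∫⁻ x, edist x x₀ ^ p ∂(μ' j) + ∫⁻ x, edist x x₀ ^ p ∂(ν' j))) +
        2 ^ (p - 1) * (n * ∫⁻ y in D.rest, edist y x₀ ^ p ∂μ +
          n * ∫⁻ y in D.rest, edist y x₀ ^ p ∂ν) := by
        conv_rhs => rw [← Finset.mul_sum, Finset.sum_add_distrib, ← Finset.mul_sum]
        ring
    _ ≤ ∑ j ∈ Finset.range (M + 1), (ENNReal.ofReal (n * (8 * R₀ / 2 ^ K) ^ p) * μ (D.B j) +
          ENNReal.ofReal (∑ e ∈ Finset.range (K + 1), ∑ a ∈ D.A j e,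
            D.weight j e * cellDeviation μ (D.cell j e a) x)) +
        2 ^ (p - 1) * (n * ∫⁻ y in D.rest, edist y x₀ ^ p ∂μ +
          ∑ i, D.rest.indicator (fun y => edist y x₀ ^ p) (x i)) := by
        rw [hrest]
        gcongr with j _
        exact hring j
    _ ≤ _ := by
        gcongr
        rw [Finset.sum_add_distrib, ← Finset.mul_sum, add_comm]
        gcongr
        · rw [deviation, ENNReal.ofReal_sum_of_nonneg]
          exact fun j _ => Finset.sum_nonneg fun e _ => Finset.sum_nonneg fun a _ =>
            mul_nonneg (D.weight_nonneg hR j e) (cellDeviation_nonneg _ _ _)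
        · exact mul_le_of_le_one_right' hmass

end RingPartition

/-! ### Union bounds for rare sample points -/

section Sampling

variable {E : Type*} [MeasurableSpace E]

open scoped Classical in
-- A union bound over the k-element sets of indices, whose number is at most n^k. The power k is
-- what makes several simultaneous outliers negligible.
lemma pi_card_ge_le (μ : Measure E) [IsProbabilityMeasure μ] (R : Set E) (n k : ℕ) :
    (Measure.pi fun _ : Fin n => μ)
      {x | k ≤ (Finset.univ.filter fun i => x i ∈ R).card} ≤ (n * μ R) ^ k := by
  have hsub : {x : Fin n → E | k ≤ (Finset.univ.filter fun i => x i ∈ R).card} ⊆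
      ⋃ s ∈ (Finset.univ : Finset (Fin n)).powersetCard k,
        Set.pi univ fun i => if i ∈ s then R else univ := by
    intro x hx
    obtain ⟨s, hs, hcard⟩ := Finset.exists_subset_card_eq hx
    simp only [mem_iUnion, Finset.mem_powersetCard]
    refine ⟨s, ⟨Finset.subset_univ _, hcard⟩, fun i _ => ?_⟩
    beta_reduce
    split_ifs with h
    · exact (Finset.mem_filter.1 (hs h)).2
    · trivial
  calc _ ≤ _ := measure_mono hsub
    _ ≤ ∑ s ∈ (Finset.univ : Finset (Fin n)).powersetCard k, (Measure.pi fun _ : Fin n => μ)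
        (Set.pi univ fun i => if i ∈ s then R else univ) := measure_biUnion_finset_le _ _
    _ = ∑ s ∈ (Finset.univ : Finset (Fin n)).powersetCard k, μ R ^ k := by
        refine Finset.sum_congr rfl fun s hs => ?_
        rw [Measure.pi_pi]
        have : ∀ i, μ (if i ∈ s then R else univ) = if i ∈ s then μ R else 1 := fun i => by
          split_ifs <;> simp
        simp_rw [this]
        rw [Finset.prod_ite_mem, Finset.univ_inter, Finset.prod_const,
          (Finset.mem_powersetCard.1 hs).2]
    _ = (n.choose k : ℝ≥0∞) * μ R ^ k := by
        rw [Finset.sum_const, Finset.card_powersetCard, Finset.card_univ, Fintype.card_fin,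
          nsmul_eq_mul]
    _ ≤ _ := by
        rw [mul_pow]
        gcongr
        exact_mod_cast Nat.choose_le_pow n k

lemma pi_exists_mem_le (μ : Measure E) [IsProbabilityMeasure μ] (R : Set E) (n : ℕ) :
    (Measure.pi fun _ : Fin n => μ) {x | ∃ i, x i ∈ R} ≤ n * μ R := by
  classical
  have := pi_card_ge_le μ R n 1
  rw [pow_one] at this
  refine le_trans (measure_mono ?_) this
  rintro x ⟨i, hi⟩
  exact Finset.one_le_card.2 ⟨i, Finset.mem_filter.2 ⟨Finset.mem_univ _, hi⟩⟩

lemma IsIIDWithLaw.map_eq_pi {Ω : Type*} [MeasurableSpace Ω] {P : Measure Ω}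
    [IsProbabilityMeasure P] {μ : Measure E} {n : ℕ} {X : Fin n → Ω → E}
    (hX : IsIIDWithLaw X μ P) : P.map (fun ω i => X i ω) = Measure.pi fun _ => μ := by
  rw [(iIndepFun_iff_map_fun_eq_pi_map fun i => (hX.measurable i).aemeasurable).1 hX.indep]
  simp_rw [hX.law]

end Sampling

/-! ### Deviation probabilities for a given ring partition -/

namespace RingPartition

variable {E : Type*} [MetricSpace E] [MeasurableSpace E] [BorelSpace E] {μ : Measure E} {x₀ : E}
  {p γ R₀ : ℝ} {M K : ℕ} (D : RingPartition μ x₀ p γ R₀ M K)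

omit [BorelSpace E] in
lemma measure_rest (hR : 0 ≤ R₀) : μ D.rest = tailFun μ x₀ R₀ :=
  measure_congr (D.rest_ae_eq hR)

/-- Second moment bound for the weighted deviation. -/
lemma pi_deviation_ge_le_sq [IsProbabilityMeasure μ] (hp : 1 ≤ p) (hR : 0 ≤ R₀) (n : ℕ) {m t : ℝ}
    (ht : 0 < t) (hm : ∫ x, D.deviation x ∂(Measure.pi fun _ : Fin n => μ) ≤ m) :
    (Measure.pi fun _ : Fin n => μ) {x | m + t ≤ D.deviation x} ≤
      ENNReal.ofReal (n * (4 * ((2 * 16 ^ p) ^ 2 *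
        ∑ j ∈ Finset.range (M + 1), ((R₀ / 2 ^ j) ^ p) ^ 2 * μ.real (D.B j))) / t ^ 2) := by
  set m₀ := ∫ x, D.deviation x ∂(Measure.pi fun _ : Fin n => μ) with hm₀
  have hvar := variance_le_of_bounded_differences μ D.measurable_influence (D.influence_nonneg hR)
    (D.influence_le (by linarith) hR) n D.deviation (D.measurable_deviation n)
    (D.abs_deviation_le hR n) (D.abs_deviation_sub_update_le hp hR) m₀ hm₀.symm
  rw [D.integral_influence_sq hR] at hvar
  have hi : Integrable (fun x : Fin n → E => (D.deviation x - m₀) ^ 2)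
      (Measure.pi fun _ : Fin n => μ) := by
    obtain ⟨C, hC⟩ : ∃ C, ∀ x : Fin n → E, |D.deviation x| ≤ C := ⟨_, D.abs_deviation_le hR n⟩
    refine Integrable.of_bound
      (((D.measurable_deviation n).sub_const m₀).pow_const 2).aestronglyMeasurable
      ((C + |m₀|) ^ 2) (ae_of_all _ fun x => ?_)
    rw [Real.norm_eq_abs, abs_pow]
    exact pow_le_pow_left₀ (abs_nonneg _) ((abs_sub _ _).trans (by gcongr; exact hC x)) 2
  have hmark := mul_meas_ge_le_integral_of_nonneg (ae_of_all _ fun x => sq_nonneg _) hi (t ^ 2)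
  have hsub : {x : Fin n → E | m + t ≤ D.deviation x} ⊆
      {x | t ^ 2 ≤ (D.deviation x - m₀) ^ 2} := by
    intro x hx
    have hx' : m + t ≤ D.deviation x := hx
    exact pow_le_pow_left₀ ht.le (by linarith) 2
  refine (measure_mono hsub).trans ?_
  rw [← ofReal_measureReal]
  refine ENNReal.ofReal_le_ofReal ?_
  rw [le_div_iff₀ (by positivity), mul_comm]
  exact hmark.trans hvar

/-- Exponential moment bound for the weighted deviation. -/
lemma pi_deviation_ge_le_exp [IsProbabilityMeasure μ] (hp : 1 ≤ p) (hR : 0 ≤ R₀) (n : ℕ)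
    {m t l : ℝ} (hl : 0 ≤ l)
    (hm : ∫ x, D.deviation x ∂(Measure.pi fun _ : Fin n => μ) ≤ m) :
    (Measure.pi fun _ : Fin n => μ) {x | m + t ≤ D.deviation x} ≤
      ENNReal.ofReal (Real.exp (n * (l ^ 2 * Real.exp (2 * l * (2 * 16 ^ p * R₀ ^ p)) *
        (4 * ((2 * 16 ^ p) ^ 2 *
          ∑ j ∈ Finset.range (M + 1), ((R₀ / 2 ^ j) ^ p) ^ 2 * μ.real (D.B j)))) - l * t)) := by
  set m₀ := ∫ x, D.deviation x ∂(Measure.pi fun _ : Fin n => μ) with hm₀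
  have hexp := integral_exp_le_of_bounded_differences μ D.measurable_influence
    (D.influence_nonneg hR) (D.influence_le (by linarith) hR) n D.deviation
    (D.measurable_deviation n) (D.abs_deviation_le hR n) (D.abs_deviation_sub_update_le hp hR) m₀
    hm₀.symm hl
  rw [D.integral_influence_sq hR] at hexp
  have hi : Integrable (fun x : Fin n → E => Real.exp (l * (D.deviation x - m₀)))
      (Measure.pi fun _ : Fin n => μ) := by
    obtain ⟨C, hC⟩ : ∃ C, ∀ x : Fin n → E, |D.deviation x| ≤ C := ⟨_, D.abs_deviation_le hR n⟩
    refine Integrable.of_bound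
      (Real.measurable_exp.comp
        (((D.measurable_deviation n).sub_const m₀).const_mul l)).aestronglyMeasurable
      (Real.exp (l * (C - m₀))) (ae_of_all _ fun x => ?_)
    rw [Real.norm_eq_abs, abs_of_pos (Real.exp_pos _)]
    gcongr
    exact (le_abs_self _).trans (hC x)
  have hmark := mul_meas_ge_le_integral_of_nonneg (ae_of_all _ fun x => (Real.exp_pos _).le) hi
    (Real.exp (l * t))
  have hsub : {x : Fin n → E | m + t ≤ D.deviation x} ⊆
      {x | Real.exp (l * t) ≤ Real.exp (l * (D.deviation x - m₀))} := by
    intro x hx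
    have hx' : m + t ≤ D.deviation x := hx
    refine Real.exp_le_exp.2 (mul_le_mul_of_nonneg_left (by linarith) hl)
  refine (measure_mono hsub).trans ?_
  rw [← ofReal_measureReal]
  refine ENNReal.ofReal_le_ofReal ?_
  rw [Real.exp_sub, le_div_iff₀ (Real.exp_pos _), mul_comm]
  exact hmark.trans hexp

/-- Reduction of the deviation probability of the empirical Wasserstein cost to that of the weighted
deviation, for samples with at most `k` points outside the rings. -/
lemma measure_lt_wassersteinPow_le [IsProbabilityMeasure μ] (hp : 1 ≤ p) (hR : 0 ≤ R₀) {n : ℕ}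
    (hn : n ≠ 0) {Ω : Type*} [MeasurableSpace Ω] {P : Measure Ω}
    [IsProbabilityMeasure P] {X : Fin n → Ω → E} (hX : IsIIDWithLaw X μ P) {y s : ℝ} (hy : 0 < y)
    (k : ℕ) (h1 : n * (8 * R₀ / 2 ^ K) ^ p ≤ y / 8)
    (h2 : 2 ^ (p - 1) * (n * ∫⁻ z in (Metric.closedBall x₀ R₀)ᶜ, edist z x₀ ^ p ∂μ) ≤
      ENNReal.ofReal (y / 8))
    (h3 : k * (2 ^ (p - 1) * s ^ p) ≤ y / 4) :
    P {ω | ENNReal.ofReal (y / n) < wassersteinPow p μ (empiricalMeasure fun i : Fin n => X i ω)} ≤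
      (Measure.pi fun _ : Fin n => μ) {x | y / 2 ≤ D.deviation x} +
        (n * tailFun μ x₀ s + (n * tailFun μ x₀ R₀) ^ (k + 1)) := by
  classical
  have hp0 : 0 ≤ p := by linarith
  have h2' : 2 ^ (p - 1) * (n * ∫⁻ z in D.rest, edist z x₀ ^ p ∂μ) ≤ ENNReal.ofReal (y / 8) := by
    rwa [setLIntegral_congr (D.rest_ae_eq hR)]
  have h2p : ENNReal.ofReal ((2 : ℝ) ^ (p - 1)) = 2 ^ (p - 1) := by
    rw [← ENNReal.ofReal_rpow_of_pos (by norm_num)]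
    simp
  -- Off U the budget y splits as y/2 for the deviation, y/8 for the resolution, y/8 for the mass of
  -- μ outside and y/4 for the sample outside, which consists of at most k points at distance at
  -- most s.
  set U : Set (Fin n → E) := {x | y / 2 ≤ D.deviation x} ∪
    ({x | ∃ i, x i ∈ (Metric.closedBall x₀ s)ᶜ} ∪
      {x | k + 1 ≤ (Finset.univ.filter fun i => x i ∈ D.rest).card}) with hU
  have hsub : {ω | ENNReal.ofReal (y / n) <
      wassersteinPow p μ (empiricalMeasure fun i : Fin n => X i ω)} ⊆
      (fun ω i => X i ω) ⁻¹' U := by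
    intro ω hω
    by_contra hcon
    simp only [hU, mem_preimage, mem_union, not_or, mem_ofPred_eq, not_le, not_exists,
      mem_compl_iff, not_not] at hcon
    obtain ⟨c1, c2, c3⟩ := hcon
    set x : Fin n → E := fun i => X i ω with hx
    have hW := D.natCast_mul_wassersteinPow_le hp hR hn x
    have hsum : 2 ^ (p - 1) * ∑ i, D.rest.indicator (fun y => edist y x₀ ^ p) (x i) ≤
        ENNReal.ofReal (y / 4) := by
      have hle : ∑ i, D.rest.indicator (fun y => edist y x₀ ^ p) (x i) ≤
          k * ENNReal.ofReal (s ^ p) := by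
        simp only [Set.indicator_apply]
        rw [← Finset.sum_filter]
        calc _ ≤ ∑ _i ∈ Finset.univ.filter fun i => x i ∈ D.rest, ENNReal.ofReal (s ^ p) := by
              refine Finset.sum_le_sum fun i _ => ?_
              rw [edist_dist, ENNReal.ofReal_rpow_of_nonneg dist_nonneg hp0]
              exact ENNReal.ofReal_le_ofReal (Real.rpow_le_rpow dist_nonneg (c2 i) hp0)
          _ ≤ _ := by
              rw [Finset.sum_const, nsmul_eq_mul]
              gcongr
              exact Nat.lt_succ_iff.1 c3
      calc _ ≤ 2 ^ (p - 1) * (k * ENNReal.ofReal (s ^ p)) := by gcongr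
        _ = ENNReal.ofReal (k * (2 ^ (p - 1) * s ^ p)) := by
            rw [ENNReal.ofReal_mul (Nat.cast_nonneg k), ENNReal.ofReal_mul (by positivity), h2p,
              ENNReal.ofReal_natCast]
            ring
        _ ≤ _ := ENNReal.ofReal_le_ofReal h3
    have hlt : ENNReal.ofReal y < n * wassersteinPow p μ (empiricalMeasure x) := by
      have : ENNReal.ofReal y = n * ENNReal.ofReal (y / n) := by
        rw [← ENNReal.ofReal_natCast, ← ENNReal.ofReal_mul (Nat.cast_nonneg n),
          mul_div_cancel₀]
        exact_mod_cast hn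
      rw [this]
      exact (ENNReal.mul_lt_mul_iff_right (by exact_mod_cast hn)
        (ENNReal.natCast_ne_top n)).2 hω
    refine absurd (hlt.trans_le hW) (not_lt.2 ?_)
    calc _ ≤ ENNReal.ofReal (y / 2) + ENNReal.ofReal (y / 8) +
          (ENNReal.ofReal (y / 8) + ENNReal.ofReal (y / 4)) := by
          rw [mul_add]
          exact add_le_add (add_le_add (ENNReal.ofReal_le_ofReal c1.le)
            (ENNReal.ofReal_le_ofReal h1)) (add_le_add h2' hsum)
      _ = ENNReal.ofReal y := by
          rw [← ENNReal.ofReal_add (by positivity) (by positivity),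
            ← ENNReal.ofReal_add (by positivity) (by positivity),
            ← ENNReal.ofReal_add (by positivity) (by positivity)]
          congr 1
          ring
  have hmeas : Measurable fun ω i => X i ω := measurable_pi_lambda _ hX.measurable
  calc _ ≤ P ((fun ω i => X i ω) ⁻¹' U) := measure_mono hsub
    _ ≤ (P.map fun ω i => X i ω) U := Measure.le_map_apply hmeas.aemeasurable U
    _ = (Measure.pi fun _ : Fin n => μ) U := by rw [hX.map_eq_pi]
    _ ≤ _ := by
        refine (measure_union_le _ _).trans (add_le_add le_rfl
          ((measure_union_le _ _).trans (add_le_add ?_ ?_)))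
        · exact pi_exists_mem_le μ _ n
        · rw [← D.measure_rest hR]
          exact pi_card_ge_le μ _ n (k + 1)

end RingPartition

/-! ### Weak moments, truncated moments and the integral I_{2p,p} -/

section Tails

variable {E : Type*} [MetricSpace E] [MeasurableSpace E] {μ : Measure E} {x₀ : E}

lemma tailFun_anti {s t : ℝ} (h : s ≤ t) : tailFun μ x₀ t ≤ tailFun μ x₀ s :=
  measure_mono (compl_subset_compl.2 (Metric.closedBall_subset_closedBall h))

lemma tailFun_le_of_weakMomentPow_le {A q t : ℝ} (hA : weakMomentPow μ x₀ q ≤ ENNReal.ofReal A)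
    (ht : 0 < t) : tailFun μ x₀ t ≤ ENNReal.ofReal (A / t ^ q) := by
  have h1 : ENNReal.ofReal (t ^ q) * tailFun μ x₀ t ≤ ENNReal.ofReal A :=
    (le_iSup₂ (f := fun (t : ℝ) (_ : 0 ≤ t) => ENNReal.ofReal (t ^ q) * tailFun μ x₀ t) t
      ht.le).trans hA
  have h2 : 0 < t ^ q := Real.rpow_pos_of_pos ht q
  rw [ENNReal.ofReal_div_of_pos h2, ENNReal.le_div_iff_mul_le
    (Or.inl (by simpa using h2)) (Or.inl ENNReal.ofReal_ne_top), mul_comm]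
  exact h1

/-- The constant in the bound of a truncated moment of order `p` by a weak moment of order `r p`. -/
noncomputable def truncatedMomentConst (p r : ℝ) : ℝ :=
  2 ^ p * 2 ^ (r * p) / (1 - 2 ^ p / 2 ^ (r * p))

lemma truncatedMomentConst_pos {p r : ℝ} (hp : 0 < p) (hr : 1 < r) :
    0 < truncatedMomentConst p r := by
  have h : (2 : ℝ) ^ p / 2 ^ (r * p) < 1 := by
    rw [div_lt_one (by positivity)]
    exact Real.rpow_lt_rpow_of_exponent_lt (by norm_num) (by nlinarith)
  have : 0 < 1 - (2 : ℝ) ^ p / 2 ^ (r * p) := by linarith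
  unfold truncatedMomentConst
  positivity

/-- A weak moment of order `r p` with `r > 1` controls the truncated moment of order `p`. -/
lemma lintegral_compl_closedBall_le [OpensMeasurableSpace E] {p r A R₀ : ℝ} (hp : 0 < p)
    (hr : 1 < r) (hA0 : 0 ≤ A)
    (hA : weakMomentPow μ x₀ (r * p) ≤ ENNReal.ofReal A) (hR : 0 < R₀) :
    ∫⁻ z in (Metric.closedBall x₀ R₀)ᶜ, edist z x₀ ^ p ∂μ ≤
      ENNReal.ofReal (truncatedMomentConst p r * (A * (R₀ ^ p / R₀ ^ (r * p)))) := by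
  unfold truncatedMomentConst
  set q : ℝ := 2 ^ p / 2 ^ (r * p) with hq
  have hq0 : 0 ≤ q := by positivity
  have hq1 : q < 1 := by
    rw [hq, div_lt_one (by positivity)]
    exact Real.rpow_lt_rpow_of_exponent_lt (by norm_num) (by nlinarith)
  set c : ℝ := 2 ^ p * 2 ^ (r * p) * (A * (R₀ ^ p / R₀ ^ (r * p))) with hc
  have hc0 : 0 ≤ c := by positivity
  have hmeas : ∀ i : ℕ, MeasurableSet (Metric.closedBall x₀ (2 ^ i * R₀ / 2))ᶜ := fun i =>
    Metric.isClosed_closedBall.measurableSet.compl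
  have hpt : ∀ z ∈ (Metric.closedBall x₀ R₀)ᶜ, edist z x₀ ^ p ≤
      ∑' i : ℕ, (Metric.closedBall x₀ (2 ^ i * R₀ / 2))ᶜ.indicator
        (fun _ => ENNReal.ofReal ((2 ^ (i + 1) * R₀) ^ p)) z := by
    intro z hz
    have hz' : R₀ < dist z x₀ := by simpa using hz
    obtain ⟨i, hi1, hi2⟩ := exists_nat_pow_near (x := dist z x₀ / R₀) (y := 2)
      (by rw [le_div_iff₀ hR]; linarith) (by norm_num)
    rw [le_div_iff₀ hR] at hi1
    rw [div_lt_iff₀ hR] at hi2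
    -- The dyadic position of z gives only 2^i R₀ ≤ dist z x₀; halving the radius makes the
    -- inequality strict. This costs the factor 2^(r p) of `truncatedMomentConst`.
    have hmem : z ∈ (Metric.closedBall x₀ (2 ^ i * R₀ / 2))ᶜ := by
      have : 0 < 2 ^ i * R₀ := by positivity
      simp only [mem_compl_iff, Metric.mem_closedBall, not_le]
      linarith
    refine le_trans ?_ (ENNReal.le_tsum i)
    rw [indicator_of_mem hmem, edist_dist, ENNReal.ofReal_rpow_of_nonneg dist_nonneg hp.le]
    exact ENNReal.ofReal_le_ofReal (Real.rpow_le_rpow dist_nonneg hi2.le hp.le)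
  have hterm : ∀ i : ℕ, (2 ^ (i + 1) * R₀) ^ p * (A / (2 ^ i * R₀ / 2) ^ (r * p)) = c * q ^ i := by
    intro i
    have e1 : ∀ s : ℝ, ((2 : ℝ) ^ i) ^ s = (2 ^ s) ^ i := fun s => by
      rw [← Real.rpow_natCast, ← Real.rpow_natCast, ← Real.rpow_mul (by norm_num),
        ← Real.rpow_mul (by norm_num), mul_comm]
    rw [Real.mul_rpow (by positivity) hR.le, pow_succ, Real.mul_rpow (by positivity) (by norm_num),
      Real.div_rpow (by positivity) (by norm_num), Real.mul_rpow (by positivity) hR.le, e1, e1, hc,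
      hq, div_pow]
    field_simp
  calc ∫⁻ z in (Metric.closedBall x₀ R₀)ᶜ, edist z x₀ ^ p ∂μ
      ≤ ∫⁻ z in (Metric.closedBall x₀ R₀)ᶜ, ∑' i : ℕ,
          (Metric.closedBall x₀ (2 ^ i * R₀ / 2))ᶜ.indicator
            (fun _ => ENNReal.ofReal ((2 ^ (i + 1) * R₀) ^ p)) z ∂μ :=
        setLIntegral_mono' Metric.isClosed_closedBall.measurableSet.compl hpt
    _ ≤ ∫⁻ z, ∑' i : ℕ, (Metric.closedBall x₀ (2 ^ i * R₀ / 2))ᶜ.indicator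
            (fun _ => ENNReal.ofReal ((2 ^ (i + 1) * R₀) ^ p)) z ∂μ := setLIntegral_le_lintegral _ _
    _ = ∑' i : ℕ, ENNReal.ofReal ((2 ^ (i + 1) * R₀) ^ p) * tailFun μ x₀ (2 ^ i * R₀ / 2) := by
        rw [lintegral_tsum fun i => (measurable_const.indicator (hmeas i)).aemeasurable]
        congr 1
        funext i
        rw [lintegral_indicator_const (hmeas i), tailFun]
    _ ≤ ∑' i : ℕ, ENNReal.ofReal (c * q ^ i) := by
        refine ENNReal.tsum_le_tsum fun i => ?_
        rw [← hterm, ENNReal.ofReal_mul (by positivity)]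
        gcongr
        exact tailFun_le_of_weakMomentPow_le hA (by positivity)
    _ = ENNReal.ofReal (∑' i : ℕ, c * q ^ i) :=
        (ENNReal.ofReal_tsum_of_nonneg (fun i => by positivity)
          ((summable_geometric_of_lt_one hq0 hq1).mul_left c)).symm
    _ = _ := by
        rw [tsum_mul_left, tsum_geometric_of_lt_one hq0 hq1, hc]
        congr 1
        ring

lemma natCast_mul_lintegral_compl_closedBall_le [OpensMeasurableSpace E] {p r A R₀ : ℝ} (hp : 0 < p)
    (hr : 1 < r) (hA0 : 0 ≤ A)
    (hA : weakMomentPow μ x₀ (r * p) ≤ ENNReal.ofReal A) (hR : 0 < R₀) (n : ℕ) :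
    2 ^ (p - 1) * (n * ∫⁻ z in (Metric.closedBall x₀ R₀)ᶜ, edist z x₀ ^ p ∂μ) ≤
      ENNReal.ofReal (2 ^ (p - 1) * truncatedMomentConst p r *
        (n * A / R₀ ^ (r * p)) * R₀ ^ p) := by
  have h2p : (2 : ℝ≥0∞) ^ (p - 1) = ENNReal.ofReal ((2 : ℝ) ^ (p - 1)) := by
    rw [← ENNReal.ofReal_rpow_of_pos (by norm_num)]
    simp
  calc _ ≤ ENNReal.ofReal (2 ^ (p - 1)) * (ENNReal.ofReal n *
        ENNReal.ofReal (truncatedMomentConst p r * (A * (R₀ ^ p / R₀ ^ (r * p))))) := by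
        rw [h2p, ENNReal.ofReal_natCast]
        gcongr
        exact lintegral_compl_closedBall_le hp hr hA0 hA hR
    _ = _ := by
        rw [← ENNReal.ofReal_mul (Nat.cast_nonneg n), ← ENNReal.ofReal_mul (by positivity)]
        congr 1
        ring

lemma natCast_mul_tailFun_le {A q t : ℝ} (hA : weakMomentPow μ x₀ q ≤ ENNReal.ofReal A)
    (ht : 0 < t) (n : ℕ) : n * tailFun μ x₀ t ≤ ENNReal.ofReal (n * A / t ^ q) := by
  rw [mul_div_assoc, ENNReal.ofReal_mul (Nat.cast_nonneg n), ENNReal.ofReal_natCast]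
  gcongr
  exact tailFun_le_of_weakMomentPow_le hA ht

/-- On (a, 2a], an interval of length a, monotonicity gives H(t) ≥ H(2a) and t^(p-1) ≥ a^(p-1). -/
lemma sqrt_tailFun_mul_le_lintegral {p a : ℝ} (hp : 1 ≤ p) (ha : 0 < a) :
    tailFun μ x₀ (2 * a) ^ (1 / 2 : ℝ) * ENNReal.ofReal (a ^ p) ≤
      ∫⁻ t in Ioc a (2 * a), tailFun μ x₀ t ^ (1 / 2 : ℝ) * ENNReal.ofReal (t ^ (p - 1)) := by
  calc tailFun μ x₀ (2 * a) ^ (1 / 2 : ℝ) * ENNReal.ofReal (a ^ p)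
      = ∫⁻ _t in Ioc a (2 * a),
          tailFun μ x₀ (2 * a) ^ (1 / 2 : ℝ) * ENNReal.ofReal (a ^ (p - 1)) := by
        rw [setLIntegral_const, Real.volume_Ioc, mul_assoc, ← ENNReal.ofReal_mul (by positivity)]
        congr 2
        rw [Real.rpow_sub_one ha.ne']
        field_simp
        ring
    _ ≤ _ := by
        refine setLIntegral_mono' measurableSet_Ioc fun t ht => ?_
        exact mul_le_mul' (ENNReal.rpow_le_rpow (tailFun_anti ht.2) (by norm_num))
          (ENNReal.ofReal_le_ofReal (Real.rpow_le_rpow ha.le ht.1.le (by linarith)))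

/-- The part of the integral over (t/2, t] alone dominates √H(t) (t/2)^p; squaring gives the
constant 4^p. -/
lemma weakMomentPow_two_mul_le {p J : ℝ} (hp : 1 ≤ p) (hJ0 : 0 ≤ J)
    (hJ : sqrtTailIntegral μ x₀ p ≤ ENNReal.ofReal J) :
    weakMomentPow μ x₀ (2 * p) ≤ ENNReal.ofReal (4 ^ p * J ^ 2) := by
  refine iSup₂_le fun t ht => ?_
  rcases ht.eq_or_lt with rfl | ht
  · rw [Real.zero_rpow (by linarith)]
    simp
  · have h1 := sqrt_tailFun_mul_le_lintegral (μ := μ) (x₀ := x₀) hp (half_pos ht)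
    have h2 : ∫⁻ t in Ioc (t / 2) (2 * (t / 2)), tailFun μ x₀ t ^ (1 / 2 : ℝ) *
        ENNReal.ofReal (t ^ (p - 1)) ≤ ENNReal.ofReal J :=
      (lintegral_mono_set fun u hu => (half_pos ht).trans hu.1).trans hJ
    have h3 := h1.trans h2
    rw [show 2 * (t / 2) = t by ring] at h3
    have h4 := pow_le_pow_left₀ zero_le h3 2
    rw [mul_pow, ← ENNReal.rpow_natCast, ← ENNReal.rpow_mul, ← ENNReal.ofReal_pow (by positivity),
      ← ENNReal.ofReal_pow hJ0] at h4
    norm_num at h4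
    calc ENNReal.ofReal (t ^ (2 * p)) * tailFun μ x₀ t
        = ENNReal.ofReal (4 ^ p) * (tailFun μ x₀ t * ENNReal.ofReal (((t / 2) ^ p) ^ 2)) := by
          rw [mul_comm (tailFun μ x₀ t), ← mul_assoc, ← ENNReal.ofReal_mul (by positivity)]
          congr 2
          rw [Real.div_rpow ht.le (by norm_num), div_pow, mul_comm 2 p, Real.rpow_mul ht.le,
            Real.rpow_two, sq (2 ^ p : ℝ), ← Real.mul_rpow (by norm_num) (by norm_num)]
          norm_num
          field_simp
      _ ≤ ENNReal.ofReal (4 ^ p) * ENNReal.ofReal (J ^ 2) := by gcongr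
      _ = _ := by rw [ENNReal.ofReal_mul (by positivity)]

/-- Beyond 1 the integrand is at most √A t^(p-1-rp/2), which is integrable since r > 2. Only
finiteness matters: for r > 2 the value of the integral enters vanishing terms only. -/
lemma sqrtTailIntegral_lt_top [IsProbabilityMeasure μ] {p r A : ℝ} (hp : 1 ≤ p) (hr : 2 < r)
    (hA0 : 0 ≤ A) (hA : weakMomentPow μ x₀ (r * p) ≤ ENNReal.ofReal A) :
    sqrtTailIntegral μ x₀ p < ∞ := by
  have hsplit : Ioi (0 : ℝ) = Ioc 0 1 ∪ Ioi 1 := (Ioc_union_Ioi_eq_Ioi zero_le_one).symm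
  rw [sqrtTailIntegral, hsplit]
  refine (lintegral_union_le _ _ _).trans_lt (ENNReal.add_lt_top.2 ⟨?_, ?_⟩)
  · calc _ ≤ ∫⁻ _t in Ioc (0 : ℝ) 1, 1 := by
          refine setLIntegral_mono' measurableSet_Ioc fun t ht => ?_
          have h1 : tailFun μ x₀ t ^ (1 / 2 : ℝ) ≤ 1 :=
            ENNReal.rpow_le_one prob_le_one (by norm_num)
          have h2 : ENNReal.ofReal (t ^ (p - 1)) ≤ 1 :=
            ENNReal.ofReal_le_one.2 (Real.rpow_le_one ht.1.le ht.2 (by linarith))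
          exact mul_le_one' h1 h2
      _ < ∞ := by simp
  · have hint : IntegrableOn (fun t : ℝ => √A * t ^ (p - 1 - r * p / 2)) (Ioi 1) :=
      (integrableOn_Ioi_rpow_of_lt (by nlinarith) one_pos).const_mul _
    calc _ ≤ ∫⁻ t in Ioi (1 : ℝ), ENNReal.ofReal (√A * t ^ (p - 1 - r * p / 2)) := by
          refine setLIntegral_mono' measurableSet_Ioi fun t ht => ?_
          have ht0 : (0 : ℝ) < t := one_pos.trans ht
          calc _ ≤ ENNReal.ofReal (A / t ^ (r * p)) ^ (1 / 2 : ℝ) * ENNReal.ofReal (t ^ (p - 1)) := by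
                gcongr
                exact tailFun_le_of_weakMomentPow_le hA ht0
            _ = _ := by
                rw [ENNReal.ofReal_rpow_of_nonneg (by positivity) (by norm_num),
                  ← ENNReal.ofReal_mul (by positivity), Real.div_rpow hA0 (by positivity),
                  ← Real.sqrt_eq_rpow A, ← Real.rpow_mul ht0.le, Real.rpow_sub ht0 (p - 1)]
                congr 1
                rw [show r * p * (1 / 2) = r * p / 2 by ring]
                ring
      _ < ∞ := hint.lintegral_lt_top

end Tails

/-! ### Ring sums under finiteness of I_{2p,p} -/

namespace RingPartition

variable {E : Type*} [MetricSpace E] [MeasurableSpace E] {μ : Measure E} {x₀ : E}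
  {p γ R₀ : ℝ} {M K : ℕ} (D : RingPartition μ x₀ p γ R₀ M K)

lemma measure_B_le_tailFun {j : ℕ} (hj : j < M) : μ (D.B j) ≤ tailFun μ x₀ (R₀ / 2 ^ (j + 1)) :=
  measure_mono fun x hx => by
    have := D.B_far j hj x hx
    simpa using this

/-- For j < M the mass of ring j is at most H(R₀/2^(j+1)), and its term is compared with the
integral over (R₀/2^(j+2), R₀/2^(j+1)]. These intervals are disjoint, and the shift by two dyadic
steps gives 4^p. The innermost ring has no lower bound on distances and is bounded by its size
alone. -/
lemma sum_rpow_mul_sqrt_le [IsProbabilityMeasure μ] (hp : 1 ≤ p) (hR : 0 < R₀) {J : ℝ}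
    (hJ0 : 0 ≤ J) (hJ : sqrtTailIntegral μ x₀ p ≤ ENNReal.ofReal J) :
    ∑ j ∈ Finset.range (M + 1), (R₀ / 2 ^ j) ^ p * √(μ.real (D.B j)) ≤
      4 ^ p * J + (R₀ / 2 ^ M) ^ p := by
  rw [Finset.sum_range_succ]
  refine add_le_add ?_ ?_
  · have hterm : ∀ j < M, ENNReal.ofReal ((R₀ / 2 ^ j) ^ p * √(μ.real (D.B j))) ≤
        ENNReal.ofReal (4 ^ p) * ∫⁻ t in Ioc (R₀ / 2 ^ (j + 2)) (R₀ / 2 ^ (j + 1)),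
          tailFun μ x₀ t ^ (1 / 2 : ℝ) * ENNReal.ofReal (t ^ (p - 1)) := by
      intro j hj
      have h1 := sqrt_tailFun_mul_le_lintegral (μ := μ) (x₀ := x₀) hp
        (show 0 < R₀ / 2 ^ (j + 2) by positivity)
      rw [show 2 * (R₀ / 2 ^ (j + 2)) = R₀ / 2 ^ (j + 1) by field_simp; ring] at h1
      have h2 : (R₀ / 2 ^ j) ^ p = 4 ^ p * (R₀ / 2 ^ (j + 2)) ^ p := by
        rw [← Real.mul_rpow (by norm_num) (by positivity)]
        congr 1
        rw [pow_add]
        field_simp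
        norm_num
      have h3 : ENNReal.ofReal √(μ.real (D.B j)) ≤
          tailFun μ x₀ (R₀ / 2 ^ (j + 1)) ^ (1 / 2 : ℝ) := by
        rw [Real.sqrt_eq_rpow, ← ENNReal.ofReal_rpow_of_nonneg measureReal_nonneg (by norm_num),
          ofReal_measureReal]
        gcongr
        exact D.measure_B_le_tailFun hj
      rw [h2, ENNReal.ofReal_mul (by positivity), ENNReal.ofReal_mul (by positivity), mul_assoc]
      gcongr
      refine le_trans ?_ h1
      rw [mul_comm]
      gcongr
    have hsum : ENNReal.ofReal (∑ j ∈ Finset.range M, (R₀ / 2 ^ j) ^ p * √(μ.real (D.B j))) ≤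
        ENNReal.ofReal (4 ^ p * J) := by
      rw [ENNReal.ofReal_sum_of_nonneg fun j _ => by positivity, ENNReal.ofReal_mul (by positivity)]
      calc _ ≤ ∑ j ∈ Finset.range M, ENNReal.ofReal (4 ^ p) *
            ∫⁻ t in Ioc (R₀ / 2 ^ (j + 2)) (R₀ / 2 ^ (j + 1)),
              tailFun μ x₀ t ^ (1 / 2 : ℝ) * ENNReal.ofReal (t ^ (p - 1)) :=
            Finset.sum_le_sum fun j hj => hterm j (Finset.mem_range.1 hj)
        _ = ENNReal.ofReal (4 ^ p) *
            ∫⁻ t in ⋃ j ∈ Finset.range M, Ioc (R₀ / 2 ^ (j + 2)) (R₀ / 2 ^ (j + 1)),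
              tailFun μ x₀ t ^ (1 / 2 : ℝ) * ENNReal.ofReal (t ^ (p - 1)) := by
            rw [← Finset.mul_sum, lintegral_biUnion_finset]
            · intro i hi j hj hij
              wlog h : i < j generalizing i j
              · exact (this hj hi hij.symm (by omega)).symm
              refine Set.disjoint_left.2 fun t hti htj => ?_
              have h4 : R₀ / 2 ^ (j + 1) ≤ R₀ / 2 ^ (i + 2) := by
                refine div_le_div_of_nonneg_left hR.le (by positivity)
                  (pow_le_pow_right₀ (by norm_num) (by omega))
              linarith [hti.1, htj.2]
            · exact fun j _ => measurableSet_Ioc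
        _ ≤ _ := by
            gcongr
            refine le_trans (lintegral_mono_set ?_) hJ
            refine iUnion₂_subset fun j _ t ht => ?_
            exact lt_trans (by positivity) ht.1
    exact (ENNReal.ofReal_le_ofReal_iff (by positivity)).1 hsum
  · have : √(μ.real (D.B M)) ≤ 1 := Real.sqrt_le_one.2 measureReal_le_one
    exact mul_le_of_le_one_right (by positivity) this

lemma sum_sq_le_sq {Q : ℝ}
    (hQ : ∑ j ∈ Finset.range (M + 1), (R₀ / 2 ^ j) ^ p * √(μ.real (D.B j)) ≤ Q) (hR : 0 ≤ R₀) :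
    ∑ j ∈ Finset.range (M + 1), ((R₀ / 2 ^ j) ^ p) ^ 2 * μ.real (D.B j) ≤ Q ^ 2 := by
  have h0 : ∀ j, 0 ≤ (R₀ / 2 ^ j) ^ p * √(μ.real (D.B j)) := fun j => by positivity
  calc _ = ∑ j ∈ Finset.range (M + 1), ((R₀ / 2 ^ j) ^ p * √(μ.real (D.B j))) ^ 2 :=
        Finset.sum_congr rfl fun j _ => by rw [mul_pow, Real.sq_sqrt measureReal_nonneg]
    _ ≤ (∑ j ∈ Finset.range (M + 1), (R₀ / 2 ^ j) ^ p * √(μ.real (D.B j))) ^ 2 :=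
        Finset.sum_sq_le_sq_sum_of_nonneg fun j _ => h0 j
    _ ≤ Q ^ 2 := pow_le_pow_left₀ (Finset.sum_nonneg fun j _ => h0 j) hQ 2

/-- The square root bound is used at every level, which costs the factor K + 1. -/
lemma integral_deviation_le_sqrt [IsProbabilityMeasure μ] [MeasurableSingletonClass E]
    (hγ : 0 ≤ γ) (hR : 0 ≤ R₀) (n : ℕ) {Q : ℝ}
    (hQ : ∑ j ∈ Finset.range (M + 1), (R₀ / 2 ^ j) ^ p * √(μ.real (D.B j)) ≤ Q) :
    ∫ x, D.deviation x ∂(Measure.pi fun _ : Fin n => μ) ≤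
      16 ^ p * (K + 1) * (2 * √γ * √n) * Q := by
  refine (D.integral_deviation_le hR n).trans ?_
  calc _ ≤ ∑ j ∈ Finset.range (M + 1), 16 ^ p * (R₀ / 2 ^ j) ^ p *
        ∑ _l ∈ Finset.range (K + 1), 2 * √(γ * (n * μ.real (D.B j))) := by
        gcongr
        exact min_le_right _ _
    _ = 16 ^ p * (K + 1) * (2 * √γ * √n) *
        ∑ j ∈ Finset.range (M + 1), (R₀ / 2 ^ j) ^ p * √(μ.real (D.B j)) := by
        rw [Finset.mul_sum]
        refine Finset.sum_congr rfl fun j _ => ?_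
        rw [Finset.sum_const, Finset.card_range, nsmul_eq_mul, Real.sqrt_mul hγ,
          Real.sqrt_mul (Nat.cast_nonneg n)]
        push_cast
        ring
    _ ≤ _ := by gcongr

end RingPartition

/-! ### Level sums without a logarithm -/

lemma sum_range_geometric_le {q : ℝ} (hq0 : 0 ≤ q) (hq1 : q < 1) (n : ℕ) :
    ∑ i ∈ Finset.range n, q ^ i ≤ (1 - q)⁻¹ := by
  rw [← tsum_geometric_of_lt_one hq0 hq1]
  exact (summable_geometric_of_lt_one hq0 hq1).sum_le_tsum _ fun i _ => by positivity

/-- The minimum of a and b is at most a^(1-t) b^t. With t = 2(1 - θ) the powers of u combine to u^θ,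
while the part taken from a keeps a decay q^((1-t) l); hence the bound is uniform in the number of
levels. -/
lemma exists_sum_min_le {q γ θ : ℝ} (hq0 : 0 < q) (hq1 : q < 1) (hγ : 0 < γ) (hθ : 1 / 2 < θ)
    (hθ1 : θ < 1) :
    ∃ c : ℝ, 0 < c ∧ ∀ u : ℝ, 0 ≤ u → ∀ K : ℕ,
      ∑ l ∈ Finset.range K, min (q ^ l * (2 * u)) (2 * √(γ * u)) ≤ c * u ^ θ := by
  set t : ℝ := 2 * (1 - θ) with ht
  have ht0 : 0 < t := by linarith
  have ht1 : 0 < 1 - t := by linarith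
  set q' : ℝ := q ^ (1 - t) with hq'
  have hq'0 : 0 < q' := Real.rpow_pos_of_pos hq0 _
  have hq'1 : q' < 1 := Real.rpow_lt_one hq0.le hq1 ht1
  refine ⟨2 * γ ^ (t / 2) * (1 - q')⁻¹, ?_, fun u hu K => ?_⟩
  · have : 0 < 1 - q' := by linarith
    positivity
  have hterm : ∀ l : ℕ, min (q ^ l * (2 * u)) (2 * √(γ * u)) ≤
      2 * γ ^ (t / 2) * u ^ θ * q' ^ l := by
    intro l
    rcases hu.eq_or_lt with rfl | hu
    · rw [Real.zero_rpow (by linarith)]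
      simp
    set a := q ^ l * (2 * u) with ha
    set b := 2 * √(γ * u) with hb
    have ha0 : 0 < a := by positivity
    have hb0 : 0 < b := by positivity
    have hmin : 0 < min a b := lt_min ha0 hb0
    calc min a b = min a b ^ (1 - t) * min a b ^ t := by
          rw [← Real.rpow_add hmin]
          simp
      _ ≤ a ^ (1 - t) * b ^ t := by
          gcongr
          · exact min_le_left _ _
          · exact min_le_right _ _
      _ = _ := by
          rw [ha, hb, Real.mul_rpow (by positivity) (by positivity),
            Real.mul_rpow (by positivity) (by positivity),
            Real.mul_rpow (by positivity) (by positivity), Real.sqrt_eq_rpow,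
            ← Real.rpow_mul (by positivity), Real.mul_rpow hγ.le hu.le]
          have e1 : (q ^ l) ^ (1 - t) = q' ^ l := by
            rw [hq', Real.rpow_pow_comm hq0.le]
          have e2 : (2 : ℝ) ^ (1 - t) * 2 ^ t = 2 := by
            rw [← Real.rpow_add (by norm_num)]
            simp
          have e3 : u ^ (1 - t) * u ^ (1 / 2 * t) = u ^ θ := by
            rw [← Real.rpow_add hu]
            congr 1
            rw [ht]
            ring
          rw [e1, show (1 / 2 * t) = t / 2 by ring] at *
          calc _ = (2 ^ (1 - t) * 2 ^ t) * γ ^ (t / 2) * (u ^ (1 - t) * u ^ (t / 2)) * q' ^ l := by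
                ring
            _ = _ := by rw [e2, e3]
  calc _ ≤ ∑ l ∈ Finset.range K, 2 * γ ^ (t / 2) * u ^ θ * q' ^ l :=
        Finset.sum_le_sum fun l _ => hterm l
    _ ≤ 2 * γ ^ (t / 2) * u ^ θ * (1 - q')⁻¹ := by
        rw [← Finset.mul_sum]
        gcongr
        exact sum_range_geometric_le hq'0.le hq'1 K
    _ = _ := by ring

/-! ### Ring sums under a weak moment -/

namespace RingPartition

variable {E : Type*} [MetricSpace E] [MeasurableSpace E] {μ : Measure E} {x₀ : E}
  {p γ R₀ : ℝ} {M K : ℕ} (D : RingPartition μ x₀ p γ R₀ M K)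

lemma real_B_le [IsFiniteMeasure μ] {r A : ℝ} (hA0 : 0 ≤ A)
    (hA : weakMomentPow μ x₀ (r * p) ≤ ENNReal.ofReal A) (hR : 0 < R₀) {j : ℕ} (hj : j < M) :
    μ.real (D.B j) ≤ A / R₀ ^ (r * p) * 2 ^ (r * p) * (2 ^ (r * p)) ^ j := by
  have h1 := (D.measure_B_le_tailFun hj).trans
    (tailFun_le_of_weakMomentPow_le hA (t := R₀ / 2 ^ (j + 1)) (by positivity))
  refine (ENNReal.toReal_le_of_le_ofReal (by positivity) h1).trans (le_of_eq ?_)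
  rw [Real.div_rpow hR.le (by positivity), ← Real.rpow_pow_comm (by norm_num), pow_succ]
  field_simp

/-- Ring j has size R₀ 2^(-j) and mass at most of order A (2^j/R₀)^(rp), so the terms have ratio
2^(rp)/4^p, less than 1 because r < 2. The outermost rings dominate; the last summand accounts for
the innermost ring. -/
lemma sum_sq_rpow_mul_le [IsProbabilityMeasure μ] {r A : ℝ} (hp : 0 < p) (hr : r < 2)
    (hA0 : 0 ≤ A) (hA : weakMomentPow μ x₀ (r * p) ≤ ENNReal.ofReal A) (hR : 0 < R₀) :
    ∑ j ∈ Finset.range (M + 1), ((R₀ / 2 ^ j) ^ p) ^ 2 * μ.real (D.B j) ≤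
      (R₀ ^ p) ^ 2 * (A / R₀ ^ (r * p) * (2 ^ (r * p) * (1 - 2 ^ (r * p) / (2 ^ p) ^ 2)⁻¹) +
        ((2 ^ M) ^ p)⁻¹) := by
  set q : ℝ := 2 ^ (r * p) / (2 ^ p) ^ 2 with hq
  have hq0 : 0 ≤ q := by positivity
  have hq1 : q < 1 := by
    rw [hq, div_lt_one (by positivity), ← Real.rpow_natCast, ← Real.rpow_mul (by norm_num)]
    refine Real.rpow_lt_rpow_of_exponent_lt (by norm_num) ?_
    push_cast
    nlinarith
  rw [Finset.sum_range_succ, mul_add]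
  refine add_le_add ?_ ?_
  · calc _ ≤ ∑ j ∈ Finset.range M, (R₀ ^ p) ^ 2 * (A / R₀ ^ (r * p) * 2 ^ (r * p)) * q ^ j := by
          refine Finset.sum_le_sum fun j hj => ?_
          calc _ ≤ ((R₀ / 2 ^ j) ^ p) ^ 2 *
                (A / R₀ ^ (r * p) * 2 ^ (r * p) * (2 ^ (r * p)) ^ j) := by
                gcongr
                exact D.real_B_le hA0 hA hR (Finset.mem_range.1 hj)
            _ = _ := by
                rw [Real.div_rpow hR.le (by positivity), ← Real.rpow_pow_comm (by norm_num) p, hq, div_pow, div_pow,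
                  ← pow_mul, ← pow_mul, mul_comm j 2]
                field_simp
      _ ≤ (R₀ ^ p) ^ 2 * (A / R₀ ^ (r * p) * 2 ^ (r * p)) * (1 - q)⁻¹ := by
          rw [← Finset.mul_sum]
          gcongr
          exact sum_range_geometric_le hq0 hq1 M
      _ = _ := by ring
  · rw [Real.div_rpow hR.le (by positivity), div_pow, div_eq_mul_inv, mul_assoc]
    gcongr
    have h1 : (1 : ℝ) ≤ (2 ^ M) ^ p := Real.one_le_rpow (one_le_pow₀ (by norm_num)) hp.le
    have h2 : (((2 : ℝ) ^ M) ^ p)⁻¹ ≤ 1 := inv_le_one_of_one_le₀ h1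
    have h3 : 0 ≤ (((2 : ℝ) ^ M) ^ p)⁻¹ := by positivity
    rw [← inv_pow, sq]
    calc _ ≤ (((2 : ℝ) ^ M) ^ p)⁻¹ * 1 * 1 := by
          gcongr
          exact measureReal_le_one
      _ = _ := by ring

/-- The terms now have ratio 2^(rpθ - p), and rθ < 1 makes the outermost rings dominate. The
innermost ring is bounded crudely through (nμ)^θ ≤ n. -/
lemma sum_rpow_mul_rpow_le [IsProbabilityMeasure μ] {r A θ : ℝ} (hp : 0 < p)
    (hθ : 0 < θ) (hθ1 : θ ≤ 1) (hrθ : r * θ < 1) (hA0 : 0 ≤ A)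
    (hA : weakMomentPow μ x₀ (r * p) ≤ ENNReal.ofReal A) (hR : 0 < R₀) {n : ℕ} (hn : 1 ≤ n) :
    ∑ j ∈ Finset.range (M + 1), (R₀ / 2 ^ j) ^ p * (n * μ.real (D.B j)) ^ θ ≤
      R₀ ^ p * ((n * A / R₀ ^ (r * p)) ^ θ *
        ((2 ^ (r * p)) ^ θ * (1 - (2 ^ (r * p)) ^ θ / 2 ^ p)⁻¹) + n * ((2 ^ M) ^ p)⁻¹) := by
  set q : ℝ := (2 ^ (r * p)) ^ θ / 2 ^ p with hq
  have hq0 : 0 ≤ q := by positivity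
  have hq1 : q < 1 := by
    rw [hq, div_lt_one (by positivity), ← Real.rpow_mul (by norm_num)]
    refine Real.rpow_lt_rpow_of_exponent_lt (by norm_num) ?_
    nlinarith
  rw [Finset.sum_range_succ, mul_add]
  refine add_le_add ?_ ?_
  · calc _ ≤ ∑ j ∈ Finset.range M, R₀ ^ p * ((n * A / R₀ ^ (r * p)) ^ θ * (2 ^ (r * p)) ^ θ) *
          q ^ j := by
          refine Finset.sum_le_sum fun j hj => ?_
          calc _ ≤ (R₀ / 2 ^ j) ^ p *
                (n * (A / R₀ ^ (r * p) * 2 ^ (r * p) * (2 ^ (r * p)) ^ j)) ^ θ := by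
                gcongr
                exact D.real_B_le hA0 hA hR (Finset.mem_range.1 hj)
            _ = _ := by
                have e1 : n * (A / R₀ ^ (r * p) * 2 ^ (r * p) * (2 ^ (r * p)) ^ j) =
                  n * A / R₀ ^ (r * p) * 2 ^ (r * p) * (2 ^ (r * p)) ^ j := by ring
                have e2 : (((2 : ℝ) ^ (r * p)) ^ j) ^ θ = ((2 ^ (r * p)) ^ θ) ^ j :=
                  (Real.rpow_pow_comm (by positivity) θ j).symm
                rw [e1, Real.mul_rpow (by positivity) (by positivity),
                  Real.mul_rpow (by positivity) (by positivity), e2,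
                  Real.div_rpow hR.le (by positivity), ← Real.rpow_pow_comm (by norm_num) p, hq, div_pow]
                field_simp
      _ ≤ R₀ ^ p * ((n * A / R₀ ^ (r * p)) ^ θ * (2 ^ (r * p)) ^ θ) * (1 - q)⁻¹ := by
          rw [← Finset.mul_sum]
          gcongr
          exact sum_range_geometric_le hq0 hq1 M
      _ = _ := by ring
  · rw [Real.div_rpow hR.le (by positivity), div_eq_mul_inv, mul_assoc]
    refine mul_le_mul_of_nonneg_left ?_ (by positivity)
    rw [mul_comm]
    refine mul_le_mul_of_nonneg_right ?_ (by positivity)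
    have hn' : (1 : ℝ) ≤ n := by exact_mod_cast hn
    calc (n * μ.real (D.B M)) ^ θ ≤ (n : ℝ) ^ θ := by
          gcongr
          exact mul_le_of_le_one_right (by positivity) measureReal_le_one
      _ ≤ (n : ℝ) ^ (1 : ℝ) := Real.rpow_le_rpow_of_exponent_le hn' hθ1
      _ = n := Real.rpow_one _

lemma integral_deviation_le_of_sum_min_le [IsProbabilityMeasure μ] [MeasurableSingletonClass E]
    (hR : 0 ≤ R₀) (n : ℕ) {c θ : ℝ}
    (hc : ∀ u : ℝ, 0 ≤ u → ∀ K : ℕ,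
      ∑ l ∈ Finset.range K, min (((2 ^ p)⁻¹) ^ l * (2 * u)) (2 * √(γ * u)) ≤ c * u ^ θ) :
    ∫ x, D.deviation x ∂(Measure.pi fun _ : Fin n => μ) ≤
      16 ^ p * c * ∑ j ∈ Finset.range (M + 1), (R₀ / 2 ^ j) ^ p * (n * μ.real (D.B j)) ^ θ := by
  refine (D.integral_deviation_le hR n).trans ?_
  rw [Finset.mul_sum]
  refine Finset.sum_le_sum fun j _ => ?_
  calc _ ≤ 16 ^ p * (R₀ / 2 ^ j) ^ p * (c * (n * μ.real (D.B j)) ^ θ) := by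
        gcongr
        exact hc _ (by positivity) _
    _ = _ := by ring

end RingPartition

/-! ### The non-asymptotic bound for 1 < r < 2 -/

lemma exists_lt_two_pow_rpow {p : ℝ} (hp : 1 ≤ p) (a : ℝ) : ∃ K : ℕ, a ≤ ((2 : ℝ) ^ K) ^ p := by
  obtain ⟨K, hK⟩ := pow_unbounded_of_one_lt a (one_lt_two : (1 : ℝ) < 2)
  exact ⟨K, hK.le.trans (Real.self_le_rpow_of_one_le (one_le_pow₀ (by norm_num)) hp)⟩


set_option maxHeartbeats 1000000 in
/-- Deviation bound of the order of a single large value, for weak moments of order `r p` with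
`1 < r < 2`. -/
lemma exists_measure_lt_wassersteinPow_le_of_lt_two {p α β r : ℝ} (hp : 1 ≤ p) (hα : α ≤ 2 * p)
    (hβ : 0 < β) (hr1 : 1 < r) (hr2 : r < 2) :
    ∃ C : ℝ, 0 < C ∧ ∀ (E : Type u) [MetricSpace E] [PolishSpace E] [MeasurableSpace E]
      [BorelSpace E] (μ : Measure E) [IsProbabilityMeasure μ] (S : Set E) (x₀ : E),
      μ S = 1 → HasCoveringDim S x₀ α β →
      ∀ A : ℝ, 0 < A → weakMomentPow μ x₀ (r * p) ≤ ENNReal.ofReal A →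
      ∀ n : ℕ, 1 ≤ n → ∀ (Ω : Type v) [MeasurableSpace Ω] (P : Measure Ω) [IsProbabilityMeasure P]
        (X : Fin n → Ω → E), IsIIDWithLaw X μ P → ∀ y : ℝ, 0 < y →
        P {ω | ENNReal.ofReal (y / n) <
          wassersteinPow p μ (empiricalMeasure fun i : Fin n => X i ω)} ≤
          ENNReal.ofReal (C * (n * A / y ^ r)) := by
  have hp0 : 0 < p := by linarith
  -- The sum over levels needs θ > 1/2 and the sum over rings needs rθ < 1; r < 2 leaves room for
  -- both.
  set θ : ℝ := (1 / 2 + 1 / r) / 2 with hθdef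
  have h1r : 1 / 2 < 1 / r := one_div_lt_one_div_of_lt (by linarith) hr2
  have h1r' : 1 / r < 1 := by rw [div_lt_one (by linarith)]; exact hr1
  have hθ : 1 / 2 < θ := by rw [hθdef]; linarith
  have hθr : θ < 1 / r := by rw [hθdef]; linarith
  have hθ1 : θ < 1 := hθr.trans h1r'
  have hrθ : r * θ < 1 := by
    rw [lt_div_iff₀ (by linarith)] at hθr
    linarith
  have h2p1 : (1 : ℝ) < 2 ^ p := Real.one_lt_rpow (by norm_num) hp0
  obtain ⟨c, hc0, hc⟩ := exists_sum_min_le (q := (2 ^ p)⁻¹) (γ := β + 1) (by positivity)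
    (inv_lt_one_of_one_lt₀ h2p1) (by linarith) hθ hθ1
  set T : ℝ := truncatedMomentConst p r with hT
  have hT0 : 0 < T := truncatedMomentConst_pos hp0 hr1
  set V : ℝ := 2 ^ (r * p) * (1 - 2 ^ (r * p) / (2 ^ p) ^ 2)⁻¹ with hV
  have hV0 : 0 < V := by
    have : (2 : ℝ) ^ (r * p) / (2 ^ p) ^ 2 < 1 := by
      rw [div_lt_one (by positivity), ← Real.rpow_natCast, ← Real.rpow_mul (by norm_num)]
      refine Real.rpow_lt_rpow_of_exponent_lt (by norm_num) ?_
      push_cast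
      nlinarith
    have : 0 < 1 - (2 : ℝ) ^ (r * p) / (2 ^ p) ^ 2 := by linarith
    positivity
  set G : ℝ := (2 ^ (r * p)) ^ θ * (1 - (2 ^ (r * p)) ^ θ / 2 ^ p)⁻¹ with hG
  have hG0 : 0 < G := by
    have : ((2 : ℝ) ^ (r * p)) ^ θ / 2 ^ p < 1 := by
      rw [div_lt_one (by positivity), ← Real.rpow_mul (by norm_num)]
      refine Real.rpow_lt_rpow_of_exponent_lt (by norm_num) ?_
      nlinarith
    have : 0 < 1 - ((2 : ℝ) ^ (r * p)) ^ θ / 2 ^ p := by linarith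
    positivity
  -- Thresholds for ε = nA/y^r: below ε₁ the mass of μ outside costs at most y/8, and below ε₂ the
  -- rings other than the innermost contribute at most y/8 to the mean. Above the smaller one, the
  -- summand 1/ε₀ of C makes the bound trivial.
  set ε₁ : ℝ := 1 / (8 * (2 ^ (p - 1) * T)) with hε₁
  have hε₁0 : 0 < ε₁ := by positivity
  set ε₂ : ℝ := (1 / (8 * (16 ^ p * c * G))) ^ θ⁻¹ with hε₂
  have hε₂0 : 0 < ε₂ := by positivity
  set ε₀ := min ε₁ ε₂ with hε₀
  have hε₀0 : 0 < ε₀ := lt_min hε₁0 hε₂0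
  set C : ℝ := 1 / ε₀ + (64 * (2 * 16 ^ p) ^ 2 * (V + 1) + 2) with hC
  have hC0 : 0 < 64 * (2 * (16 : ℝ) ^ p) ^ 2 * (V + 1) + 2 := by positivity
  refine ⟨C, by positivity, ?_⟩
  intro E _ _ _ _ μ _ S x₀ hμS hS A hA0 hA n hn Ω _ P _ X hX y hy
  have hn0 : n ≠ 0 := by omega
  have hn1 : (1 : ℝ) ≤ n := by exact_mod_cast hn
  set ε : ℝ := n * A / y ^ r with hε
  have hε0 : 0 < ε := by positivity
  rcases le_total ε₀ ε with hbig | hsmall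
  · refine prob_le_one.trans ?_
    rw [ENNReal.one_le_ofReal]
    have : 1 ≤ 1 / ε₀ * ε := by
      rw [one_div, ← div_eq_inv_mul, one_le_div hε₀0]
      exact hbig
    nlinarith [mul_pos hC0 hε0]
  -- parameters
  set R₀ : ℝ := y ^ p⁻¹ with hR₀
  have hR : 0 < R₀ := by positivity
  have hRp : R₀ ^ p = y := by
    rw [hR₀, ← Real.rpow_mul hy.le, inv_mul_cancel₀ hp0.ne', Real.rpow_one]
  have hRrp : R₀ ^ (r * p) = y ^ r := by
    rw [mul_comm, Real.rpow_mul hR.le, hRp]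
  -- No bound below grows with K or M, so they may be as large as needed: K makes the resolution
  -- error at most y/8, and M makes the innermost ring negligible.
  obtain ⟨K, hK⟩ := exists_lt_two_pow_rpow hp (8 * 8 ^ p * n)
  obtain ⟨M, hM⟩ := exists_lt_two_pow_rpow hp (max (n / ε) (8 * (16 ^ p * c * n)))
  have hM1 : n * ((2 ^ M) ^ p)⁻¹ ≤ ε := by
    have := (le_max_left _ _).trans hM
    rw [div_le_iff₀ hε0] at this
    rw [← div_eq_mul_inv, div_le_iff₀ (by positivity)]
    linarith
  have hM2 : 16 ^ p * c * (n * ((2 ^ M) ^ p)⁻¹) ≤ 1 / 8 := by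
    have := (le_max_right _ _).trans hM
    rw [← mul_assoc, ← div_eq_mul_inv, div_le_iff₀ (by positivity)]
    linarith
  obtain ⟨D⟩ := hS.nonempty_ringPartition μ hμS hp0.le hα hβ hR M K
  have h1 : n * (8 * R₀ / 2 ^ K) ^ p ≤ y / 8 := by
    rw [Real.div_rpow (by positivity) (by positivity), Real.mul_rpow (by norm_num) hR.le, hRp,
      ← mul_div_assoc, div_le_iff₀ (by positivity)]
    nlinarith
  have h2 : 2 ^ (p - 1) * (n * ∫⁻ z in (Metric.closedBall x₀ R₀)ᶜ, edist z x₀ ^ p ∂μ) ≤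
      ENNReal.ofReal (y / 8) := by
    refine (natCast_mul_lintegral_compl_closedBall_le hp0 hr1 hA0.le hA hR n).trans
      (ENNReal.ofReal_le_ofReal ?_)
    rw [hRp, hRrp, ← hε, ← hT]
    have h3 : ε ≤ 1 / (8 * (2 ^ (p - 1) * T)) := hsmall.trans (min_le_left _ _)
    rw [le_div_iff₀ (by positivity)] at h3
    calc _ = ε * (8 * (2 ^ (p - 1) * T)) * (y / 8) := by ring
      _ ≤ 1 * (y / 8) := by gcongr
      _ = _ := one_mul _
  have hmean : ∫ x, D.deviation x ∂(Measure.pi fun _ : Fin n => μ) ≤ y / 4 := by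
    refine (D.integral_deviation_le_of_sum_min_le hR.le n hc).trans ?_
    have h3 := D.sum_rpow_mul_rpow_le hp0 (by linarith) hθ1.le hrθ hA0.le hA hR hn
    rw [hRp, hRrp, ← hε, ← hG] at h3
    have h4 : ε ^ θ ≤ 1 / (8 * (16 ^ p * c * G)) := by
      calc ε ^ θ ≤ ε₂ ^ θ := by
            gcongr
            exact hsmall.trans (min_le_right _ _)
        _ = _ := by
            rw [hε₂, ← Real.rpow_mul (by positivity), inv_mul_cancel₀ (by linarith), Real.rpow_one]
    rw [le_div_iff₀ (by positivity)] at h4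
    calc _ ≤ 16 ^ p * c * (y * (ε ^ θ * G + n * ((2 ^ M) ^ p)⁻¹)) := by gcongr
      _ = y * (ε ^ θ * (8 * (16 ^ p * c * G)) / 8 + 16 ^ p * c * (n * ((2 ^ M) ^ p)⁻¹)) := by ring
      _ ≤ y * (1 / 8 + 1 / 8) := by gcongr
      _ = _ := by ring
  have hdev := D.pi_deviation_ge_le_sq hp hR.le n (m := y / 4) (t := y / 4) (by positivity) hmean
  rw [show y / 4 + y / 4 = y / 2 by ring] at hdev
  have hsq := D.sum_sq_rpow_mul_le hp0 hr2 hA0.le hA hR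
  rw [hRp, hRrp, ← hV] at hsq
  have hdev2 : n * (4 * ((2 * 16 ^ p) ^ 2 * ∑ j ∈ Finset.range (M + 1),
      ((R₀ / 2 ^ j) ^ p) ^ 2 * μ.real (D.B j))) / (y / 4) ^ 2 ≤
      64 * (2 * 16 ^ p) ^ 2 * (V + 1) * ε := by
    rw [div_le_iff₀ (by positivity)]
    calc _ ≤ n * (4 * ((2 * 16 ^ p) ^ 2 * (y ^ 2 * (A / y ^ r * V + ((2 ^ M) ^ p)⁻¹)))) := by gcongr
      _ = 4 * (2 * 16 ^ p) ^ 2 * y ^ 2 * (ε * V + n * ((2 ^ M) ^ p)⁻¹) := by rw [hε]; ring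
      _ ≤ 4 * (2 * 16 ^ p) ^ 2 * y ^ 2 * (ε * V + ε) := by gcongr
      _ = _ := by ring
  have htail : n * tailFun μ x₀ R₀ ≤ ENNReal.ofReal ε := by
    rw [hε, ← hRrp]
    exact natCast_mul_tailFun_le hA hR n
  -- With k = 0 no point outside R₀ is tolerated, so s is arbitrary; s = R₀ makes the two tail terms
  -- equal.
  calc _ ≤ _ := D.measure_lt_wassersteinPow_le hp hR.le hn0 hX hy (s := R₀) 0 h1 h2 (by
        simp only [Nat.cast_zero, zero_mul]
        positivity)
    _ ≤ ENNReal.ofReal (64 * (2 * 16 ^ p) ^ 2 * (V + 1) * ε) +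
        (ENNReal.ofReal ε + ENNReal.ofReal ε) := by
        rw [zero_add, pow_one]
        exact add_le_add (hdev.trans (ENNReal.ofReal_le_ofReal hdev2)) (add_le_add htail htail)
    _ = ENNReal.ofReal ((64 * (2 * 16 ^ p) ^ 2 * (V + 1) + 2) * ε) := by
        rw [← ENNReal.ofReal_add hε0.le hε0.le, ← ENNReal.ofReal_add (by positivity) (by positivity)]
        congr 1
        ring
    _ ≤ _ := by
        refine ENNReal.ofReal_le_ofReal ?_
        rw [hC]
        exact mul_le_mul_of_nonneg_right (le_add_of_nonneg_left (by positivity)) hε0.le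

/-! ### Logarithmically many levels for the asymptotic bounds -/

/-- The number of levels used for samples of size `n`. -/
noncomputable def levelCount (n : ℕ) : ℕ :=
  ⌈4 * Real.logb 2 n⌉₊

lemma pow_four_le_two_pow_levelCount {n : ℕ} (hn : 1 ≤ n) : (n : ℝ) ^ 4 ≤ 2 ^ levelCount n := by
  have hn0 : (0 : ℝ) < n := by exact_mod_cast hn
  calc (n : ℝ) ^ 4 = 2 ^ (4 * Real.logb 2 n) := by
        rw [mul_comm, Real.rpow_mul (by norm_num), Real.rpow_logb (by norm_num) (by norm_num) hn0]
        norm_cast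
    _ ≤ 2 ^ ((levelCount n : ℕ) : ℝ) :=
        Real.rpow_le_rpow_of_exponent_le (by norm_num) (Nat.le_ceil _)
    _ = _ := Real.rpow_natCast _ _

/-- The left side is of order √n log n, and ρ > 1/2 leaves a positive power of n. As the factor (K +
1)√n is at least √n, the same statement also absorbs constants and multiples of √n. -/
lemma eventually_levelCount_mul_sqrt_le {ρ x : ℝ} (hρ : 1 / 2 < ρ) (hx : 0 < x) (c : ℝ) :
    ∀ᶠ n : ℕ in atTop, c * ((levelCount n + 1) * √n) ≤ x * (n : ℝ) ^ ρ := by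
  have h1 : Tendsto (fun n : ℕ => |c| * ((4 / Real.log 2) * (Real.log n / (n : ℝ) ^ (ρ - 1 / 2)) +
      2 * (n : ℝ) ^ (-(ρ - 1 / 2)))) atTop (nhds (|c| * ((4 / Real.log 2) * 0 + 2 * 0))) := by
    have e1 : Tendsto (fun n : ℕ => Real.log n / (n : ℝ) ^ (ρ - 1 / 2)) atTop (nhds 0) :=
      ((isLittleO_log_rpow_atTop (by linarith : 0 < ρ - 1 / 2)).tendsto_div_nhds_zero).comp
        tendsto_natCast_atTop_atTop
    have e2 : Tendsto (fun n : ℕ => (n : ℝ) ^ (-(ρ - 1 / 2))) atTop (nhds 0) :=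
      (tendsto_rpow_neg_atTop (by linarith : 0 < ρ - 1 / 2)).comp tendsto_natCast_atTop_atTop
    exact ((e1.const_mul _).add (e2.const_mul _)).const_mul _
  rw [mul_zero, mul_zero, add_zero, mul_zero] at h1
  filter_upwards [h1.eventually (gt_mem_nhds hx), eventually_ge_atTop 1] with n hn hn1
  have hn0 : (0 : ℝ) < n := by exact_mod_cast hn1
  have hn1' : (1 : ℝ) ≤ n := by exact_mod_cast hn1
  have hlog : 0 ≤ Real.logb 2 n := Real.logb_nonneg (by norm_num) hn1'
  have hK : (levelCount n : ℝ) + 1 ≤ 4 / Real.log 2 * Real.log n + 2 := by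
    have := Nat.ceil_lt_add_one (show 0 ≤ 4 * Real.logb 2 n by positivity)
    rw [Real.logb] at this
    have h3 : 4 / Real.log 2 * Real.log n = 4 * (Real.log n / Real.log 2) := by ring
    rw [h3]
    unfold levelCount
    rw [Real.logb]
    linarith
  have hpow : (n : ℝ) ^ ρ = (n : ℝ) ^ (ρ - 1 / 2) * √n := by
    rw [Real.sqrt_eq_rpow, ← Real.rpow_add hn0]
    congr 1
    ring
  have hd : 0 < (n : ℝ) ^ (ρ - 1 / 2) := by positivity
  calc c * ((levelCount n + 1) * √n) ≤ |c| * ((levelCount n + 1) * √n) := by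
        gcongr
        exact le_abs_self c
    _ ≤ |c| * ((4 / Real.log 2 * Real.log n + 2) * √n) := by gcongr
    _ = |c| * ((4 / Real.log 2) * (Real.log n / (n : ℝ) ^ (ρ - 1 / 2)) +
          2 * (n : ℝ) ^ (-(ρ - 1 / 2))) * ((n : ℝ) ^ (ρ - 1 / 2) * √n) := by
        rw [Real.rpow_neg hn0.le]
        field_simp
    _ ≤ x * ((n : ℝ) ^ (ρ - 1 / 2) * √n) := by gcongr
    _ = _ := by rw [hpow]

/-- Common preparation for the two limit statements, which take R₀^p = n² and R₀^p = √n. The 1/n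
beside 4^p J comes from the innermost ring; it disappears in the limit, which keeps the constant
proportional to I_{2p,p}². -/
lemma exists_ringPartition_deviation_bounds {p α β : ℝ} (hp : 1 ≤ p) (hα : α ≤ 2 * p) (hβ : 0 < β)
    {E : Type*} [MetricSpace E] [PolishSpace E] [MeasurableSpace E] [BorelSpace E] (μ : Measure E)
    [IsProbabilityMeasure μ] {S : Set E} {x₀ : E} (hμS : μ S = 1) (hS : HasCoveringDim S x₀ α β)
    {J : ℝ} (hJ0 : 0 ≤ J) (hJ : sqrtTailIntegral μ x₀ p ≤ ENNReal.ofReal J) {n : ℕ} (hn : 1 ≤ n)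
    {a : ℝ} (ha : a ≤ 2) {R₀ : ℝ} (hR : 0 < R₀) (hRp : R₀ ^ p = (n : ℝ) ^ a) {y : ℝ}
    (hy : 8 ^ p ≤ y / 8)
    (hmean : 16 ^ p * (2 * √(β + 1)) * (4 ^ p * J + 1) * ((levelCount n + 1) * √n) ≤ y / 4) :
    ∃ (M : ℕ) (D : RingPartition μ x₀ p (β + 1) R₀ M (levelCount n)),
      n * (8 * R₀ / 2 ^ levelCount n) ^ p ≤ y / 8 ∧
      ∫ x, D.deviation x ∂(Measure.pi fun _ : Fin n => μ) ≤ y / 4 ∧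
      ∑ j ∈ Finset.range (M + 1), ((R₀ / 2 ^ j) ^ p) ^ 2 * μ.real (D.B j) ≤
        (4 ^ p * J + 1 / n) ^ 2 := by
  have hp0 : 0 < p := by linarith
  have hn0 : (0 : ℝ) < n := by exact_mod_cast hn
  have hn1 : (1 : ℝ) ≤ n := by exact_mod_cast hn
  obtain ⟨M, hM⟩ := exists_lt_two_pow_rpow hp (n * R₀ ^ p)
  obtain ⟨D⟩ := hS.nonempty_ringPartition μ hμS hp0.le hα hβ hR M (levelCount n)
  have hsmall : (R₀ / 2 ^ M) ^ p ≤ 1 / n := by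
    rw [Real.div_rpow hR.le (by positivity), div_le_div_iff₀ (by positivity) hn0]
    linarith
  have hQ : ∑ j ∈ Finset.range (M + 1), (R₀ / 2 ^ j) ^ p * √(μ.real (D.B j)) ≤
      4 ^ p * J + 1 / n := (D.sum_rpow_mul_sqrt_le hp hR hJ0 hJ).trans (by linarith)
  refine ⟨M, D, ?_, ?_, D.sum_sq_le_sq hQ hR.le⟩
  · have hK := pow_four_le_two_pow_levelCount hn
    have hK2 : (2 : ℝ) ^ levelCount n ≤ (2 ^ levelCount n) ^ p :=
      Real.self_le_rpow_of_one_le (one_le_pow₀ (by norm_num)) hp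
    have ha' : (n : ℝ) ^ a ≤ n ^ 2 := by
      rw [← Real.rpow_two]
      exact Real.rpow_le_rpow_of_exponent_le hn1 ha
    refine le_trans ?_ hy
    rw [Real.div_rpow (by positivity) (by positivity), Real.mul_rpow (by norm_num) hR.le, hRp,
      ← mul_div_assoc, div_le_iff₀ (by positivity)]
    -- As R₀^p ≤ n², the numerator is at most 8^p n³, and 2^K ≥ n⁴ is more than enough.
    calc n * (8 ^ p * (n : ℝ) ^ a) ≤ n * (8 ^ p * n ^ 2) := by gcongr
      _ = 8 ^ p * (n ^ 3 * 1) := by ring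
      _ ≤ 8 ^ p * (n ^ 3 * n) := by gcongr
      _ = 8 ^ p * n ^ 4 := by ring
      _ ≤ _ := by
        gcongr
        exact hK.trans hK2
  · refine (D.integral_deviation_le_sqrt (by linarith) hR.le n hQ).trans (le_trans ?_ hmean)
    have : 1 / (n : ℝ) ≤ 1 := by
      rw [div_le_one hn0]
      exact hn1
    calc _ ≤ 16 ^ p * (levelCount n + 1) * (2 * √(β + 1) * √n) * (4 ^ p * J + 1) := by gcongr
      _ = _ := by ring

lemma limsup_le_ofReal_of_eventually_le {f : ℕ → ℝ≥0∞} {g : ℕ → ℝ} {L : ℝ}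
    (hg : Tendsto g atTop (nhds L)) (h : ∀ᶠ n in atTop, f n ≤ ENNReal.ofReal (g n)) :
    limsup f atTop ≤ ENNReal.ofReal L := by
  refine (limsup_le_limsup h).trans (le_of_eq ?_)
  exact ((ENNReal.continuous_ofReal.tendsto L).comp hg).limsup_eq

lemma IsIIDWithLaw.fin {Ω E : Type*} [MeasurableSpace Ω] [MeasurableSpace E] {X : ℕ → Ω → E}
    {μ : Measure E} {P : Measure Ω} (hX : IsIIDWithLaw X μ P) (n : ℕ) :
    IsIIDWithLaw (fun i : Fin n => X i) μ P :=
  ⟨fun i => hX.measurable i, fun i => hX.law i, hX.indep.precomp Fin.val_injective⟩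

lemma div_rpow_one_sub_eq {n : ℕ} (hn : 1 ≤ n) (x ρ : ℝ) :
    x / (n : ℝ) ^ (1 - ρ) = x * (n : ℝ) ^ ρ / n := by
  have hn0 : (0 : ℝ) < n := by exact_mod_cast hn
  rw [Real.rpow_sub hn0, Real.rpow_one]
  field_simp

/-! ### The two asymptotic deviation bounds -/

section Limits

variable {p α β : ℝ} {E : Type u} [MetricSpace E] [PolishSpace E] [MeasurableSpace E]
  [BorelSpace E] {μ : Measure E} [IsProbabilityMeasure μ] {S : Set E} {x₀ : E}
  {Ω : Type v} [MeasurableSpace Ω] {P : Measure Ω} [IsProbabilityMeasure P] {X : ℕ → Ω → E}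

/-- Deviations under finiteness of the square root tail integral. -/
lemma limsup_measure_lt_wassersteinPow_le_of_sqrtTailIntegral (hp : 1 ≤ p) (hα : α ≤ 2 * p)
    (hβ : 0 < β) (hμS : μ S = 1) (hS : HasCoveringDim S x₀ α β) {J : ℝ} (hJ0 : 0 ≤ J)
    (hJ : sqrtTailIntegral μ x₀ p ≤ ENNReal.ofReal J) (hX : IsIIDWithLaw X μ P)
    {ρ : ℝ} (hρ : 1 / 2 < ρ) (hρ1 : ρ ≤ 1) {x : ℝ} (hx : 0 < x) :
    limsup (fun n : ℕ => ENNReal.ofReal ((n : ℝ) ^ (2 * ρ - 1)) *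
        P {ω | ENNReal.ofReal (x / (n : ℝ) ^ (1 - ρ)) <
          wassersteinPow p μ (empiricalMeasure fun i : Fin n => X i ω)}) atTop ≤
      ENNReal.ofReal (64 * (2 * 16 ^ p) ^ 2 * (4 ^ p * J) ^ 2 / x ^ 2) := by
  have hp0 : 0 < p := by linarith
  set A : ℝ := 4 ^ p * J ^ 2 with hAdef
  have hA0 : 0 ≤ A := by positivity
  have hA : weakMomentPow μ x₀ (2 * p) ≤ ENNReal.ofReal A := weakMomentPow_two_mul_le hp hJ0 hJ
  set T : ℝ := truncatedMomentConst p 2 with hT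
  have hT0 : 0 < T := truncatedMomentConst_pos hp0 one_lt_two
  have hinv : Tendsto (fun n : ℕ => 1 / (n : ℝ)) atTop (nhds 0) :=
    tendsto_one_div_atTop_nhds_zero_nat
  have hlim : Tendsto (fun n : ℕ => 64 * (2 * 16 ^ p) ^ 2 * (4 ^ p * J + 1 / n) ^ 2 / x ^ 2 +
      2 * A * (1 / n)) atTop
      (nhds (64 * (2 * 16 ^ p) ^ 2 * (4 ^ p * J + 0) ^ 2 / x ^ 2 + 2 * A * 0)) :=
    (((((hinv.const_add _).pow 2).const_mul _).div_const _)).add (hinv.const_mul _)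
  rw [mul_zero, add_zero, add_zero] at hlim
  refine limsup_le_ofReal_of_eventually_le hlim ?_
  filter_upwards [eventually_levelCount_mul_sqrt_le hρ (by positivity : 0 < x / 4)
      (16 ^ p * (2 * √(β + 1)) * (4 ^ p * J + 1)),
    eventually_levelCount_mul_sqrt_le hρ (by positivity : 0 < x / 8) (8 ^ p),
    eventually_levelCount_mul_sqrt_le hρ (by positivity : 0 < x / 8) (2 ^ (p - 1) * T * A),
    eventually_ge_atTop 1] with n h1 h2 h3 hn
  have hn0 : (0 : ℝ) < n := by exact_mod_cast hn
  have hn1 : (1 : ℝ) ≤ n := by exact_mod_cast hn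
  have hKn : (1 : ℝ) ≤ (levelCount n + 1) * √n := by
    have : 1 ≤ √n := Real.one_le_sqrt.2 hn1
    nlinarith [(Nat.cast_nonneg (levelCount n) : (0 : ℝ) ≤ levelCount n)]
  set y : ℝ := x * (n : ℝ) ^ ρ with hy
  have hy0 : 0 < y := by positivity
  -- With R₀^p = n² the weak moment of order 2p gives n H(R₀) ≤ A/n³, which stays negligible after
  -- multiplication by n^(2ρ-1) ≤ n². The Chebyshev term alone survives.
  set R₀ : ℝ := ((n : ℝ) ^ (2 : ℝ)) ^ p⁻¹ with hR₀
  have hR : 0 < R₀ := by positivity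
  have hRp : R₀ ^ p = (n : ℝ) ^ (2 : ℝ) := by
    rw [hR₀, ← Real.rpow_mul (by positivity), inv_mul_cancel₀ hp0.ne', Real.rpow_one]
  have hRrp : R₀ ^ (2 * p) = (n : ℝ) ^ 4 := by
    rw [mul_comm, Real.rpow_mul hR.le, hRp, ← Real.rpow_mul hn0.le]
    norm_num
  obtain ⟨M, D, d1, d2, d3⟩ := exists_ringPartition_deviation_bounds hp hα hβ μ hμS hS hJ0 hJ hn
    le_rfl hR hRp (y := y) (by nlinarith [Real.rpow_pos_of_pos (by norm_num : (0 : ℝ) < 8) p])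
    (by linarith)
  have e2 : 2 ^ (p - 1) * (n * ∫⁻ z in (Metric.closedBall x₀ R₀)ᶜ, edist z x₀ ^ p ∂μ) ≤
      ENNReal.ofReal (y / 8) := by
    refine (natCast_mul_lintegral_compl_closedBall_le hp0 one_lt_two hA0 hA hR n).trans
      (ENNReal.ofReal_le_ofReal ?_)
    rw [hRp, hRrp, ← hT, Real.rpow_two]
    calc _ = 2 ^ (p - 1) * T * A * (1 / n) := by field_simp
      _ ≤ 2 ^ (p - 1) * T * A * 1 := by
          gcongr
          rw [div_le_one hn0]
          exact hn1
      _ ≤ 2 ^ (p - 1) * T * A * ((levelCount n + 1) * √n) := by gcongr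
      _ ≤ y / 8 := by linarith
  have hdev := D.pi_deviation_ge_le_sq hp hR.le n (m := y / 4) (t := y / 4) (by positivity) d2
  rw [show y / 4 + y / 4 = y / 2 by ring] at hdev
  have htail : n * tailFun μ x₀ R₀ ≤ ENNReal.ofReal (n * A / n ^ 4) := by
    rw [← hRrp]
    exact natCast_mul_tailFun_le hA hR n
  have hprob := D.measure_lt_wassersteinPow_le hp hR.le (by omega) (hX.fin n) hy0 (s := R₀) 0 d1 e2
    (by simp only [Nat.cast_zero, zero_mul]; positivity)
  rw [zero_add, pow_one] at hprob
  rw [div_rpow_one_sub_eq hn]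
  calc _ ≤ ENNReal.ofReal ((n : ℝ) ^ (2 * ρ - 1)) *
        (ENNReal.ofReal (n * (4 * ((2 * 16 ^ p) ^ 2 * (4 ^ p * J + 1 / n) ^ 2)) / (y / 4) ^ 2) +
          (ENNReal.ofReal (n * A / n ^ 4) + ENNReal.ofReal (n * A / n ^ 4))) := by
        gcongr
        refine hprob.trans (add_le_add (hdev.trans (ENNReal.ofReal_le_ofReal ?_))
          (add_le_add htail htail))
        gcongr
    _ = ENNReal.ofReal ((n : ℝ) ^ (2 * ρ - 1) *
        (n * (4 * ((2 * 16 ^ p) ^ 2 * (4 ^ p * J + 1 / n) ^ 2)) / (y / 4) ^ 2 +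
          (n * A / n ^ 4 + n * A / n ^ 4))) := by
        rw [← ENNReal.ofReal_add (by positivity) (by positivity),
          ← ENNReal.ofReal_add (by positivity) (by positivity),
          ← ENNReal.ofReal_mul (by positivity)]
    _ ≤ _ := by
        refine ENNReal.ofReal_le_ofReal ?_
        rw [mul_add]
        refine add_le_add (le_of_eq ?_) ?_
        · have e3 : (n : ℝ) ^ (2 * ρ - 1) = ((n : ℝ) ^ ρ) ^ 2 / n := by
            rw [Real.rpow_sub_one hn0.ne', mul_comm, Real.rpow_mul hn0.le, Real.rpow_two]
          rw [e3, hy]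
          field_simp
          ring
        · calc (n : ℝ) ^ (2 * ρ - 1) * (n * A / n ^ 4 + n * A / n ^ 4)
              ≤ (n : ℝ) ^ (2 : ℝ) * (n * A / n ^ 4 + n * A / n ^ 4) := by
                gcongr
                linarith
            _ = 2 * A * (1 / n) := by
                rw [Real.rpow_two]
                field_simp
                ring

set_option maxHeartbeats 1000000 in
/-- Deviations under a weak moment of order `r p` with `r > 2`. -/
lemma limsup_measure_lt_wassersteinPow_le_of_two_lt (hp : 1 ≤ p) (hα : α ≤ 2 * p)
    (hβ : 0 < β) (hμS : μ S = 1) (hS : HasCoveringDim S x₀ α β) {r A : ℝ} (hr : 2 < r)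
    (hA0 : 0 ≤ A) (hA : weakMomentPow μ x₀ (r * p) ≤ ENNReal.ofReal A) (hX : IsIIDWithLaw X μ P)
    {k : ℕ} (hk : 0 < k) (hkr : r - 1 < (r / 2 - 1) * k)
    {ρ : ℝ} (hρ : 1 / 2 < ρ) (hρ1 : ρ ≤ 1) {x : ℝ} (hx : 0 < x) :
    limsup (fun n : ℕ => ENNReal.ofReal ((n : ℝ) ^ (r * ρ - 1)) *
        P {ω | ENNReal.ofReal (x / (n : ℝ) ^ (1 - ρ)) <
          wassersteinPow p μ (empiricalMeasure fun i : Fin n => X i ω)}) atTop ≤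
      ENNReal.ofReal ((k * 2 ^ (p + 1)) ^ r * A / x ^ r) := by
  have hp0 : 0 < p := by linarith
  have hk0 : (0 : ℝ) < k := by exact_mod_cast hk
  set J : ℝ := (sqrtTailIntegral μ x₀ p).toReal with hJdef
  have hJ0 : 0 ≤ J := ENNReal.toReal_nonneg
  have hJ : sqrtTailIntegral μ x₀ p ≤ ENNReal.ofReal J :=
    (ENNReal.ofReal_toReal (sqrtTailIntegral_lt_top hp hr hA0 hA).ne).ge
  set T : ℝ := truncatedMomentConst p r with hT
  have hT0 : 0 < T := truncatedMomentConst_pos hp0 (by linarith)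
  set B : ℝ := Real.exp (2 * (2 * 16 ^ p)) * (4 * ((2 * 16 ^ p) ^ 2 * (4 ^ p * J + 1) ^ 2)) with hB
  set c : ℝ := (k * 2 ^ (p + 1)) ^ r * A / x ^ r with hc
  -- More than k points outside have probability at most (A n^(1-r/2))^(k+1). Multiplied by n^(rρ-1)
  -- ≤ n^(r-1), this is A^(k+1) n^(-d).
  set d : ℝ := (r / 2 - 1) * (k + 1) - (r - 1) with hd
  have hd0 : 0 < d := by
    rw [hd]
    nlinarith
  have hlim1 : Tendsto (fun n : ℕ => (n : ℝ) ^ (r * ρ - 1) *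
      Real.exp (B - x / 4 * (n : ℝ) ^ (ρ - 1 / 2))) atTop (nhds 0) := by
    have hδ : 0 < ρ - 1 / 2 := by linarith
    have h1 := (tendsto_rpow_mul_exp_neg_mul_atTop_nhds_zero ((r * ρ - 1) / (ρ - 1 / 2)) (x / 4)
      (by positivity)).comp ((tendsto_rpow_atTop hδ).comp tendsto_natCast_atTop_atTop)
    have h2 := h1.const_mul (Real.exp B)
    rw [mul_zero] at h2
    refine h2.congr fun n => ?_
    have hn0 : (0 : ℝ) ≤ n := Nat.cast_nonneg n
    simp only [Function.comp_apply]
    rw [← Real.rpow_mul hn0, mul_div_cancel₀ _ hδ.ne', sub_eq_add_neg B, Real.exp_add, neg_mul]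
    ring
  have hlim2 : Tendsto (fun n : ℕ => A ^ (k + 1) * (n : ℝ) ^ (-d)) atTop (nhds 0) := by
    have := ((tendsto_rpow_neg_atTop hd0).comp tendsto_natCast_atTop_atTop).const_mul (A ^ (k + 1))
    rwa [mul_zero] at this
  have hlim := hlim1.add (hlim2.const_add c)
  rw [add_zero, zero_add] at hlim
  refine limsup_le_ofReal_of_eventually_le hlim ?_
  filter_upwards [eventually_levelCount_mul_sqrt_le hρ (by positivity : 0 < x / 4)
      (16 ^ p * (2 * √(β + 1)) * (4 ^ p * J + 1)),
    eventually_levelCount_mul_sqrt_le hρ (by positivity : 0 < x / 8) (8 ^ p),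
    eventually_levelCount_mul_sqrt_le hρ (by positivity : 0 < x / 8) (2 ^ (p - 1) * T * A),
    eventually_ge_atTop 1] with n h1 h2 h3 hn
  have hn0 : (0 : ℝ) < n := by exact_mod_cast hn
  have hn1 : (1 : ℝ) ≤ n := by exact_mod_cast hn
  have hs0 : 0 < √(n : ℝ) := Real.sqrt_pos.2 hn0
  have hK0 : (0 : ℝ) ≤ levelCount n := Nat.cast_nonneg _
  have hKn : √(n : ℝ) ≤ (levelCount n + 1) * √n := by nlinarith
  have hKn1 : (1 : ℝ) ≤ (levelCount n + 1) * √n := (Real.one_le_sqrt.2 hn1).trans hKn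
  set y : ℝ := x * (n : ℝ) ^ ρ with hy
  have hy0 : 0 < y := by positivity
  set R₀ : ℝ := ((n : ℝ) ^ (1 / 2 : ℝ)) ^ p⁻¹ with hR₀
  have hR : 0 < R₀ := by positivity
  have hRp : R₀ ^ p = (n : ℝ) ^ (1 / 2 : ℝ) := by
    rw [hR₀, ← Real.rpow_mul (by positivity), inv_mul_cancel₀ hp0.ne', Real.rpow_one]
  have hRp' : R₀ ^ p = √(n : ℝ) := by rw [hRp, Real.sqrt_eq_rpow]
  have hRrp : R₀ ^ (r * p) = (n : ℝ) ^ (r / 2) := by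
    rw [mul_comm, Real.rpow_mul hR.le, hRp, ← Real.rpow_mul hn0.le]
    congr 1
    ring
  obtain ⟨M, D, d1, d2, d3⟩ := exists_ringPartition_deviation_bounds hp hα hβ μ hμS hS hJ0 hJ hn
    (by norm_num : (1 / 2 : ℝ) ≤ 2) hR hRp (y := y)
    (by nlinarith [Real.rpow_pos_of_pos (by norm_num : (0 : ℝ) < 8) p]) (by linarith)
  have hnr : n * A / (n : ℝ) ^ (r / 2) = A * (n : ℝ) ^ (-(r / 2 - 1)) := by
    rw [Real.rpow_neg hn0.le, Real.rpow_sub_one hn0.ne']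
    field_simp
  have e2 : 2 ^ (p - 1) * (n * ∫⁻ z in (Metric.closedBall x₀ R₀)ᶜ, edist z x₀ ^ p ∂μ) ≤
      ENNReal.ofReal (y / 8) := by
    refine (natCast_mul_lintegral_compl_closedBall_le hp0 (by linarith) hA0 hA hR n).trans
      (ENNReal.ofReal_le_ofReal ?_)
    rw [hRp', hRrp, ← hT, hnr]
    have h4 : (n : ℝ) ^ (-(r / 2 - 1)) ≤ 1 :=
      Real.rpow_le_one_of_one_le_of_nonpos hn1 (by linarith)
    calc _ ≤ 2 ^ (p - 1) * T * (A * 1) * ((levelCount n + 1) * √n) := by gcongr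
      _ = 2 ^ (p - 1) * T * A * ((levelCount n + 1) * √n) := by ring
      _ ≤ y / 8 := by linarith
  -- Since R₀^p = √n, the choice l = 1/√n keeps both n l² and l R₀^p bounded, while l y/4 = (x/4)
  -- n^(ρ-1/2) tends to infinity: the inner part decays faster than any power of n.
  have hdev := D.pi_deviation_ge_le_exp hp hR.le n (m := y / 4) (t := y / 4) (l := (√n)⁻¹)
    (by positivity) d2
  rw [show y / 4 + y / 4 = y / 2 by ring] at hdev
  have hexp : n * ((√n)⁻¹ ^ 2 * Real.exp (2 * (√n)⁻¹ * (2 * 16 ^ p * R₀ ^ p)) *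
      (4 * ((2 * 16 ^ p) ^ 2 * ∑ j ∈ Finset.range (M + 1), ((R₀ / 2 ^ j) ^ p) ^ 2 *
        μ.real (D.B j)))) - (√n)⁻¹ * (y / 4) ≤ B - x / 4 * (n : ℝ) ^ (ρ - 1 / 2) := by
    refine sub_le_sub ?_ (le_of_eq ?_)
    · have h5 : 2 * (√n)⁻¹ * (2 * 16 ^ p * R₀ ^ p) = 2 * (2 * 16 ^ p) := by
        rw [hRp']
        field_simp
      have h6 : (√n)⁻¹ ^ 2 = (n : ℝ)⁻¹ := by rw [inv_pow, Real.sq_sqrt hn0.le]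
      have h7 : (4 ^ p * J + 1 / n) ^ 2 ≤ (4 ^ p * J + 1) ^ 2 := by
        gcongr
        rw [div_le_one hn0]
        exact hn1
      rw [h5, h6, mul_assoc, ← mul_assoc, mul_inv_cancel₀ hn0.ne', one_mul, hB]
      gcongr
      exact d3.trans h7
    · rw [hy, Real.rpow_sub hn0, ← Real.sqrt_eq_rpow]
      field_simp
  -- The largest s for which k points at distance s cost no more than y/4. The bound on n H(s) is
  -- then the only term to survive in the limit.
  set s : ℝ := (y / (k * 2 ^ (p + 1))) ^ p⁻¹ with hs
  have hsp : s ^ p = y / (k * 2 ^ (p + 1)) := by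
    rw [hs, ← Real.rpow_mul (by positivity), inv_mul_cancel₀ hp0.ne', Real.rpow_one]
  have hs0 : 0 < s := by positivity
  have hsrp : s ^ (r * p) = (y / (k * 2 ^ (p + 1))) ^ r := by
    rw [mul_comm, Real.rpow_mul hs0.le, hsp]
  have hprob := D.measure_lt_wassersteinPow_le hp hR.le (by omega) (hX.fin n) hy0 (s := s) k d1 e2
    (by
      rw [hsp, Real.rpow_sub_one (by norm_num), Real.rpow_add_one (by norm_num)]
      refine le_of_eq ?_
      field_simp
      norm_num)
  have htail := natCast_mul_tailFun_le hA hs0 n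
  rw [hsrp] at htail
  have htail2 := natCast_mul_tailFun_le hA hR n
  rw [hRrp, hnr] at htail2
  have htail3 := pow_le_pow_left₀ zero_le htail2 (k + 1)
  rw [← ENNReal.ofReal_pow (by positivity)] at htail3
  rw [div_rpow_one_sub_eq hn]
  calc _ ≤ ENNReal.ofReal ((n : ℝ) ^ (r * ρ - 1)) *
        (ENNReal.ofReal (Real.exp (B - x / 4 * (n : ℝ) ^ (ρ - 1 / 2))) +
          (ENNReal.ofReal (n * A / (y / (k * 2 ^ (p + 1))) ^ r) +
            ENNReal.ofReal ((A * (n : ℝ) ^ (-(r / 2 - 1))) ^ (k + 1)))) := by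
        gcongr
        exact hprob.trans (add_le_add (hdev.trans (ENNReal.ofReal_le_ofReal
          (Real.exp_le_exp.2 hexp))) (add_le_add htail htail3))
    _ = ENNReal.ofReal ((n : ℝ) ^ (r * ρ - 1) *
        (Real.exp (B - x / 4 * (n : ℝ) ^ (ρ - 1 / 2)) +
          (n * A / (y / (k * 2 ^ (p + 1))) ^ r +
            (A * (n : ℝ) ^ (-(r / 2 - 1))) ^ (k + 1)))) := by
        rw [← ENNReal.ofReal_add (by positivity) (by positivity),
          ← ENNReal.ofReal_add (by positivity) (by positivity),
          ← ENNReal.ofReal_mul (by positivity)]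
    _ ≤ _ := by
        refine ENNReal.ofReal_le_ofReal ?_
        rw [mul_add, mul_add]
        refine add_le_add le_rfl (add_le_add (le_of_eq ?_) ?_)
        · rw [hc, hy, Real.div_rpow (by positivity) (by positivity),
            Real.mul_rpow hx.le (by positivity), ← Real.rpow_mul hn0.le, mul_comm ρ,
            Real.rpow_sub_one hn0.ne']
          field_simp
        · have h8 : ((n : ℝ) ^ (-(r / 2 - 1))) ^ (k + 1) = (n : ℝ) ^ (-(r / 2 - 1) * (k + 1)) := by
            rw [← Real.rpow_natCast, ← Real.rpow_mul hn0.le]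
            push_cast
            ring_nf
          rw [mul_pow, h8, mul_left_comm, ← Real.rpow_add hn0]
          refine mul_le_mul_of_nonneg_left (Real.rpow_le_rpow_of_exponent_le hn1 ?_) (by positivity)
          rw [hd]
          nlinarith

end Limits

/-! ### Assembly of the three statements -/

theorem mainTheorem9 :
    -- weak moment of order `r p` with `r > 2`
    (∀ p r : ℝ, 1 ≤ p → 2 < r → ∃ C : ℝ, 0 < C ∧
      ∀ α β : ℝ, 0 < α → α ≤ 2 * p → 0 < β →
      ∀ (E : Type u) [MetricSpace E] [PolishSpace E] [MeasurableSpace E] [BorelSpace E]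
        (μ : Measure E) [IsProbabilityMeasure μ] (S : Set E) (x₀ : E),
        μ S = 1 → HasCoveringDim S x₀ α β → weakMomentPow μ x₀ (r * p) < ∞ →
      ∀ (Ω : Type v) [MeasurableSpace Ω] (P : Measure Ω) [IsProbabilityMeasure P]
        (X : ℕ → Ω → E), IsIIDWithLaw X μ P →
      ∀ ρ : ℝ, 1 / 2 < ρ → ρ ≤ 1 → ∀ x : ℝ, 0 < x →
        limsup (fun n : ℕ => ENNReal.ofReal ((n : ℝ) ^ (r * ρ - 1)) *
            P {ω | ENNReal.ofReal (x / (n : ℝ) ^ (1 - ρ)) <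
              wassersteinPow p μ (empiricalMeasure fun i : Fin n => X i ω)}) atTop
          ≤ ENNReal.ofReal C * weakMomentPow μ x₀ (r * p) / ENNReal.ofReal (x ^ r)) ∧
    -- `I_{2p,p} < ∞`
    (∀ p α β : ℝ, 1 ≤ p → 0 < α → α ≤ 2 * p → 0 < β → ∃ C : ℝ, 0 < C ∧
      ∀ (E : Type u) [MetricSpace E] [PolishSpace E] [MeasurableSpace E] [BorelSpace E]
        (μ : Measure E) [IsProbabilityMeasure μ] (S : Set E) (x₀ : E),
        μ S = 1 → HasCoveringDim S x₀ α β → sqrtTailIntegral μ x₀ p < ∞ →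
      ∀ (Ω : Type v) [MeasurableSpace Ω] (P : Measure Ω) [IsProbabilityMeasure P]
        (X : ℕ → Ω → E), IsIIDWithLaw X μ P →
      ∀ ρ : ℝ, 1 / 2 < ρ → ρ ≤ 1 → ∀ x : ℝ, 0 < x →
        limsup (fun n : ℕ => ENNReal.ofReal ((n : ℝ) ^ (2 * ρ - 1)) *
            P {ω | ENNReal.ofReal (x / (n : ℝ) ^ (1 - ρ)) <
              wassersteinPow p μ (empiricalMeasure fun i : Fin n => X i ω)}) atTop
          ≤ ENNReal.ofReal C * sqrtTailIntegral μ x₀ p ^ 2 / ENNReal.ofReal (x ^ 2)) ∧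
    -- weak moment of order `r p` with `1 < r < 2`: a bound for every sample size `n ≥ 1`
    (∀ p α β r : ℝ, 1 ≤ p → 0 < α → α ≤ 2 * p → 0 < β → 1 < r → r < 2 → ∃ C : ℝ, 0 < C ∧
      ∀ (E : Type u) [MetricSpace E] [PolishSpace E] [MeasurableSpace E] [BorelSpace E]
        (μ : Measure E) [IsProbabilityMeasure μ] (S : Set E) (x₀ : E),
        μ S = 1 → HasCoveringDim S x₀ α β → weakMomentPow μ x₀ (r * p) < ∞ →
      ∀ (n : ℕ), 1 ≤ n →
      ∀ (Ω : Type v) [MeasurableSpace Ω] (P : Measure Ω) [IsProbabilityMeasure P]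
        (X : Fin n → Ω → E), IsIIDWithLaw X μ P →
      ∀ ρ : ℝ, 1 / r ≤ ρ → ρ ≤ 1 → ∀ x : ℝ, 0 < x →
        ENNReal.ofReal ((n : ℝ) ^ (r * ρ - 1)) *
            P {ω | ENNReal.ofReal (x / (n : ℝ) ^ (1 - ρ)) <
              wassersteinPow p μ (empiricalMeasure fun i : Fin n => X i ω)}
          ≤ ENNReal.ofReal C * weakMomentPow μ x₀ (r * p) / ENNReal.ofReal (x ^ r)) := by
  refine ⟨?_, ?_, ?_⟩
  · intro p r hp hr
    -- The number of tolerated outliers depends only on r, hence the constant only on p and r.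
    obtain ⟨k, hk⟩ := exists_nat_gt ((r - 1) / (r / 2 - 1))
    have hr2 : 0 < r / 2 - 1 := by linarith
    rw [div_lt_iff₀ hr2, mul_comm] at hk
    have hk0 : 0 < k := by
      rcases Nat.eq_zero_or_pos k with rfl | h
      · simp only [Nat.cast_zero, mul_zero] at hk
        linarith
      · exact h
    have hk1 : (0 : ℝ) < k := by exact_mod_cast hk0
    refine ⟨(k * 2 ^ (p + 1)) ^ r, by positivity, ?_⟩
    intro α β _ hα hβ E _ _ _ _ μ _ S x₀ hμS hS hA Ω _ P _ X hX ρ hρ hρ1 x hx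
    have h := limsup_measure_lt_wassersteinPow_le_of_two_lt hp hα hβ hμS hS hr
      ENNReal.toReal_nonneg (ENNReal.ofReal_toReal hA.ne).ge hX hk0 hk hρ hρ1 hx
    refine h.trans (le_of_eq ?_)
    rw [ENNReal.ofReal_div_of_pos (by positivity), ENNReal.ofReal_mul (by positivity),
      ENNReal.ofReal_toReal hA.ne]
  · intro p α β hp _ hα hβ
    refine ⟨64 * (2 * 16 ^ p) ^ 2 * (4 ^ p) ^ 2, by positivity, ?_⟩
    intro E _ _ _ _ μ _ S x₀ hμS hS hJ Ω _ P _ X hX ρ hρ hρ1 x hx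
    have h := limsup_measure_lt_wassersteinPow_le_of_sqrtTailIntegral hp hα hβ hμS hS
      ENNReal.toReal_nonneg (ENNReal.ofReal_toReal hJ.ne).ge hX hρ hρ1 hx
    refine h.trans (le_of_eq ?_)
    rw [show 64 * (2 * 16 ^ p) ^ 2 * (4 ^ p * (sqrtTailIntegral μ x₀ p).toReal) ^ 2 / x ^ 2 =
        64 * (2 * 16 ^ p) ^ 2 * (4 ^ p) ^ 2 * (sqrtTailIntegral μ x₀ p).toReal ^ 2 / x ^ 2 by ring,
      ENNReal.ofReal_div_of_pos (by positivity), ENNReal.ofReal_mul (by positivity),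
      ENNReal.ofReal_pow ENNReal.toReal_nonneg, ENNReal.ofReal_toReal hJ.ne]
  · intro p α β r hp _ hα hβ hr1 hr2
    obtain ⟨C, hC, h⟩ := exists_measure_lt_wassersteinPow_le_of_lt_two.{u, v} hp hα hβ hr1 hr2
    refine ⟨C, hC, ?_⟩
    intro E _ _ _ _ μ _ S x₀ hμS hS hA n hn Ω _ P _ X hX ρ _ _ x hx
    have hn0 : (0 : ℝ) < n := by exact_mod_cast hn
    -- The bound was proved for A > 0, but the weak moment vanishes when μ is the point mass at x₀;
    -- it is enlarged by δ and δ tends to 0.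
    have hbound : ∀ δ : ℝ, 0 < δ → ENNReal.ofReal ((n : ℝ) ^ (r * ρ - 1)) *
        P {ω | ENNReal.ofReal (x / (n : ℝ) ^ (1 - ρ)) <
          wassersteinPow p μ (empiricalMeasure fun i : Fin n => X i ω)} ≤
        ENNReal.ofReal (C * ((weakMomentPow μ x₀ (r * p)).toReal + δ) / x ^ r) := by
      intro δ hδ
      have hpos : 0 < (weakMomentPow μ x₀ (r * p)).toReal + δ :=
        add_pos_of_nonneg_of_pos ENNReal.toReal_nonneg hδ
      have h1 := h E μ S x₀ hμS hS _ hpos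
        ((ENNReal.ofReal_toReal hA.ne).ge.trans (ENNReal.ofReal_le_ofReal (by linarith))) n hn Ω P X
        hX (x * (n : ℝ) ^ ρ) (by positivity)
      rw [div_rpow_one_sub_eq hn]
      calc _ ≤ ENNReal.ofReal ((n : ℝ) ^ (r * ρ - 1)) * ENNReal.ofReal
            (C * (n * ((weakMomentPow μ x₀ (r * p)).toReal + δ) / (x * (n : ℝ) ^ ρ) ^ r)) := by
            gcongr
        _ = _ := by
            rw [← ENNReal.ofReal_mul (by positivity)]
            congr 1
            rw [Real.mul_rpow hx.le (by positivity), ← Real.rpow_mul hn0.le, mul_comm ρ,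
              Real.rpow_sub_one hn0.ne']
            field_simp
    have hlim : Tendsto (fun δ : ℝ => ENNReal.ofReal
        (C * ((weakMomentPow μ x₀ (r * p)).toReal + δ) / x ^ r)) (nhdsWithin 0 (Ioi 0))
        (nhds (ENNReal.ofReal (C * ((weakMomentPow μ x₀ (r * p)).toReal + 0) / x ^ r))) := by
      refine ((ENNReal.continuous_ofReal.comp ?_).tendsto 0).mono_left nhdsWithin_le_nhds
      fun_prop
    refine (ge_of_tendsto hlim (by
      filter_upwards [self_mem_nhdsWithin] with δ hδ
      exact hbound δ hδ)).trans (le_of_eq ?_)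
    rw [add_zero, ENNReal.ofReal_div_of_pos (by positivity), ENNReal.ofReal_mul hC.le,
      ENNReal.ofReal_toReal hA.ne]
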